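/- Let $0<\alpha<1$, $\gamma>-\alpha$, let $n,J\ge 1$ be integers, and let $G_0$ be a nonatomic probability measure on a standard Borel space $\mathbb S$. Let $P\sim\mathrm{PYP}(\alpha,\gamma,G_0)$, that is, $P=\tilde\mu/T$, where $\tilde\mu$ is the completely random measure with Lévy intensity $\frac{\alpha}{\Gamma(1-\alpha)}s^{-1-\alpha}\,\mathrm ds\,G_0(\mathrm dx)$, $T=\tilde\mu(\mathbb S)$, and the law of $\tilde\mu$ has been reweighted by the density $\frac{\Gamma(\gamma+1)}{\Gamma(\gamma/\alpha+1)}T^{-\gamma}$. Given $P$, let $X_1,\dots,X_{n+1}$ be i.i.d. with law $P$. Let $h:\mathbb S\to[J]=\{1,\dots,J\}$ be a random hash function, independent of $P$ and of the sample, such that $\Pr[h(x_1)=j_1,h(x_2)=j_2]=J^{-2}$ for all $x_1\ne x_2$ in $\mathbb S$ and all $j_1,j_2\in[J]$. Independence means that, given $P$ and $X_1=x_1,\dots,X_{n+1}=x_{n+1}$, the vector $(h(X_1),\dots,h(X_{n+1}))$ has the law of $(h(x_1),\dots,h(x_{n+1}))$; the finite-dimensional laws of $h$ are assumed to depend measurably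 on the symbols that are hashed. Let $\mathbf C_J=(C_1,\dots,C_J)$ with $C_j=\#\{i\le n: h(X_i)=j\}$ be the sketch of $X_1,\dots,X_n$, let $f_{X_{n+1}}=\#\{i\le n: X_i=X_{n+1}\}$, let $M_{l,n}$ be the number of distinct symbols that occur exactly $l$ times in $X_1,\dots,X_n$, and let $K_n$ be the number of distinct symbols in $X_1,\dots,X_n$. Write $(a)_{(m)}=\prod_{i=0}^{m-1}(a+i)$ and $$\mathscr C(m,k;\alpha)=\frac1{k!}\sum_{i=0}^{k}(-1)^i\binom ki(-i\alpha)_{(m)} .$$ For $\mathbf d\in\mathbb N_0^J$ and $a\in\mathbb R$ put $$\Sigma(a,\mathbf d)=\sum_{\mathbf i\in\times_{k=1}^{J}\{0,\dots,d_k\}}\frac{\Gamma(a+|\mathbf i|)}{J^{|\mathbf i|}}\prod_{k=1}^J\mathscr C(d_k,i_k;\alpha),\qquad |\mathbf i|=\sum_{k=1}^J i_k ,$$ where the terms with a vanishing product are read as $0$. Then for every $\mathbf c\in\mathbb N_0^J$ with $\sum_j c_j=n$ we have $\Pr[\mathbf C_J=\mathbf c]>0$, and for every $l\in\{1,\dots,n\}$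 $$\Pr[f_{X_{n+1}}=l\mid\mathbf C_J=\mathbf c]=\frac{\alpha/J}{\gamma+n}\,(1-\alpha)_{(l)}\sum_{j:\,c_j\ge l}\binom{c_j}{l}\frac{\Sigma\!\left(\frac{\gamma+\alpha}{\alpha},\mathbf c-l\,\mathbf e_j\right)}{\Sigma\!\left(\frac{\gamma}{\alpha},\mathbf c\right)},$$ where $\mathbf e_j$ is the $j$-th unit vector. Moreover, for every $l\in\{1,\dots,n\}$, $$\Pr[f_{X_{n+1}}=l\mid\mathbf C_J=\mathbf c]=\frac{l-\alpha}{\gamma+n}\,\mathbb E[M_{l,n}\mid\mathbf C_J=\mathbf c],$$ so that the posterior means of $M_{l,n}$ and of $K_n$ are $$\mathbb E[M_{l,n}\mid\mathbf C_J=\mathbf c]=\frac{\gamma+n}{l-\alpha}\Pr[f_{X_{n+1}}=l\mid\mathbf C_J=\mathbf c],\qquad \mathbb E[K_n\mid\mathbf C_J=\mathbf c]=\sum_{l=1}^n\frac{\gamma+n}{l-\alpha}\Pr[f_{X_{n+1}}=l\mid\mathbf C_J=\mathbf c],$$ with the closed form above inserted for $\Pr[f_{X_{n+1}}=l\mid\mathbf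 C_J=\mathbf c]$. -/

import Mathlib

open MeasureTheory ProbabilityTheory
open scoped ENNReal

noncomputable section

/-! ### Completely random measures, Poisson-Kingman priors and the Pitman-Yor process -/

/-- `Q`, a law on the space of measures on `E`, is the law of a Poisson random measure with
intensity `ν`: the masses of disjoint sets are independent, and the mass of a set of finite
intensity `ν B` is Poisson distributed with mean `ν B`. -/
structure IsPoissonRandomMeasure {E : Type*} [MeasurableSpace E] (ν : Measure E)
    (Q : Measure (Measure E)) : Prop where
  isProbabilityMeasure : IsProbabilityMeasure Q
  map_eval : ∀ B : Set E, MeasurableSet B → ν B < ∞ →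
    Q.map (fun N => N B) = (poissonMeasure (ν B).toNNReal).map (fun m : ℕ => (m : ℝ≥0∞))
  indep : ∀ (k : ℕ) (B : Fin k → Set E), (∀ i, MeasurableSet (B i)) →
    Pairwise (fun i i' => Disjoint (B i) (B i')) → iIndepFun (fun i N => N (B i)) Q

/-- The homogeneous Lévy intensity `θ ρ(s) ds G₀(dx)` on `ℝ₊ × S`. -/
def levyIntensity {S : Type*} [MeasurableSpace S] (θ : ℝ) (ρ : ℝ → ℝ) (G₀ : Measure S) :
    Measure (ℝ × S) :=
  ((volume.restrict (Set.Ioi (0 : ℝ))).withDensity (fun s => ENNReal.ofReal (θ * ρ s))).prod G₀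

/-- The measure `A ↦ ∫ s N(ds, A)` on `S`: every atom `(s, x)` of `N` contributes a jump of
size `s` at the location `x`. -/
def jumpMeasure {S : Type*} [MeasurableSpace S] (N : Measure (ℝ × S)) : Measure S :=
  (N.withDensity (fun p => ENNReal.ofReal p.1)).map Prod.snd

/-- `M`, a law on the space of measures on `S`, is the law of the completely random measure
`CRM(θ, ρ, G₀)`. -/
def IsCRM {S : Type*} [MeasurableSpace S] (θ : ℝ) (ρ : ℝ → ℝ) (G₀ : Measure S)
    (M : Measure (Measure S)) : Prop :=
  ∃ Q : Measure (Measure (ℝ × S)),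
    IsPoissonRandomMeasure (levyIntensity θ ρ G₀) Q ∧ M = Q.map jumpMeasure

/-- The normalization `μ / μ(S)`. -/
def normalizedMeasure {S : Type*} [MeasurableSpace S] (μ : Measure S) : Measure S :=
  (μ Set.univ)⁻¹ • μ

/-- `Λ` is the Poisson-Kingman prior with parameters `(θ, ρ, g f_T, G₀)`: the law of the
normalization of `μ ∼ CRM(θ, ρ, G₀)` after the law of `μ` has been reweighted by the density
`g(T)` in the total mass `T = μ(S)`, where `E[g(T)] = 1`. (Given `T`, the law of the normalized
measure is unchanged, while the law `f_T` of `T` becomes `g f_T`.) -/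
def IsPoissonKingman {S : Type*} [MeasurableSpace S] (θ : ℝ) (ρ g : ℝ → ℝ) (G₀ : Measure S)
    (Λ : Measure (Measure S)) : Prop :=
  ∃ M : Measure (Measure S), IsCRM θ ρ G₀ M ∧
    (∫⁻ μ : Measure S, ENNReal.ofReal (g (μ Set.univ).toReal) ∂M) = 1 ∧
    Λ = (M.withDensity
      (fun μ : Measure S => ENNReal.ofReal (g (μ Set.univ).toReal))).map normalizedMeasure

/-- `Λ` is the Pitman-Yor process prior `PYP(α, γ, G₀)`: the Poisson-Kingman prior obtained from
the `α`-stable completely random measure by polynomial tilting of its total mass. -/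
def IsPitmanYor {S : Type*} [MeasurableSpace S] (α γ : ℝ) (G₀ : Measure S)
    (Λ : Measure (Measure S)) : Prop :=
  IsPoissonKingman 1 (fun s => α / Real.Gamma (1 - α) * s ^ (-1 - α))
    (fun t => Real.Gamma (γ + 1) / Real.Gamma (γ / α + 1) * t ^ (-γ)) G₀ Λ

/-! ### Sampling and hashing -/

/-- `X₁, …, X_m | P` are independent and identically distributed with law `P`. -/
structure IsConditionallyIID {Ω S : Type*} [MeasurableSpace Ω] [MeasurableSpace S]
    (Pr : Measure Ω) (P : Ω → Measure S) {m : ℕ} (X : Fin m → Ω → S) : Prop where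
  measurable_random_measure : Measurable P
  measurable_sample : ∀ i, Measurable (X i)
  law : ∀ B : Set (Measure S), MeasurableSet B → ∀ A : Fin m → Set S,
    (∀ i, MeasurableSet (A i)) →
    Pr {ω | P ω ∈ B ∧ ∀ i, X i ω ∈ A i} = ∫⁻ ω in {ω | P ω ∈ B}, ∏ i, P ω (A i) ∂Pr

/-- `h` is a random hash function from `S` to `[J]`, drawn from a pairwise independent family.
(Measurability of the finite-dimensional laws in the hashed symbols is what makes it meaningful
to hash random symbols.) -/
structure IsPairwiseIndependentHash {Ω S : Type*} [MeasurableSpace Ω] [MeasurableSpace S]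
    (Pr : Measure Ω) {J : ℕ} (h : Ω → S → Fin J) : Prop where
  measurable_eval : ∀ x, Measurable (fun ω => h ω x)
  measurable_law : ∀ (m : ℕ) (j : Fin m → Fin J),
    Measurable (fun x : Fin m → S => Pr {ω | ∀ i, h ω (x i) = j i})
  pairwise : ∀ x₁ x₂ : S, x₁ ≠ x₂ → ∀ j₁ j₂ : Fin J,
    Pr {ω | h ω x₁ = j₁ ∧ h ω x₂ = j₂} = ((J : ℝ≥0∞) ^ 2)⁻¹

/-- The random hash function `h` is independent of `(P, X₁, …, X_m)`: given `P` and
`X₁ = x₁, …, X_m = x_m`, the hash values `(h(X₁), …, h(X_m))` have the law of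
`(h(x₁), …, h(x_m))`. For a jointly measurable `(ω, x) ↦ h ω x` this is a consequence of ordinary
independence. It is stated directly because no jointly measurable hash function into at least two
buckets is pairwise independent on a diffuse standard Borel space, and without joint measurability
the independence of the generated `σ`-algebras alone does not determine the law of the values
`h(X_i)`. -/
structure IsIndependentHash {Ω S : Type*} [MeasurableSpace Ω] [MeasurableSpace S]
    (Pr : Measure Ω) {J m : ℕ} (h : Ω → S → Fin J) (P : Ω → Measure S)
    (X : Fin m → Ω → S) : Prop where
  measurable_hash : ∀ i, Measurable (fun ω => h ω (X i ω))
  law : ∀ B : Set (Measure S), MeasurableSet B → ∀ A : Set (Fin m → S), MeasurableSet A →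
    ∀ j : Fin m → Fin J,
    Pr {ω | P ω ∈ B ∧ (fun i => X i ω) ∈ A ∧ ∀ i, h ω (X i ω) = j i} =
      ∫⁻ ω in {ω | P ω ∈ B ∧ (fun i => X i ω) ∈ A}, Pr {ω' | ∀ i, h ω' (X i ω) = j i} ∂Pr

/-! ### Statistics of a sample -/

/-- The sketch of `(x₁, …, x_n)`: bucket `j` counts the `i` with `h(x_i) = j`. -/
def sketch {S : Type*} {J n : ℕ} (h : S → Fin J) (x : Fin n → S) : Fin J → ℕ :=
  fun j => (Finset.univ.filter (fun i => h (x i) = j)).card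

open Classical in
/-- The empirical frequency of the symbol `y` in `(x₁, …, x_n)`. -/
def frequency {S : Type*} {n : ℕ} (x : Fin n → S) (y : S) : ℕ :=
  (Finset.univ.filter (fun i => x i = y)).card

open Classical in
/-- The `l`-cardinality: the number of distinct symbols with frequency `l` in the sample. -/
def lCardinality {S : Type*} {n : ℕ} (x : Fin n → S) (l : ℕ) : ℕ :=
  ((Finset.univ.image x).filter (fun y => frequency x y = l)).card

open Classical in
/-- The cardinality: the number of distinct symbols in the sample. -/
def cardinality {S : Type*} {n : ℕ} (x : Fin n → S) : ℕ :=
  (Finset.univ.image x).card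

/-! ### The closed form -/

/-- The rising factorial `a (a + 1) ⋯ (a + n - 1)`. -/
def risingFactorial (a : ℝ) (n : ℕ) : ℝ := ∏ i ∈ Finset.range n, (a + i)

/-- The generalized factorial coefficient `𝒞(n, k; α)`. -/
def genFactorialCoeff (n k : ℕ) (α : ℝ) : ℝ :=
  (1 / (k.factorial : ℝ)) * ∑ i ∈ Finset.range (k + 1),
    (-1 : ℝ) ^ i * (k.choose i : ℝ) * risingFactorial (-(i : ℝ) * α) n

/-- `∑_{i ∈ ×ₖ {0, …, dₖ}} Γ(a + |i|) J^{-|i|} ∏ₖ 𝒞(dₖ, iₖ; α)`. -/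
def bucketSum {J : ℕ} (α a : ℝ) (d : Fin J → ℕ) : ℝ :=
  ∑ i ∈ Fintype.piFinset (fun k => Finset.range (d k + 1)),
    Real.Gamma (a + ((∑ k, i k : ℕ) : ℝ)) / (J : ℝ) ^ (∑ k, i k) *
      ∏ k, genFactorialCoeff (d k) (i k) α

/-- The closed form of the probability that the next symbol has frequency `l`, given the sketch
`c`. In the `j`-th numerator the count of bucket `j` is decreased by `l`; if `c j < l`, then the
binomial coefficient vanishes. -/
def frequencyClosedForm {J : ℕ} (α γ : ℝ) (n : ℕ) (c : Fin J → ℕ) (l : ℕ) : ℝ :=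
  (α / J) / (γ + n) * risingFactorial (1 - α) l *
    ∑ j, ((c j).choose l : ℝ) *
      (bucketSum α ((γ + α) / α) (fun k => c k - if k = j then l else 0) /
        bucketSum α (γ / α) c)

end

/-! The law of the sample is written as a mixture over set partitions, and the statistics then
become weighted counts of blocks.

For the stable completely random measure, the masses of the cells of a finite partition have joint
Laplace transform `∏ exp (-g_k λ_k ^ α)`, where `g_k` is the `G₀`-mass of the cell. Differentiating
it produces mixed moments damped by an exponential, expressed by the polynomials with coefficients
`genFactorialCoeff`. Normalization and tilting together contribute a power `T ^ (-(γ + n))`, which a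
gamma integral over a latent variable `u` turns into `exp (-u T)`. The joint moments of the
Pitman-Yor masses are therefore integrals over `u` of products over the cells
(`IsPitmanYor.lintegral_prod_pow`). Summing products of `blockWeight` over set partitions gives the
same polynomials: removing the block of a chosen point and applying Leibniz' rule to the stable
Laplace transform yield one and the same recursion (`partitionSum_eq_prod`,
`genFactorialPoly_eval_succ_eq_sum`). So a sample arises by drawing a partition with weight
`partitionWeight` and labelling its blocks independently by `G₀` (`eq_samplingLaw`).

Pairwise independence of the hash suffices. The centred indicators of the events `h x = v` are
orthogonal in `L²`, so by Bessel's inequality a fixed event is correlated with at most countably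
many of them. As `G₀` is diffuse, the block labels almost surely avoid these, and the hash values of
distinct blocks behave as independent uniform ones (`IsPairwiseIndependentHash.ae_pi_fin`).

Prescribed hash values hence force every block into one bucket and cost a factor `1 / J` per block.
For fixed `u` the sum over partitions factorizes over the buckets, and integrating out `u` leaves
`bucketSum α (γ / α) c`. Marking a block of size `l` in bucket `j` gives a binomial coefficient and
the same product with `c j` lowered by `l`; the extra power `u ^ α` shifts `γ` to `γ + α`. The count
`M_{l,n}` marks a block of size `l` among `n` points, whereas the event that the last symbol has
frequency `l` marks the block of size `l + 1` containing the last of `n + 1` points. The two answers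
differ by `(1 - α)_{(l)} / (1 - α)_{(l-1)} = l - α` and by `Γ(γ + n + 1) / Γ(γ + n) = γ + n`, which
is the relation between them. -/

/-- The sum over all set partitions of `s` of the product of the weights of the blocks. -/
def partitionSum {ι R : Type*} [DecidableEq ι] [CommSemiring R] (w : Finset ι → R)
    (s : Finset ι) : R :=
  ∑ π : Finpartition s, ∏ B ∈ π.parts, w B

/-! ### Sums over set partitions -/

section PartitionSum

variable {ι R : Type*} [DecidableEq ι] [CommSemiring R]

lemma partitionSum_empty (w : Finset ι → R) : partitionSum w ∅ = 1 := by
  have : Unique (Finpartition (∅ : Finset ι)) := inferInstanceAs (Unique (Finpartition ⊥))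
  rw [partitionSum, Fintype.sum_unique]
  have h : (default : Finpartition (∅ : Finset ι)).parts = ∅ :=
    Finpartition.parts_eq_empty_iff.2 rfl
  rw [h, Finset.prod_empty]

/-- Deleting the block `B` is a bijection onto the partitions of `s \ B`, with inverse
`Finpartition.extend`. -/
lemma sum_prod_parts_of_mem (w : Finset ι → R) {s B : Finset ι} (hB : B ⊆ s) (hne : B.Nonempty) :
    ∑ π : Finpartition s with B ∈ π.parts, ∏ C ∈ π.parts, w C = w B * partitionSum w (s \ B) := by
  rw [partitionSum, Finset.mul_sum]
  symm
  have hb : B ≠ ⊥ := hne.ne_empty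
  refine Finset.sum_bij (fun π _ => π.extend hb disjoint_sdiff_self_left
    (Finset.sdiff_union_of_subset hB)) ?_ ?_ ?_ ?_
  · intro π _
    simp
  · intro π₁ _ π₂ _ h
    have hn : ∀ π : Finpartition (s \ B), B ∉ π.parts := fun π hm => by
      obtain ⟨x, hx⟩ := hne
      exact (Finset.mem_sdiff.1 (π.subset hm hx)).2 hx
    have h' := congrArg Finpartition.parts h
    simp only [Finpartition.extend_parts] at h'
    ext1
    rw [← Finset.erase_insert (hn π₁), h', Finset.erase_insert (hn π₂)]
  · intro π hπ
    have hBπ : B ∈ π.parts := (Finset.mem_filter.1 hπ).2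
    refine ⟨π.ofSubset (Finset.erase_subset B _) ?_, Finset.mem_univ _, ?_⟩
    · ext x
      simp only [Finset.mem_sup, Finset.mem_erase, id, Finset.mem_sdiff]
      constructor
      · rintro ⟨C, ⟨hCB, hC⟩, hx⟩
        exact ⟨π.subset hC hx, fun hxB => hCB (π.eq_of_mem_parts hC hBπ hx hxB)⟩
      · rintro ⟨hx, hxB⟩
        obtain ⟨C, hC, hxC⟩ := π.exists_mem hx
        exact ⟨C, ⟨fun h => hxB (h ▸ hxC), hC⟩, hxC⟩
    · ext1
      simp [Finset.insert_erase hBπ]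
  · intro π _
    rw [Finpartition.extend_parts, Finset.prod_insert]
    intro hm
    obtain ⟨x, hx⟩ := hne
    exact (Finset.mem_sdiff.1 (π.subset hm hx)).2 hx

/-- Exchange of summation: mark a block first, then partition the rest. With indicators for `f`,
this evaluates every block statistic needed below. -/
lemma sum_prod_parts_mul_sum (w f : Finset ι → R) (s : Finset ι) :
    ∑ π : Finpartition s, (∏ B ∈ π.parts, w B) * ∑ B ∈ π.parts, f B =
      ∑ B ∈ s.powerset with B.Nonempty, f B * (w B * partitionSum w (s \ B)) := by
  have h1 : ∀ π : Finpartition s, (∏ B ∈ π.parts, w B) * ∑ B ∈ π.parts, f B =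
      ∑ B ∈ s.powerset with B.Nonempty,
        if B ∈ π.parts then f B * ∏ B ∈ π.parts, w B else 0 := by
    intro π
    rw [← Finset.sum_filter, Finset.mul_sum]
    refine Finset.sum_congr ?_ fun B _ => mul_comm _ _
    ext B
    simp only [Finset.mem_filter, Finset.mem_powerset]
    exact ⟨fun h => ⟨⟨π.subset h, π.nonempty_of_mem_parts h⟩, h⟩, fun h => h.2⟩
  simp_rw [h1]
  rw [Finset.sum_comm]
  refine Finset.sum_congr rfl fun B hB => ?_
  simp only [Finset.mem_filter, Finset.mem_powerset] at hB
  rw [← Finset.sum_filter, ← Finset.mul_sum, sum_prod_parts_of_mem w hB.1 hB.2]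

/-- Exactly one block contains `a`, so the indicator of `a ∈ B` sums to one over the blocks, and
marking that block costs nothing. -/
lemma partitionSum_insert (w : Finset ι → R) {s : Finset ι} {a : ι} (ha : a ∉ s) :
    partitionSum w (insert a s) =
      ∑ B ∈ s.powerset, w (insert a B) * partitionSum w (s \ B) := by
  have h1 : ∀ π : Finpartition (insert a s),
      ∑ B ∈ π.parts, (if a ∈ B then (1 : R) else 0) = 1 := by
    intro π
    have : π.parts.filter (fun B => a ∈ B) = {π.part a} := by
      ext B
      simp only [Finset.mem_filter, Finset.mem_singleton]
      refine ⟨fun h => (π.part_eq_of_mem h.1 h.2).symm, ?_⟩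
      rintro rfl
      exact ⟨π.part_mem.2 (Finset.mem_insert_self _ _),
        π.mem_part_self.2 (Finset.mem_insert_self _ _)⟩
    rw [← Finset.sum_filter, this, Finset.sum_singleton]
  have h2 := sum_prod_parts_mul_sum w (fun B => if a ∈ B then (1 : R) else 0) (insert a s)
  simp_rw [h1, mul_one, ite_mul, one_mul, zero_mul] at h2
  rw [partitionSum, h2, ← Finset.sum_filter, Finset.filter_filter]
  symm
  refine Finset.sum_bij (fun B _ => insert a B) ?_ ?_ ?_ ?_
  · intro B hB
    simp only [Finset.mem_filter, Finset.mem_powerset] at hB ⊢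
    exact ⟨Finset.insert_subset_insert _ hB, Finset.insert_nonempty _ _,
      Finset.mem_insert_self _ _⟩
  · intro B hB C hC h
    have hB' : a ∉ B := fun h => ha (Finset.mem_powerset.1 hB h)
    have hC' : a ∉ C := fun h => ha (Finset.mem_powerset.1 hC h)
    rw [← Finset.erase_insert hB', h, Finset.erase_insert hC']
  · intro B hB
    simp only [Finset.mem_filter, Finset.mem_powerset] at hB
    exact ⟨B.erase a, Finset.mem_powerset.2 (Finset.subset_insert_iff.1 hB.1),
      Finset.insert_erase hB.2.2⟩
  · intro B hB
    rw [Finset.insert_sdiff_insert, Finset.sdiff_insert_of_notMem ha]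

/-- If only the blocks of constant colour have nonzero weight, and their weight is a function of
the colour and the size, then the sum over set partitions factorizes over the colours. -/
lemma partitionSum_eq_prod {κ : Type*} [Fintype κ] [DecidableEq κ] (r : ι → κ)
    (w : Finset ι → R) (v Y : κ → ℕ → R)
    (hw : ∀ a B, (∀ i ∈ B, r i = r a) → a ∉ B → w (insert a B) = v (r a) (B.card + 1))
    (hw0 : ∀ a b B, a ∈ B → b ∈ B → r a ≠ r b → w B = 0)
    (hY0 : ∀ k, Y k 0 = 1)
    (hY : ∀ k m, Y k (m + 1) =
      ∑ i ∈ Finset.range (m + 1), (m.choose i : R) * (v k (i + 1) * Y k (m - i)))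
    (s : Finset ι) :
    partitionSum w s = ∏ k, Y k (s.filter (fun i => r i = k)).card := by
  induction s using Finset.strongInduction with
  | _ s ih =>
  rcases s.eq_empty_or_nonempty with rfl | ⟨a, ha⟩
  · simp [partitionSum_empty, hY0]
  obtain ⟨s, hs, rfl⟩ : ∃ t, a ∉ t ∧ s = insert a t :=
    ⟨s.erase a, Finset.notMem_erase _ _, (Finset.insert_erase ha).symm⟩
  rw [partitionSum_insert w hs]
  set t := s.filter (fun i => r i = r a) with ht
  -- The companions of `a` in its block must have its colour; all other choices of `B` have weight
  -- zero.
  have hts : t.powerset ⊆ s.powerset := Finset.powerset_mono.2 (Finset.filter_subset _ _)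
  rw [← Finset.sum_subset hts]
  swap
  · intro B hB hBt
    have : ∃ b ∈ B, r b ≠ r a := by
      by_contra! hcon
      refine hBt (Finset.mem_powerset.2 fun b hb => ?_)
      exact Finset.mem_filter.2 ⟨Finset.mem_powerset.1 hB hb, hcon b hb⟩
    obtain ⟨b, hb, hba⟩ := this
    rw [hw0 b a _ (Finset.mem_insert_of_mem hb) (Finset.mem_insert_self _ _) hba, zero_mul]
  -- Removing the block of `a` changes only the colour class of `a`, so the factors of the other
  -- colours can be pulled out and `hY` applied to the one that remains.
  have hterm : ∀ B ∈ t.powerset, w (insert a B) * partitionSum w (s \ B) =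
      (v (r a) (B.card + 1) * Y (r a) (t.card - B.card)) *
        ∏ k ∈ Finset.univ.erase (r a), Y k (s.filter (fun i => r i = k)).card := by
    intro B hB
    rw [Finset.mem_powerset] at hB
    have haB : a ∉ B := fun h => hs (Finset.mem_filter.1 (hB h)).1
    rw [hw a B (fun i hi => (Finset.mem_filter.1 (hB hi)).2) haB,
      ih (s \ B) (lt_of_le_of_lt Finset.sdiff_subset (Finset.ssubset_insert hs)),
      ← Finset.mul_prod_erase _ _ (Finset.mem_univ (r a)), ← mul_assoc]
    congr 1
    · congr 2
      rw [← Finset.card_sdiff_of_subset hB]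
      congr 1
      ext i
      simp only [ht, Finset.mem_filter, Finset.mem_sdiff]
      tauto
    · refine Finset.prod_congr rfl fun k hk => ?_
      congr 2
      ext i
      simp only [Finset.mem_filter, Finset.mem_sdiff]
      refine ⟨fun h => ⟨h.1.1, h.2⟩, fun h => ⟨⟨h.1, fun hi => ?_⟩, h.2⟩⟩
      exact (Finset.mem_erase.1 hk).1 (h.2.symm.trans (Finset.mem_filter.1 (hB hi)).2)
  rw [Finset.sum_congr rfl hterm, ← Finset.sum_mul,
    Finset.sum_powerset_apply_card (fun m => v (r a) (m + 1) * Y (r a) (t.card - m)),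
    ← Finset.mul_prod_erase _ _ (Finset.mem_univ (r a))]
  congr 1
  · rw [Finset.filter_insert, if_pos rfl, Finset.card_insert_of_notMem (by simp [hs]), hY]
    simp only [nsmul_eq_mul, ht]
  · refine Finset.prod_congr rfl fun k hk => ?_
    rw [Finset.filter_insert, if_neg (fun h => (Finset.mem_erase.1 hk).1 h.symm)]

end PartitionSum

/-! ### Generalized factorial coefficients and derivatives of the stable Laplace transform -/

section GenFactorial

variable {α : ℝ}

lemma risingFactorial_succ (a : ℝ) (n : ℕ) :
    risingFactorial a (n + 1) = risingFactorial a n * (a + n) :=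
  Finset.prod_range_succ _ _

lemma risingFactorial_nonneg {a : ℝ} (ha : 0 ≤ a) (n : ℕ) : 0 ≤ risingFactorial a n :=
  Finset.prod_nonneg fun i _ => by positivity

lemma genFactorialCoeff_succ_zero (n : ℕ) : genFactorialCoeff (n + 1) 0 α = 0 := by
  simp [genFactorialCoeff, risingFactorial, Finset.prod_range_succ']

lemma genFactorialCoeff_zero_zero : genFactorialCoeff 0 0 α = 1 := by
  simp [genFactorialCoeff, risingFactorial]

lemma genFactorialCoeff_zero_succ (k : ℕ) : genFactorialCoeff 0 (k + 1) α = 0 := by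
  have h : ∑ i ∈ Finset.range (k + 1 + 1), (-1 : ℝ) ^ i * ((k + 1).choose i : ℝ) = 0 := by
    have := Int.alternating_sum_range_choose_of_ne (Nat.succ_ne_zero k)
    exact_mod_cast this
  simp [genFactorialCoeff, risingFactorial, h]

/-- The new factor `n - i α` splits as `(n - (k + 1) α) + (k + 1 - i) α`, and `(k + 1 - i)` turns
the binomial coefficient of `k + 1` into `k + 1` times that of `k`. -/
lemma genFactorialCoeff_succ_succ (n k : ℕ) :
    genFactorialCoeff (n + 1) (k + 1) α =
      (n - (k + 1) * α) * genFactorialCoeff n (k + 1) α + α * genFactorialCoeff n k α := by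
  have h1 : ∀ i ∈ Finset.range (k + 1 + 1),
      (-1 : ℝ) ^ i * ((k + 1).choose i : ℝ) * risingFactorial (-(i : ℝ) * α) (n + 1) =
      (n - (k + 1) * α) * ((-1 : ℝ) ^ i * ((k + 1).choose i : ℝ) *
        risingFactorial (-(i : ℝ) * α) n) +
      α * ((-1 : ℝ) ^ i * (((k + 1).choose i : ℝ) * (k + 1 - i)) *
        risingFactorial (-(i : ℝ) * α) n) := by
    intro i _
    rw [risingFactorial_succ]
    ring
  have h2 : ∀ i ∈ Finset.range (k + 1),
      (-1 : ℝ) ^ i * (((k + 1).choose i : ℝ) * (k + 1 - i)) * risingFactorial (-(i : ℝ) * α) n =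
      (k + 1) * ((-1 : ℝ) ^ i * (k.choose i : ℝ) * risingFactorial (-(i : ℝ) * α) n) := by
    intro i hi
    have hle : i ≤ k := Nat.lt_succ_iff.1 (Finset.mem_range.1 hi)
    have h := Nat.choose_mul_succ_eq k i
    have h' : (k.choose i : ℝ) * (k + 1) = ((k + 1).choose i : ℝ) * (k + 1 - i) := by
      have := congrArg (Nat.cast (R := ℝ)) h
      push_cast [Nat.cast_sub (hle.trans (Nat.le_succ k))] at this
      exact this
    rw [← h']
    ring
  unfold genFactorialCoeff
  rw [Finset.sum_congr rfl h1, Finset.sum_add_distrib, ← Finset.mul_sum, ← Finset.mul_sum,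
    Finset.sum_range_succ (fun i => (-1 : ℝ) ^ i * (((k + 1).choose i : ℝ) * (k + 1 - i)) *
        risingFactorial (-(i : ℝ) * α) n), Finset.sum_congr rfl h2, ← Finset.mul_sum]
  have hk : (k.factorial : ℝ) ≠ 0 := by positivity
  push_cast [Nat.factorial_succ]
  field_simp
  ring

lemma genFactorialCoeff_eq_zero_of_lt {n k : ℕ} (h : n < k) : genFactorialCoeff n k α = 0 := by
  induction n generalizing k with
  | zero => obtain ⟨k, rfl⟩ := Nat.exists_eq_succ_of_ne_zero h.ne'
            exact genFactorialCoeff_zero_succ k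
  | succ n ih =>
    obtain ⟨k, rfl⟩ := Nat.exists_eq_succ_of_ne_zero (Nat.ne_zero_of_lt h)
    rw [Nat.succ_eq_add_one, genFactorialCoeff_succ_succ, ih (by omega), ih (by omega)]
    simp

lemma genFactorialCoeff_self (n : ℕ) : genFactorialCoeff n n α = α ^ n := by
  induction n with
  | zero => simp [genFactorialCoeff_zero_zero]
  | succ n ih =>
    rw [genFactorialCoeff_succ_succ, genFactorialCoeff_eq_zero_of_lt (Nat.lt_succ_self n), ih]
    ring

/-- In the recurrence the factor `n - (k + 1) α` can be negative only if `n < k + 1`, and then the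
coefficient it multiplies vanishes. -/
lemma genFactorialCoeff_nonneg (h0 : 0 < α) (h1 : α < 1) (n k : ℕ) :
    0 ≤ genFactorialCoeff n k α := by
  induction n generalizing k with
  | zero =>
    cases k with
    | zero => simp [genFactorialCoeff_zero_zero]
    | succ k => simp [genFactorialCoeff_zero_succ]
  | succ n ih =>
    cases k with
    | zero => simp [genFactorialCoeff_succ_zero]
    | succ k =>
      rw [genFactorialCoeff_succ_succ]
      refine add_nonneg ?_ (mul_nonneg h0.le (ih k))
      rcases lt_or_ge n (k + 1) with h | h
      · rw [genFactorialCoeff_eq_zero_of_lt h, mul_zero]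
      · refine mul_nonneg ?_ (ih _)
        have : ((k : ℝ) + 1) ≤ n := by exact_mod_cast h
        nlinarith

/-- The polynomial whose coefficients are the generalized factorial coefficients. -/
noncomputable def genFactorialPoly (α : ℝ) (n : ℕ) : Polynomial ℝ :=
  ∑ k ∈ Finset.range (n + 1), Polynomial.C (genFactorialCoeff n k α) * Polynomial.X ^ k

lemma coeff_genFactorialPoly (n k : ℕ) :
    (genFactorialPoly α n).coeff k = genFactorialCoeff n k α := by
  simp only [genFactorialPoly, Polynomial.finsetSum_coeff, Polynomial.coeff_C_mul_X_pow]
  rw [Finset.sum_ite_eq]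
  split_ifs with h
  · rfl
  · rw [genFactorialCoeff_eq_zero_of_lt]
    simpa using h

lemma genFactorialPoly_zero : genFactorialPoly α 0 = 1 := by
  simp [genFactorialPoly, genFactorialCoeff_zero_zero]

/-- The triangular recurrence in the form `p ↦ n p + α x (p - p')`, which is what one
differentiation of `exp (-g y ^ α)` does to the polynomial factor. -/
lemma genFactorialPoly_succ (n : ℕ) :
    genFactorialPoly α (n + 1) =
      Polynomial.C (n : ℝ) * genFactorialPoly α n +
        Polynomial.C α * (Polynomial.X * genFactorialPoly α n) -
        Polynomial.C α * (Polynomial.X * Polynomial.derivative (genFactorialPoly α n)) := by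
  ext k
  cases k with
  | zero =>
    simp only [coeff_genFactorialPoly, Polynomial.coeff_sub, Polynomial.coeff_add,
      Polynomial.coeff_C_mul, Polynomial.coeff_X_mul_zero, genFactorialCoeff_succ_zero]
    cases n with
    | zero => simp
    | succ n => simp [genFactorialCoeff_succ_zero]
  | succ k =>
    simp only [coeff_genFactorialPoly, Polynomial.coeff_sub, Polynomial.coeff_add,
      Polynomial.coeff_C_mul, Polynomial.coeff_X_mul, Polynomial.coeff_derivative,
      genFactorialCoeff_succ_succ]
    ring

lemma genFactorialPoly_eval (n : ℕ) (z : ℝ) :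
    (genFactorialPoly α n).eval z =
      ∑ k ∈ Finset.range (n + 1), genFactorialCoeff n k α * z ^ k := by
  simp [genFactorialPoly, Polynomial.eval_finsetSum]

lemma genFactorialPoly_eval_nonneg (h0 : 0 < α) (h1 : α < 1) (n : ℕ) {z : ℝ} (hz : 0 ≤ z) :
    0 ≤ (genFactorialPoly α n).eval z := by
  rw [genFactorialPoly_eval]
  exact Finset.sum_nonneg fun k _ =>
    mul_nonneg (genFactorialCoeff_nonneg h0 h1 _ _) (pow_nonneg hz _)

open Filter Topology

lemma hasDerivAt_neg_rpow {t : ℝ} (ht : t < 0) (p : ℝ) :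
    HasDerivAt (fun t : ℝ => (-t) ^ p) (-(p * (-t) ^ (p - 1))) t := by
  have := (hasDerivAt_neg t).rpow_const (p := p) (Or.inl (by linarith : -t ≠ 0))
  convert this using 1
  ring

/-- The variable is `t = -λ` with `λ > 0`, as in a moment generating function; this removes the
alternating signs of the Laplace transform. -/
lemma iteratedDeriv_stable (g : ℝ) (n : ℕ) {t : ℝ} (ht : t < 0) :
    iteratedDeriv n (fun t : ℝ => Real.exp (-(g * (-t) ^ α))) t =
      ((-t) ^ n)⁻¹ * (genFactorialPoly α n).eval (g * (-t) ^ α) *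
        Real.exp (-(g * (-t) ^ α)) := by
  induction n generalizing t with
  | zero => simp [genFactorialPoly_zero]
  | succ n ih =>
    rw [iteratedDeriv_succ]
    have hev : iteratedDeriv n (fun t : ℝ => Real.exp (-(g * (-t) ^ α))) =ᶠ[𝓝 t]
        fun t => ((-t) ^ n)⁻¹ * (genFactorialPoly α n).eval (g * (-t) ^ α) *
          Real.exp (-(g * (-t) ^ α)) := by
      filter_upwards [Iio_mem_nhds ht] with s hs using ih hs
    rw [hev.deriv_eq]
    have hpos : 0 < -t := by linarith
    have h1 : HasDerivAt (fun t : ℝ => g * (-t) ^ α) (-(g * (α * (-t) ^ (α - 1)))) t :=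
      ((hasDerivAt_neg_rpow ht α).const_mul g).congr_deriv (by ring)
    have h1n : HasDerivAt (fun t : ℝ => -(g * (-t) ^ α)) (g * (α * (-t) ^ (α - 1))) t :=
      h1.neg.congr_deriv (neg_neg _)
    have h2 : HasDerivAt (fun t : ℝ => ((-t) ^ n)⁻¹) (n * ((-t) ^ (n + 1))⁻¹) t := by
      have hd : HasDerivAt (fun t : ℝ => (-t) ^ n) (n * (-t) ^ (n - 1) * (-1)) t :=
        (hasDerivAt_neg t).pow n
      have h : HasDerivAt (fun t : ℝ => ((-t) ^ n)⁻¹)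
          (-(n * (-t) ^ (n - 1) * (-1)) / ((-t) ^ n) ^ 2) t :=
        hd.inv (pow_pos hpos n).ne'
      refine h.congr_deriv ?_
      cases n with
      | zero => simp
      | succ n =>
        rw [Nat.add_sub_cancel]
        set y := -t
        field_simp
        ring
    have h3 := ((genFactorialPoly α n).hasDerivAt (g * (-t) ^ α)).comp t h1
    have h4 := (h2.mul h3).mul h1n.exp
    refine (HasDerivAt.deriv h4).trans ?_
    have h5 : (-t) ^ α = (-t) ^ (α - 1) * (-t) := by
      rw [← Real.rpow_add_one hpos.ne']
      ring_nf
    rw [genFactorialPoly_succ]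
    simp only [Polynomial.eval_sub, Polynomial.eval_add, Polynomial.eval_mul, Polynomial.eval_C,
      Polynomial.eval_X, Function.comp, Pi.mul_apply]
    set E := Real.exp (-(g * (-t) ^ α))
    set q := (genFactorialPoly α n).eval (g * (-t) ^ α)
    set q' := (Polynomial.derivative (genFactorialPoly α n)).eval (g * (-t) ^ α)
    rw [h5]
    set y := -t
    field_simp
    ring

lemma iteratedDeriv_neg_rpow (p : ℝ) (n : ℕ) {t : ℝ} (ht : t < 0) :
    iteratedDeriv n (fun t : ℝ => (-t) ^ (-p)) t =
      risingFactorial p n * (-t) ^ (-p - n) := by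
  induction n generalizing t with
  | zero => simp [risingFactorial]
  | succ n ih =>
    rw [iteratedDeriv_succ]
    have hev : iteratedDeriv n (fun t : ℝ => (-t) ^ (-p)) =ᶠ[𝓝 t]
        fun t => risingFactorial p n * (-t) ^ (-p - n) := by
      filter_upwards [Iio_mem_nhds ht] with s hs using ih hs
    rw [hev.deriv_eq, ((hasDerivAt_neg_rpow ht (-p - n)).const_mul _).deriv, risingFactorial_succ]
    have : -p - ((n + 1 : ℕ) : ℝ) = -p - n - 1 := by push_cast; ring
    rw [this]
    ring

/-- The sizes of the blocks enter the exchangeable partition probability function of the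
Pitman-Yor process through these weights. -/
noncomputable def blockWeight (α u : ℝ) (m : ℕ) : ℝ :=
  α * risingFactorial (1 - α) (m - 1) * u ^ (α - m)

lemma blockWeight_nonneg (h0 : 0 < α) (h1 : α < 1) {u : ℝ} (hu : 0 < u) (m : ℕ) :
    0 ≤ blockWeight α u m := by
  have := risingFactorial_nonneg (by linarith : 0 ≤ 1 - α) (m - 1)
  unfold blockWeight
  positivity

/-- For `f t = exp (-g (-t) ^ α)` one has `f' = g α (-t) ^ (α - 1) f`. Differentiating this `n`
times by Leibniz' rule and cancelling the exponential gives the recursion required by hypothesis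
`hY` of `partitionSum_eq_prod`; the derivatives of `(-t) ^ (α - 1)` are the origin of `blockWeight`.
-/
lemma genFactorialPoly_eval_succ_eq_sum (g : ℝ) (n : ℕ) {u : ℝ} (hu : 0 < u) :
    (u ^ (n + 1))⁻¹ * (genFactorialPoly α (n + 1)).eval (g * u ^ α) =
      ∑ i ∈ Finset.range (n + 1), (n.choose i : ℝ) * ((g * blockWeight α u (i + 1)) *
        ((u ^ (n - i))⁻¹ * (genFactorialPoly α (n - i)).eval (g * u ^ α))) := by
  set f : ℝ → ℝ := fun t => Real.exp (-(g * (-t) ^ α)) with hf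
  set a : ℝ → ℝ := fun t => (-t) ^ (-(1 - α)) with ha
  have ht : -u < 0 := by linarith
  have hcda : ContDiffAt ℝ n a (-u) := by
    refine ContDiffAt.rpow_const_of_ne (by fun_prop) (by simpa using hu.ne')
  have hcdf : ContDiffAt ℝ n f (-u) := by
    refine ContDiffAt.exp (ContDiffAt.neg (contDiffAt_const.mul ?_))
    exact ContDiffAt.rpow_const_of_ne (by fun_prop) (by simpa using hu.ne')
  have hd : deriv f =ᶠ[𝓝 (-u)] fun t => (g * α) * (a * f) t := by
    filter_upwards [Iio_mem_nhds ht] with t ht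
    have h1 : HasDerivAt (fun t : ℝ => g * (-t) ^ α) (g * (-(α * (-t) ^ (α - 1)))) t :=
      (hasDerivAt_neg_rpow ht α).const_mul g
    have h2 : HasDerivAt f (f t * -(g * (-(α * (-t) ^ (α - 1))))) t := h1.neg.exp
    rw [h2.deriv]
    simp only [ha, Pi.mul_apply]
    rw [show -(1 - α) = α - 1 by ring]
    ring
  have h1 : iteratedDeriv (n + 1) f (-u) = (g * α) * iteratedDeriv n (a * f) (-u) := by
    rw [iteratedDeriv_succ', hd.iteratedDeriv_eq n, iteratedDeriv_const_mul_field]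
  rw [iteratedDeriv_mul hcda hcdf, iteratedDeriv_stable g (n + 1) ht, Finset.mul_sum] at h1
  have hE : Real.exp (-(g * u ^ α)) ≠ 0 := (Real.exp_pos _).ne'
  refine mul_right_cancel₀ hE ?_
  simp only [neg_neg] at h1
  rw [h1, Finset.sum_mul]
  refine Finset.sum_congr rfl fun i hi => ?_
  rw [iteratedDeriv_neg_rpow _ _ ht, iteratedDeriv_stable g (n - i) ht, blockWeight, neg_neg,
    Nat.add_sub_cancel]
  have : -(1 - α) - (i : ℝ) = α - ((i + 1 : ℕ) : ℝ) := by push_cast; ring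
  rw [this]
  ring

end GenFactorial

/-! ### The exponential on `[0, ∞]`, used so that Laplace functionals need no integrability
conditions -/

/-- The function `x ↦ exp (-x)` on `[0, ∞]`. -/
noncomputable def expNeg (x : ℝ≥0∞) : ℝ≥0∞ := EReal.exp (-(x : EReal))

section ExpNeg

open Filter Topology
open scoped NNReal

lemma expNeg_zero : expNeg 0 = 1 := by simp [expNeg]

lemma expNeg_top : expNeg ∞ = 0 := by simp [expNeg]

lemma expNeg_ofReal {x : ℝ} (hx : 0 ≤ x) :
    expNeg (ENNReal.ofReal x) = ENNReal.ofReal (Real.exp (-x)) := by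
  rw [expNeg, EReal.coe_ennreal_ofReal, max_eq_left hx, ← EReal.coe_neg, EReal.exp_coe]

lemma expNeg_eq_ofReal_toReal {x : ℝ≥0∞} (hx : x ≠ ∞) :
    expNeg x = ENNReal.ofReal (Real.exp (-x.toReal)) := by
  conv_lhs => rw [← ENNReal.ofReal_toReal hx]
  exact expNeg_ofReal ENNReal.toReal_nonneg

lemma expNeg_le_one (x : ℝ≥0∞) : expNeg x ≤ 1 := by
  rw [expNeg, EReal.exp_le_one_iff, EReal.neg_le_zero]
  exact EReal.coe_ennreal_nonneg x

lemma expNeg_add (x y : ℝ≥0∞) : expNeg (x + y) = expNeg x * expNeg y := by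
  rcases eq_or_ne x ∞ with rfl | hx
  · simp [expNeg_top]
  rcases eq_or_ne y ∞ with rfl | hy
  · simp [expNeg_top]
  rw [expNeg_eq_ofReal_toReal hx, expNeg_eq_ofReal_toReal hy,
    expNeg_eq_ofReal_toReal (ENNReal.add_ne_top.2 ⟨hx, hy⟩), ENNReal.toReal_add hx hy, neg_add,
    Real.exp_add, ENNReal.ofReal_mul (Real.exp_pos _).le]

lemma expNeg_sum {κ : Type*} (s : Finset κ) (x : κ → ℝ≥0∞) :
    expNeg (∑ k ∈ s, x k) = ∏ k ∈ s, expNeg (x k) := by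
  classical
  induction s using Finset.induction_on with
  | empty => simp [expNeg_zero]
  | insert a s ha ih => rw [Finset.sum_insert ha, Finset.prod_insert ha, expNeg_add, ih]

lemma expNeg_mul_natCast (a : ℝ≥0∞) (n : ℕ) : expNeg (a * n) = expNeg a ^ n := by
  have := expNeg_sum (Finset.range n) (fun _ => a)
  simpa [mul_comm] using this

lemma antitone_expNeg : Antitone expNeg := fun x y h => by
  rw [expNeg, expNeg, EReal.exp_le_exp_iff, EReal.neg_le_neg_iff]
  exact_mod_cast h

lemma continuous_expNeg : Continuous expNeg :=
  ENNReal.continuous_exp.comp (continuous_neg.comp continuous_coe_ennreal_ereal)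

lemma measurable_expNeg : Measurable expNeg := continuous_expNeg.measurable

end ExpNeg

/-! ### Laplace functional of a Poisson random measure -/

section PoissonRandomMeasure

open Filter Topology
open scoped NNReal

/-- With `q = expNeg a` the integrand is `q ^ m`, so the Poisson weights reassemble into the
exponential series of `r q`. The case `a = ∞` is `q = 0`. -/
lemma lintegral_expNeg_poissonMeasure (r : ℝ≥0) (a : ℝ≥0∞) :
    ∫⁻ m : ℕ, expNeg (a * m) ∂(poissonMeasure r) = expNeg (r * (1 - expNeg a)) := by
  obtain ⟨q, hq⟩ : ∃ q : ℝ≥0, expNeg a = q :=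
    ⟨_, (ENNReal.coe_toNNReal (ne_top_of_le_ne_top ENNReal.one_ne_top (expNeg_le_one a))).symm⟩
  have hq1 : (q : ℝ) ≤ 1 := by
    have := expNeg_le_one a
    rw [hq] at this
    exact_mod_cast this
  have h1 : ∀ m : ℕ, ENNReal.ofReal (Real.exp (-r) * r ^ m / m.factorial) * expNeg (a * m) =
      ENNReal.ofReal (Real.exp (-r) * ((r * q : ℝ) ^ m / m.factorial)) := by
    intro m
    rw [expNeg_mul_natCast, hq, ← ENNReal.ofReal_coe_nnreal, ← ENNReal.ofReal_pow q.coe_nonneg,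
      ← ENNReal.ofReal_mul (by positivity)]
    congr 1
    rw [mul_pow]
    ring
  have hs : HasSum (fun m : ℕ => Real.exp (-r) * ((r * q : ℝ) ^ m / m.factorial))
      (Real.exp (-r) * Real.exp (r * q)) := by
    rw [Real.exp_eq_exp_ℝ]
    exact (NormedSpace.expSeries_div_hasSum_exp (r * q : ℝ)).mul_left _
  rw [poissonMeasure, lintegral_sum_measure]
  simp_rw [lintegral_smul_measure, lintegral_dirac, smul_eq_mul, h1]
  rw [← ENNReal.ofReal_tsum_of_nonneg (fun m => by positivity) hs.summable, hs.tsum_eq,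
    ← Real.exp_add, hq]
  have : (r : ℝ≥0∞) * (1 - q) = ENNReal.ofReal (r * (1 - q)) := by
    rw [ENNReal.ofReal_mul r.coe_nonneg, ENNReal.ofReal_sub _ q.coe_nonneg]
    simp
  rw [this, expNeg_ofReal (mul_nonneg r.coe_nonneg (by linarith))]
  congr 2
  ring

variable {E : Type*} [MeasurableSpace E] {ν : Measure E} {Q : Measure (Measure E)}

lemma IsPoissonRandomMeasure.lintegral_expNeg_eval (hQ : IsPoissonRandomMeasure ν Q) {B : Set E}
    (hB : MeasurableSet B) (hν : ν B < ∞) (a : ℝ≥0∞) :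
    ∫⁻ N, expNeg (a * N B) ∂Q = expNeg (ν B * (1 - expNeg a)) := by
  have h : Measurable fun x : ℝ≥0∞ => expNeg (a * x) :=
    measurable_expNeg.comp (measurable_const_mul a)
  rw [← lintegral_map (f := fun x : ℝ≥0∞ => expNeg (a * x)) (g := fun N : Measure E => N B) h
    (Measure.measurable_coe hB), hQ.map_eval B hB hν, lintegral_map h (by fun_prop),
    lintegral_expNeg_poissonMeasure, ENNReal.coe_toNNReal hν.ne]

/-- The level sets are disjoint, so their masses are independent and both sides are products over
the values. The value `0` contributes nothing and is left out, since its level set may have infinite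
intensity. -/
lemma IsPoissonRandomMeasure.lintegral_expNeg_simpleFunc (hQ : IsPoissonRandomMeasure ν Q)
    (f : SimpleFunc E ℝ≥0∞) (hf : ∀ a ≠ 0, ν (f ⁻¹' {a}) < ∞) :
    ∫⁻ N, expNeg (∫⁻ x, f x ∂N) ∂Q = expNeg (∫⁻ x, (1 - expNeg (f x)) ∂ν) := by
  set s : Finset ℝ≥0∞ := f.range.filter (fun a => a ≠ 0) with hs
  have h1 : ∀ (g : ℝ≥0∞ → ℝ≥0∞), g 0 = 0 → ∀ N : Measure E,
      ∫⁻ x, g (f x) ∂N = ∑ a : s, g a * N (f ⁻¹' {(a : ℝ≥0∞)}) := by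
    intro g hg N
    have : ∫⁻ x, g (f x) ∂N = ∑ a ∈ f.range, g a * N (f ⁻¹' {a}) := by
      rw [← SimpleFunc.map_lintegral g f]
      exact (SimpleFunc.lintegral_eq_lintegral (f.map g) N)
    rw [this, Finset.sum_coe_sort s (fun a => g a * N (f ⁻¹' {a})), hs]
    refine (Finset.sum_filter_of_ne ?_).symm
    rintro a _ ha rfl
    simp [hg] at ha
  have hind : iIndepFun (fun (a : s) (N : Measure E) => N (f ⁻¹' {(a : ℝ≥0∞)})) Q := by
    have h := hQ.indep s.card (fun i => f ⁻¹' {(s.equivFin.symm i : ℝ≥0∞)})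
      (fun i => f.measurableSet_preimage _) (fun i j hij => by
        refine Disjoint.preimage _ (Set.disjoint_singleton.2 fun h => hij ?_)
        exact s.equivFin.symm.injective (Subtype.ext h))
    have h2 := h.precomp s.equivFin.injective
    simpa using h2
  have hmeas : ∀ a : s, Measurable fun N : Measure E => N (f ⁻¹' {(a : ℝ≥0∞)}) :=
    fun a => Measure.measurable_coe (f.measurableSet_preimage _)
  have hm2 : ∀ a : s, Measurable fun x : ℝ≥0∞ => expNeg ((a : ℝ≥0∞) * x) :=
    fun a => measurable_expNeg.comp (measurable_const_mul _)
  simp_rw [h1 (fun x => x) rfl, h1 (fun x => 1 - expNeg x) (by simp [expNeg_zero]), expNeg_sum]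
  rw [lintegral_prod_eq_prod_lintegral_of_indepFun Finset.univ
    (fun (a : s) (N : Measure E) => expNeg ((a : ℝ≥0∞) * N (f ⁻¹' {(a : ℝ≥0∞)})))
    (hind.comp _ hm2) (fun a => (hm2 a).comp (hmeas a))]
  refine Finset.prod_congr rfl fun a _ => ?_
  rw [hQ.lintegral_expNeg_eval (f.measurableSet_preimage _)
    (hf a (Finset.mem_filter.1 a.2).2), mul_comm]

/-- The Laplace functional of a Poisson random measure. -/
lemma IsPoissonRandomMeasure.lintegral_expNeg_lintegral [SigmaFinite ν]
    (hQ : IsPoissonRandomMeasure ν Q) {f : E → ℝ≥0∞} (hf : Measurable f) :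
    ∫⁻ N, expNeg (∫⁻ x, f x ∂N) ∂Q = expNeg (∫⁻ x, (1 - expNeg (f x)) ∂ν) := by
  have := hQ.isProbabilityMeasure
  -- Truncating to spanning sets gives the nonzero level sets finite intensity while `F n` still
  -- increases to `f`. The limit is taken inside by monotone convergence, and in the outer integral
  -- by domination with the constant `1`.
  set F : ℕ → SimpleFunc E ℝ≥0∞ := fun n =>
    (SimpleFunc.eapprox f n).restrict (spanningSets ν n) with hF
  have hFapp : ∀ n x, F n x = (spanningSets ν n).indicator (SimpleFunc.eapprox f n) x :=
    fun n x => by rw [hF, SimpleFunc.restrict_apply _ (measurableSet_spanningSets ν n)]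
  have hmono : ∀ x, Monotone fun n => F n x := by
    intro x m n hmn
    simp only [hFapp]
    by_cases hx : x ∈ spanningSets ν m
    · rw [Set.indicator_of_mem hx, Set.indicator_of_mem (monotone_spanningSets ν hmn hx)]
      exact SimpleFunc.monotone_eapprox f hmn x
    · rw [Set.indicator_of_notMem hx]
      exact zero_le
  have hlim : ∀ x, Tendsto (fun n => F n x) atTop (𝓝 (f x)) := by
    intro x
    refine (SimpleFunc.tendsto_eapprox hf x).congr' ?_
    filter_upwards [eventually_ge_atTop (spanningSetsIndex ν x)] with n hn
    rw [hFapp, Set.indicator_of_mem (monotone_spanningSets ν hn (mem_spanningSetsIndex ν x))]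
  have heq : ∀ n, ∫⁻ N, expNeg (∫⁻ x, F n x ∂N) ∂Q =
      expNeg (∫⁻ x, (1 - expNeg (F n x)) ∂ν) := by
    intro n
    refine hQ.lintegral_expNeg_simpleFunc (F n) fun a ha => ?_
    refine (measure_mono ?_).trans_lt (measure_spanningSets_lt_top ν n)
    intro x hx
    by_contra hxn
    have : F n x = a := hx
    rw [hFapp, Set.indicator_of_notMem hxn] at this
    exact ha this.symm
  have hL : Tendsto (fun n => ∫⁻ N, expNeg (∫⁻ x, F n x ∂N) ∂Q) atTop
      (𝓝 (∫⁻ N, expNeg (∫⁻ x, f x ∂N) ∂Q)) := by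
    refine tendsto_lintegral_of_dominated_convergence (fun _ => 1) (fun n => ?_) (fun n => ?_)
      (by simp) ?_
    · exact measurable_expNeg.comp (Measure.measurable_lintegral (F n).measurable)
    · exact ae_of_all _ fun N => expNeg_le_one _
    · refine ae_of_all _ fun N => (continuous_expNeg.tendsto _).comp ?_
      exact lintegral_tendsto_of_tendsto_of_monotone (fun n => (F n).measurable.aemeasurable)
        (ae_of_all _ hmono) (ae_of_all _ hlim)
  have hR : Tendsto (fun n => expNeg (∫⁻ x, (1 - expNeg (F n x)) ∂ν)) atTop
      (𝓝 (expNeg (∫⁻ x, (1 - expNeg (f x)) ∂ν))) := by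
    refine (continuous_expNeg.tendsto _).comp ?_
    refine lintegral_tendsto_of_tendsto_of_monotone (fun n => ?_)
      (ae_of_all _ fun x m n hmn => ?_) (ae_of_all _ fun x => ?_)
    · exact (measurable_const.sub (measurable_expNeg.comp (F n).measurable)).aemeasurable
    · exact tsub_le_tsub_left (antitone_expNeg (hmono x hmn)) _
    · exact ENNReal.Tendsto.sub tendsto_const_nhds
        ((continuous_expNeg.tendsto _).comp (hlim x)) (Or.inl ENNReal.one_ne_top)
  exact tendsto_nhds_unique hL ((tendsto_congr heq).2 hR)

end PoissonRandomMeasure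

/-! ### Laplace exponent of the stable subordinator -/

section Stable

open Filter Topology
open scoped NNReal

lemma lintegral_rpow_mul_exp_neg_mul_Ioi {a r : ℝ} (ha : 0 < a) (hr : 0 < r) :
    ∫⁻ t in Set.Ioi (0 : ℝ), ENNReal.ofReal (t ^ (a - 1) * Real.exp (-(r * t))) =
      ENNReal.ofReal ((1 / r) ^ a * Real.Gamma a) := by
  have h := Real.integral_rpow_mul_exp_neg_mul_Ioi ha hr
  have hne : (1 / r) ^ a * Real.Gamma a ≠ 0 := by
    have := Real.Gamma_pos_of_pos ha
    positivity
  rw [← h, ofReal_integral_eq_lintegral_ofReal]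
  · exact Integrable.of_integral_ne_zero (by rwa [h])
  · filter_upwards [ae_restrict_mem measurableSet_Ioi] with t ht
    have : (0 : ℝ) < t := ht
    positivity

lemma lintegral_Ioc_mul_exp_neg {c s : ℝ} (hc : 0 ≤ c) (hs : 0 < s) :
    ∫⁻ t in Set.Ioc 0 c, ENNReal.ofReal (s * Real.exp (-(t * s))) =
      ENNReal.ofReal (1 - Real.exp (-(c * s))) := by
  have h : ∫ t in (0 : ℝ)..c, s * Real.exp (-(t * s)) = 1 - Real.exp (-(c * s)) := by
    have hd : ∀ t ∈ Set.uIcc 0 c,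
        HasDerivAt (fun t => -Real.exp (-(t * s))) (s * Real.exp (-(t * s))) t := by
      intro t _
      refine ((hasDerivAt_id t).mul_const s).neg.exp.neg.congr_deriv ?_
      simp only [Pi.neg_apply, id]
      ring
    rw [intervalIntegral.integral_eq_sub_of_hasDerivAt hd
      ((by fun_prop : Continuous fun t : ℝ => s * Real.exp (-(t * s))).intervalIntegrable _ _)]
    simp
    ring
  rw [← h, intervalIntegral.integral_of_le hc, ofReal_integral_eq_lintegral_ofReal]
  · exact (by fun_prop : Continuous fun t : ℝ => s * Real.exp (-(t * s))).integrableOn_Ioc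
  · exact ae_of_all _ fun t => by positivity

lemma lintegral_Ioc_rpow {α c : ℝ} (hα : 0 < α) (hc : 0 ≤ c) :
    ∫⁻ t in Set.Ioc 0 c, ENNReal.ofReal (α * t ^ (α - 1)) = ENNReal.ofReal (c ^ α) := by
  have h : ∫ t in (0 : ℝ)..c, α * t ^ (α - 1) = c ^ α := by
    rw [intervalIntegral.integral_const_mul, integral_rpow (Or.inl (by linarith)),
      sub_add_cancel, Real.zero_rpow hα.ne']
    field_simp
    ring
  rw [← h, intervalIntegral.integral_of_le hc, ofReal_integral_eq_lintegral_ofReal]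
  · refine ((intervalIntegrable_iff_integrableOn_Ioc_of_le hc).1 ?_)
    exact (intervalIntegral.intervalIntegrable_rpow' (by linarith)).const_mul _
  · filter_upwards [ae_restrict_mem measurableSet_Ioc] with t ht
    have : (0 : ℝ) < t := ht.1
    positivity

/-- The Laplace exponent of the stable subordinator. -/
lemma lintegral_one_sub_expNeg_stable {α c : ℝ} (h0 : 0 < α) (h1 : α < 1) (hc : 0 ≤ c) :
    ∫⁻ s in Set.Ioi (0 : ℝ), (1 - expNeg (ENNReal.ofReal c * ENNReal.ofReal s)) *
      ENNReal.ofReal (α / Real.Gamma (1 - α) * s ^ (-1 - α)) = ENNReal.ofReal (c ^ α) := by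
  have hG : 0 < Real.Gamma (1 - α) := Real.Gamma_pos_of_pos (by linarith)
  -- Writing `1 - exp (-c s)` as the integral of `s exp (-t s)` over `0 < t ≤ c` and applying
  -- Tonelli reduces the claim to a gamma integral in `s`, whose value `Γ(1 - α) t ^ (α - 1)`
  -- cancels the normalization of the intensity.
  have e1 : ∀ s ∈ Set.Ioi (0 : ℝ), (1 - expNeg (ENNReal.ofReal c * ENNReal.ofReal s)) *
      ENNReal.ofReal (α / Real.Gamma (1 - α) * s ^ (-1 - α)) =
      ∫⁻ t in Set.Ioc 0 c, ENNReal.ofReal (s * Real.exp (-(t * s))) *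
        ENNReal.ofReal (α / Real.Gamma (1 - α) * s ^ (-1 - α)) := by
    intro s hs
    have hs' : (0 : ℝ) < s := hs
    rw [lintegral_mul_const _ (by fun_prop), lintegral_Ioc_mul_exp_neg hc hs',
      ← ENNReal.ofReal_mul hc, expNeg_ofReal (by positivity),
      ENNReal.ofReal_sub _ (Real.exp_pos _).le, ENNReal.ofReal_one]
  rw [setLIntegral_congr_fun measurableSet_Ioi e1, lintegral_lintegral_swap]
  swap
  · refine Measurable.aemeasurable ?_
    unfold Function.uncurry
    fun_prop
  have e2 : ∀ t ∈ Set.Ioc 0 c, ∫⁻ s in Set.Ioi (0 : ℝ),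
      ENNReal.ofReal (s * Real.exp (-(t * s))) *
        ENNReal.ofReal (α / Real.Gamma (1 - α) * s ^ (-1 - α)) =
      ENNReal.ofReal (α * t ^ (α - 1)) := by
    intro t ht
    have e3 : ∀ s ∈ Set.Ioi (0 : ℝ), ENNReal.ofReal (s * Real.exp (-(t * s))) *
        ENNReal.ofReal (α / Real.Gamma (1 - α) * s ^ (-1 - α)) =
        ENNReal.ofReal (α / Real.Gamma (1 - α)) *
          ENNReal.ofReal (s ^ ((1 - α) - 1) * Real.exp (-(t * s))) := by
      intro s hs
      have hs' : (0 : ℝ) < s := hs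
      rw [← ENNReal.ofReal_mul (by positivity), ← ENNReal.ofReal_mul (by positivity)]
      congr 1
      have : s ^ ((1 - α) - 1) = s ^ (-1 - α) * s := by
        rw [← Real.rpow_add_one hs'.ne']
        ring_nf
      rw [this]
      ring
    rw [setLIntegral_congr_fun measurableSet_Ioi e3, lintegral_const_mul _ (by fun_prop),
      lintegral_rpow_mul_exp_neg_mul_Ioi (by linarith) ht.1,
      ← ENNReal.ofReal_mul (by positivity)]
    congr 1
    have : (1 / t) ^ (1 - α) = t ^ (α - 1) := by
      rw [one_div, Real.inv_rpow ht.1.le, ← Real.rpow_neg ht.1.le]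
      ring_nf
    rw [this]
    field_simp
  rw [setLIntegral_congr_fun measurableSet_Ioc e2, lintegral_Ioc_rpow h0 hc]

end Stable

/-! ### Laplace transform of the stable completely random measure -/

section CRM

open Filter Topology
open scoped NNReal

variable {S : Type*} [MeasurableSpace S]

lemma measurable_jumpMeasure : Measurable (jumpMeasure (S := S)) := by
  refine Measure.measurable_of_measurable_coe _ fun B hB => ?_
  have h : ∀ N : Measure (ℝ × S), jumpMeasure N B =
      ∫⁻ p, (Prod.snd ⁻¹' B).indicator (fun p : ℝ × S => ENNReal.ofReal p.1) p ∂N := by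
    intro N
    rw [jumpMeasure, Measure.map_apply measurable_snd hB,
      withDensity_apply _ (measurable_snd hB), lintegral_indicator (measurable_snd hB)]
  simp_rw [h]
  exact Measure.measurable_lintegral ((by fun_prop : Measurable fun p : ℝ × S =>
    ENNReal.ofReal p.1).indicator (measurable_snd hB))

lemma lintegral_jumpMeasure (N : Measure (ℝ × S)) {f : S → ℝ≥0∞} (hf : Measurable f) :
    ∫⁻ x, f x ∂(jumpMeasure N) = ∫⁻ p, f p.2 * ENNReal.ofReal p.1 ∂N := by
  have h1 : Measurable fun p : ℝ × S => ENNReal.ofReal p.1 := by fun_prop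
  have h2 : Measurable fun p : ℝ × S => f p.2 := hf.comp measurable_snd
  rw [jumpMeasure, lintegral_map hf measurable_snd,
    lintegral_withDensity_eq_lintegral_mul _ h1 h2]
  simp only [Pi.mul_apply, mul_comm]

lemma lintegral_comp_eq_sum {κ : Type*} [Fintype κ] [MeasurableSpace κ]
    [MeasurableSingletonClass κ] (μ : Measure S) {f : S → κ} (hf : Measurable f)
    (l : κ → ℝ≥0∞) : ∫⁻ x, l (f x) ∂μ = ∑ k, l k * μ (f ⁻¹' {k}) := by
  rw [← lintegral_map (measurable_of_countable l) hf, lintegral_fintype]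
  simp_rw [Measure.map_apply hf (measurableSet_singleton _)]

/-- The joint Laplace transform of the masses that a stable completely random measure gives to the
cells of a finite partition. -/
lemma IsCRM.lintegral_expNeg_sum {α : ℝ} (h0 : 0 < α) (h1 : α < 1) {G₀ : Measure S}
    [IsProbabilityMeasure G₀] {M : Measure (Measure S)}
    (hM : IsCRM 1 (fun s => α / Real.Gamma (1 - α) * s ^ (-1 - α)) G₀ M)
    {κ : Type*} [Fintype κ] [MeasurableSpace κ] [MeasurableSingletonClass κ]
    {f : S → κ} (hf : Measurable f) (l : κ → ℝ) (hl : ∀ k, 0 ≤ l k) :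
    ∫⁻ μ, expNeg (∑ k, ENNReal.ofReal (l k) * μ (f ⁻¹' {k})) ∂M =
      ENNReal.ofReal (Real.exp (-∑ k, G₀.real (f ⁻¹' {k}) * l k ^ α)) := by
  obtain ⟨Q, hQ, rfl⟩ := hM
  have hlm : Measurable fun k => ENNReal.ofReal (l k) := measurable_of_countable _
  have hlf : Measurable fun x => ENNReal.ofReal (l (f x)) := hlm.comp hf
  have : SigmaFinite (levyIntensity 1 (fun s => α / Real.Gamma (1 - α) * s ^ (-1 - α)) G₀) := by
    unfold levyIntensity
    infer_instance
  have hm : Measurable fun μ : Measure S =>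
      expNeg (∑ k, ENNReal.ofReal (l k) * μ (f ⁻¹' {k})) := by
    refine measurable_expNeg.comp (Finset.measurable_sum _ fun k _ => ?_)
    exact (Measure.measurable_coe (hf (measurableSet_singleton k))).const_mul _
  have hm' : Measurable fun p : ℝ × S => ENNReal.ofReal (l (f p.2)) * ENNReal.ofReal p.1 :=
    (hlf.comp measurable_snd).mul (by fun_prop)
  rw [lintegral_map hm measurable_jumpMeasure]
  simp_rw [← lintegral_comp_eq_sum _ hf, lintegral_jumpMeasure _ hlf]
  rw [hQ.lintegral_expNeg_lintegral hm']
  have key : ∫⁻ p, (1 - expNeg (ENNReal.ofReal (l (f p.2)) * ENNReal.ofReal p.1))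
      ∂(levyIntensity 1 (fun s => α / Real.Gamma (1 - α) * s ^ (-1 - α)) G₀) =
      ENNReal.ofReal (∑ k, G₀.real (f ⁻¹' {k}) * l k ^ α) := by
    have hm2 : Measurable fun p : ℝ × S =>
        1 - expNeg (ENNReal.ofReal (l (f p.2)) * ENNReal.ofReal p.1) :=
      measurable_const.sub (measurable_expNeg.comp hm')
    rw [levyIntensity, lintegral_prod_symm' _ hm2]
    have e : ∀ x : S, ∫⁻ s, (1 - expNeg (ENNReal.ofReal (l (f x)) * ENNReal.ofReal s))
        ∂((volume.restrict (Set.Ioi (0 : ℝ))).withDensity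
          fun s => ENNReal.ofReal (1 * (α / Real.Gamma (1 - α) * s ^ (-1 - α)))) =
        ENNReal.ofReal (l (f x) ^ α) := by
      intro x
      have hd : Measurable fun s : ℝ =>
          ENNReal.ofReal (1 * (α / Real.Gamma (1 - α) * s ^ (-1 - α))) := by fun_prop
      have hs : Measurable fun s : ℝ =>
          1 - expNeg (ENNReal.ofReal (l (f x)) * ENNReal.ofReal s) := by
        refine measurable_const.sub (measurable_expNeg.comp ?_)
        fun_prop
      rw [lintegral_withDensity_eq_lintegral_mul _ hd hs,
        ← lintegral_one_sub_expNeg_stable h0 h1 (hl (f x))]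
      simp only [Pi.mul_apply, one_mul, mul_comm]
    simp_rw [e]
    rw [lintegral_comp_eq_sum _ hf (fun k => ENNReal.ofReal (l k ^ α)),
      ENNReal.ofReal_sum_of_nonneg fun k _ =>
        mul_nonneg measureReal_nonneg (Real.rpow_nonneg (hl k) _)]
    refine Finset.sum_congr rfl fun k _ => ?_
    rw [mul_comm, ENNReal.ofReal_mul measureReal_nonneg, ofReal_measureReal]
  rw [key, expNeg_ofReal (Finset.sum_nonneg fun k _ =>
        mul_nonneg measureReal_nonneg (Real.rpow_nonneg (hl k) _))]

end CRM

/-! ### Joint moments of the masses of cells -/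

section Moments

open Filter Topology
open scoped NNReal

/-- Differentiating a product-form Laplace transform of stable type in each of its arguments. -/
lemma lintegral_prod_pow_mul_exp {Ω κ : Type*} [MeasurableSpace Ω] [Fintype κ] [DecidableEq κ]
    {α : ℝ} (h0 : 0 < α) (h1 : α < 1) (M : Measure Ω) (X : κ → Ω → ℝ) (hX : ∀ k, Measurable (X k))
    (hX0 : ∀ k ω, 0 ≤ X k ω) (g : κ → ℝ) (hg : ∀ k, 0 ≤ g k)
    (hL : ∀ l : κ → ℝ, (∀ k, 0 < l k) →
      ∫⁻ ω, ENNReal.ofReal (Real.exp (-∑ k, l k * X k ω)) ∂M =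
        ENNReal.ofReal (∏ k, Real.exp (-(g k * l k ^ α))))
    (m : κ → ℕ) (t : Finset κ) (l : κ → ℝ) (hl : ∀ k, 0 < l k) :
    ∫⁻ ω, ENNReal.ofReal ((∏ k ∈ t, X k ω ^ m k) * Real.exp (-∑ k, l k * X k ω)) ∂M =
      ENNReal.ofReal ((∏ k ∈ t, ((l k ^ m k)⁻¹ * (genFactorialPoly α (m k)).eval (g k * l k ^ α))) *
        ∏ k, Real.exp (-(g k * l k ^ α))) := by
  induction t using Finset.induction_on generalizing l with
  | empty => simpa using hL l hl
  | insert a t ha ih =>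
    set R : Ω → ℝ := fun ω => (∏ k ∈ t, X k ω ^ m k) *
      Real.exp (-∑ k ∈ Finset.univ.erase a, l k * X k ω) with hR
    set C : ℝ := (∏ k ∈ t, ((l k ^ m k)⁻¹ * (genFactorialPoly α (m k)).eval (g k * l k ^ α))) *
        ∏ k ∈ Finset.univ.erase a, Real.exp (-(g k * l k ^ α)) with hC
    have hRm : Measurable R := by
      refine (Finset.measurable_prod _ fun k _ => (hX k).pow_const _).mul
        (Real.measurable_exp.comp (Finset.measurable_sum _ fun k _ => (hX k).const_mul _).neg)
    have hR0 : ∀ ω, 0 ≤ R ω := fun ω =>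
      mul_nonneg (Finset.prod_nonneg fun k _ => pow_nonneg (hX0 k ω) _) (Real.exp_pos _).le
    -- All factors not involving `X a` are absorbed into a new measure. The induction hypothesis,
    -- with the argument `l a` left free, determines the moment generating function of `X a` under
    -- it on the negative half-line.
    set ρ := M.withDensity fun ω => ENNReal.ofReal (R ω) with hρ
    have hden : ∀ φ : Ω → ℝ, Measurable φ → ∫⁻ ω, ENNReal.ofReal (φ ω) ∂ρ =
        ∫⁻ ω, ENNReal.ofReal (R ω * φ ω) ∂M := by
      intro φ hφ
      rw [hρ, lintegral_withDensity_eq_lintegral_mul _ (by fun_prop) (by fun_prop)]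
      refine lintegral_congr fun ω => ?_
      simp only [Pi.mul_apply]
      rw [ENNReal.ofReal_mul (hR0 ω)]
    have hlap : ∀ c, 0 < c → ∫⁻ ω, ENNReal.ofReal (Real.exp (-c * X a ω)) ∂ρ =
        ENNReal.ofReal (C * Real.exp (-(g a * c ^ α))) := by
      intro c hc
      have h := ih (Function.update l a c) (fun k => by
        rcases eq_or_ne k a with rfl | hk
        · simpa using hc
        · simpa [hk] using hl k)
      have hat : ∀ k ∈ t, Function.update l a c k = l k := fun k hk => by
        rw [Function.update_of_ne]
        rintro rfl
        exact ha hk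
      have hae : ∀ k ∈ Finset.univ.erase a, Function.update l a c k = l k := fun k hk => by
        rw [Function.update_of_ne (Finset.mem_erase.1 hk).1]
      rw [hden _ (by fun_prop)]
      rw [← Finset.mul_prod_erase _ _ (Finset.mem_univ a), Function.update_self,
        Finset.prod_congr rfl (fun k hk => by rw [hat k hk]),
        Finset.prod_congr (s₁ := Finset.univ.erase a) rfl (fun k hk => by rw [hae k hk])] at h
      rw [hC, mul_assoc, mul_comm (∏ k ∈ Finset.univ.erase a, _), ← h]
      refine lintegral_congr fun ω => ?_
      rw [← Finset.add_sum_erase _ _ (Finset.mem_univ a), Function.update_self,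
        Finset.sum_congr (s₁ := Finset.univ.erase a) rfl (fun k hk => by rw [hae k hk]), hR]
      simp only
      rw [neg_add, Real.exp_add, neg_mul]
      congr 1
      ring
    have hint : ∀ c, 0 < c → Integrable (fun ω => Real.exp (-c * X a ω)) ρ := by
      intro c hc
      refine ⟨by fun_prop, ?_⟩
      rw [hasFiniteIntegral_iff_ofReal (ae_of_all _ fun _ => (Real.exp_pos _).le), hlap c hc]
      exact ENNReal.ofReal_lt_top
    have hC0 : 0 ≤ C := by
      refine mul_nonneg (Finset.prod_nonneg fun k _ => ?_)
        (Finset.prod_nonneg fun k _ => (Real.exp_pos _).le)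
      exact mul_nonneg (inv_nonneg.2 (pow_nonneg (hl k).le _))
        (genFactorialPoly_eval_nonneg h0 h1 _ (mul_nonneg (hg k) (Real.rpow_nonneg (hl k).le _)))
    have hmgf : ∀ c, 0 < c → mgf (X a) ρ (-c) = C * Real.exp (-(g a * c ^ α)) := by
      intro c hc
      rw [mgf, integral_eq_lintegral_of_nonneg_ae (ae_of_all _ fun _ => (Real.exp_pos _).le)
        (hint c hc).aestronglyMeasurable, hlap c hc,
        ENNReal.toReal_ofReal (mul_nonneg hC0 (Real.exp_pos _).le)]
    -- The exponential is integrable at every negative argument, so differentiation under the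
    -- integral is legitimate at `-l a` without any moment of `X a` having to exist undamped.
    have hint' : -l a ∈ interior (integrableExpSet (X a) ρ) := by
      rw [mem_interior]
      refine ⟨Set.Iio 0, fun c hc => ?_, isOpen_Iio, by simpa using hl a⟩
      have := hint (-c) (by simpa using hc)
      simpa [integrableExpSet] using this
    have hev : mgf (X a) ρ =ᶠ[𝓝 (-l a)] fun c => C * Real.exp (-(g a * (-c) ^ α)) := by
      filter_upwards [Iio_mem_nhds (by simpa using hl a : -l a < 0)] with c hc
      have := hmgf (-c) (by simpa using hc)
      rw [neg_neg] at this
      rw [this]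
    have hder := iteratedDeriv_mgf hint' (m a)
    rw [hev.iteratedDeriv_eq, iteratedDeriv_const_mul_field,
      iteratedDeriv_stable _ _ (by simpa using hl a : -l a < 0), neg_neg] at hder
    have hfin : ∫⁻ ω, ENNReal.ofReal (X a ω ^ m a * Real.exp (-l a * X a ω)) ∂ρ =
        ENNReal.ofReal (C * ((l a ^ m a)⁻¹ * (genFactorialPoly α (m a)).eval (g a * l a ^ α) *
          Real.exp (-(g a * l a ^ α)))) := by
      rw [hder, ofReal_integral_eq_lintegral_ofReal]
      · exact integrable_pow_mul_exp_of_mem_interior_integrableExpSet hint' _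
      · exact ae_of_all _ fun ω => mul_nonneg (pow_nonneg (hX0 a ω) _) (Real.exp_pos _).le
    rw [hden _ (by fun_prop)] at hfin
    calc _ = ∫⁻ ω, ENNReal.ofReal (R ω * (X a ω ^ m a * Real.exp (-l a * X a ω))) ∂M := by
          refine lintegral_congr fun ω => ?_
          rw [Finset.prod_insert ha, ← Finset.add_sum_erase _ _ (Finset.mem_univ a), hR,
            neg_add, Real.exp_add, neg_mul]
          congr 1
          ring
      _ = _ := by
          rw [hfin, Finset.prod_insert ha, ← Finset.mul_prod_erase _ _ (Finset.mem_univ a), hC]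
          congr 1
          ring

variable {S : Type*} [MeasurableSpace S] {α γ : ℝ} {G₀ : Measure S} [IsProbabilityMeasure G₀]

lemma IsCRM.isProbabilityMeasure {θ : ℝ} {ρ : ℝ → ℝ} {G₀ : Measure S} {M : Measure (Measure S)}
    (hM : IsCRM θ ρ G₀ M) : IsProbabilityMeasure M := by
  obtain ⟨Q, hQ, rfl⟩ := hM
  have := hQ.isProbabilityMeasure
  exact Measure.isProbabilityMeasure_map measurable_jumpMeasure.aemeasurable

lemma IsCRM.lintegral_expNeg_univ (h0 : 0 < α) (h1 : α < 1) {M : Measure (Measure S)}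
    (hM : IsCRM 1 (fun s => α / Real.Gamma (1 - α) * s ^ (-1 - α)) G₀ M) {c : ℝ} (hc : 0 ≤ c) :
    ∫⁻ μ, expNeg (ENNReal.ofReal c * μ Set.univ) ∂M = ENNReal.ofReal (Real.exp (-c ^ α)) := by
  have h := hM.lintegral_expNeg_sum h0 h1 (f := fun _ : S => ()) measurable_const
    (fun _ => c) (fun _ => hc)
  simpa using h

/-- In the Laplace transform `exp (-c ^ α)` of the total mass, `c → 0+` shows that infinite mass has
probability zero, and `c → ∞` that zero mass has probability zero. -/
lemma IsCRM.ae_pos_and_lt_top (h0 : 0 < α) (h1 : α < 1) {M : Measure (Measure S)}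
    (hM : IsCRM 1 (fun s => α / Real.Gamma (1 - α) * s ^ (-1 - α)) G₀ M) :
    ∀ᵐ μ ∂M, μ Set.univ ≠ 0 ∧ μ Set.univ ≠ ∞ := by
  have := hM.isProbabilityMeasure
  have hm : Measurable fun μ : Measure S => μ Set.univ := Measure.measurable_coe MeasurableSet.univ
  have hfin : M {μ | μ Set.univ ≠ ∞} = 1 := by
    refine le_antisymm prob_le_one ?_
    have hset : MeasurableSet {μ : Measure S | μ Set.univ ≠ ∞} :=
      (hm (measurableSet_singleton ∞)).compl
    have hle : ∀ c : ℝ, 0 < c → ENNReal.ofReal (Real.exp (-c ^ α)) ≤ M {μ | μ Set.univ ≠ ∞} := by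
      intro c hc
      rw [← hM.lintegral_expNeg_univ h0 h1 hc.le, ← lintegral_indicator_one hset]
      refine lintegral_mono fun μ => ?_
      by_cases hμ : μ Set.univ = ∞
      · simp [hμ, ENNReal.mul_top, hc, expNeg_top]
      · rw [Set.indicator_of_mem (by exact hμ)]
        exact expNeg_le_one _
    have hlim : Tendsto (fun c : ℝ => ENNReal.ofReal (Real.exp (-c ^ α))) (𝓝[>] 0) (𝓝 1) := by
      have : Tendsto (fun c : ℝ => ENNReal.ofReal (Real.exp (-c ^ α))) (𝓝 0)
          (𝓝 (ENNReal.ofReal (Real.exp (-(0 : ℝ) ^ α)))) :=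
        ENNReal.tendsto_ofReal ((Real.continuous_exp.tendsto _).comp
          ((Real.continuousAt_rpow_const 0 α (Or.inr h0.le)).tendsto.neg))
      rw [Real.zero_rpow h0.ne', neg_zero, Real.exp_zero, ENNReal.ofReal_one] at this
      exact this.mono_left nhdsWithin_le_nhds
    exact le_of_tendsto hlim (by filter_upwards [self_mem_nhdsWithin] with c hc using hle c hc)
  have hzero : M {μ | μ Set.univ = 0} = 0 := by
    refine le_antisymm ?_ zero_le
    have hset : MeasurableSet {μ : Measure S | μ Set.univ = 0} := hm (measurableSet_singleton 0)
    have hle : ∀ c : ℝ, 0 ≤ c → M {μ | μ Set.univ = 0} ≤ ENNReal.ofReal (Real.exp (-c ^ α)) := by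
      intro c hc
      rw [← hM.lintegral_expNeg_univ h0 h1 hc, ← lintegral_indicator_one hset]
      refine lintegral_mono fun μ => ?_
      by_cases hμ : μ Set.univ = 0
      · rw [hμ, mul_zero, expNeg_zero]
        exact Set.indicator_le_self' (fun _ _ => zero_le) μ
      · rw [Set.indicator_of_notMem (by exact hμ)]
        exact zero_le
    have hlim : Tendsto (fun c : ℝ => ENNReal.ofReal (Real.exp (-c ^ α))) atTop (𝓝 0) := by
      rw [← ENNReal.ofReal_zero]
      exact ENNReal.tendsto_ofReal (Real.tendsto_exp_neg_atTop_nhds_zero.comp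
        (tendsto_rpow_atTop h0))
    exact ge_of_tendsto hlim (by filter_upwards [eventually_ge_atTop 0] with c hc using hle c hc)
  refine Filter.Eventually.and ?_ ?_
  · rw [ae_iff]
    simpa using hzero
  · rw [ae_iff]
    have := (prob_compl_eq_zero_iff (μ := M) (hm (measurableSet_singleton ∞)).compl).2 hfin
    simpa [Set.compl_def] using this

lemma measurable_normalizedMeasure : Measurable (normalizedMeasure (S := S)) := by
  refine Measure.measurable_of_measurable_coe _ fun B hB => ?_
  simp only [normalizedMeasure, Measure.smul_apply, smul_eq_mul]
  exact (Measure.measurable_coe MeasurableSet.univ).inv.mul (Measure.measurable_coe hB)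

lemma IsPitmanYor.ae_univ_eq_one (h0 : 0 < α) (h1 : α < 1) {Λ : Measure (Measure S)}
    (hΛ : IsPitmanYor α γ G₀ Λ) : ∀ᵐ ν ∂Λ, ν Set.univ = 1 := by
  obtain ⟨M, hM, -, rfl⟩ := hΛ
  have hset : MeasurableSet {ν : Measure S | ν Set.univ = 1} :=
    (Measure.measurable_coe MeasurableSet.univ) (measurableSet_singleton 1)
  rw [ae_map_iff measurable_normalizedMeasure.aemeasurable hset]
  refine (withDensity_absolutelyContinuous _ _).ae_le ?_
  filter_upwards [hM.ae_pos_and_lt_top h0 h1] with μ hμ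
  simp [normalizedMeasure, ENNReal.inv_mul_cancel hμ.1 hμ.2]

/-- The normalizing constant of the partition probabilities of a sample of size `n`. -/
noncomputable def samplingConstant (α γ : ℝ) (n : ℕ) : ℝ :=
  Real.Gamma (γ + 1) / Real.Gamma (γ / α + 1) / Real.Gamma (γ + n)

lemma samplingConstant_pos (h0 : 0 < α) (hγ : -α < γ) {n : ℕ} (hγn : 0 < γ + n)
    (hγ1 : 0 < γ + 1) : 0 < samplingConstant α γ n := by
  have h1 : -1 < γ / α := by
    rw [lt_div_iff₀ h0]
    linarith
  exact div_pos (div_pos (Real.Gamma_pos_of_pos hγ1) (Real.Gamma_pos_of_pos (by linarith)))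
    (Real.Gamma_pos_of_pos hγn)

/-- The joint moments of the masses that a Pitman-Yor process gives to the cells of a finite
partition. -/
lemma IsPitmanYor.lintegral_prod_pow (h0 : 0 < α) (h1 : α < 1) (hγ : -α < γ)
    {Λ : Measure (Measure S)} (hΛ : IsPitmanYor α γ G₀ Λ)
    {κ : Type*} [Fintype κ] [DecidableEq κ] [MeasurableSpace κ] [MeasurableSingletonClass κ]
    {f : S → κ} (hf : Measurable f) (m : κ → ℕ) {n : ℕ} (hn : 1 ≤ n) (hm : ∑ k, m k = n) :
    ∫⁻ ν, ∏ k, ν (f ⁻¹' {k}) ^ m k ∂Λ =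
      ENNReal.ofReal (samplingConstant α γ n) *
        ∫⁻ u in Set.Ioi (0 : ℝ), ENNReal.ofReal (u ^ (γ + n - 1) *
          ((∏ k, ((u ^ m k)⁻¹ * (genFactorialPoly α (m k)).eval (G₀.real (f ⁻¹' {k}) * u ^ α))) *
            Real.exp (-u ^ α))) := by
  obtain ⟨M, hM, -, rfl⟩ := hΛ
  rw [samplingConstant]
  have := hM.isProbabilityMeasure
  have hn' : (1 : ℝ) ≤ n := by exact_mod_cast hn
  set c : ℝ := Real.Gamma (γ + 1) / Real.Gamma (γ / α + 1) with hc
  have hc0 : 0 < c := by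
    refine div_pos (Real.Gamma_pos_of_pos (by linarith)) (Real.Gamma_pos_of_pos ?_)
    have : -1 < γ / α := by
      rw [lt_div_iff₀ h0]
      linarith
    linarith
  have hGn : 0 < Real.Gamma (γ + n) := Real.Gamma_pos_of_pos (by linarith)
  set X : κ → Measure S → ℝ := fun k μ => (μ (f ⁻¹' {k})).toReal with hX
  have hmeas : ∀ k, Measurable fun μ : Measure S => μ (f ⁻¹' {k}) :=
    fun k => Measure.measurable_coe (hf (measurableSet_singleton k))
  have hmu : Measurable fun μ : Measure S => μ Set.univ := Measure.measurable_coe MeasurableSet.univ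
  have hXm : ∀ k, Measurable (X k) := fun k => (hmeas k).ennreal_toReal
  have hsum : ∀ μ : Measure S, ∑ k, μ (f ⁻¹' {k}) = μ Set.univ := by
    intro μ
    have := lintegral_comp_eq_sum μ hf (fun _ => 1)
    simpa using this.symm
  have hG1 : ∑ k, G₀.real (f ⁻¹' {k}) = 1 := by
    simp_rw [measureReal_def]
    rw [← ENNReal.toReal_sum fun k _ => measure_ne_top _ _, hsum, measure_univ, ENNReal.toReal_one]
  have hae := hM.ae_pos_and_lt_top h0 h1
  have hL : ∀ l : κ → ℝ, (∀ k, 0 < l k) →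
      ∫⁻ μ, ENNReal.ofReal (Real.exp (-∑ k, l k * X k μ)) ∂M =
        ENNReal.ofReal (∏ k, Real.exp (-(G₀.real (f ⁻¹' {k}) * l k ^ α))) := by
    intro l hl
    have h := hM.lintegral_expNeg_sum h0 h1 hf l (fun k => (hl k).le)
    rw [← Real.exp_sum, Finset.sum_neg_distrib, ← h]
    refine lintegral_congr_ae ?_
    filter_upwards [hae] with μ hμ
    have hfin : ∀ k, μ (f ⁻¹' {k}) ≠ ∞ := fun k =>
      ne_top_of_le_ne_top hμ.2 (measure_mono (Set.subset_univ _))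
    rw [← expNeg_ofReal (Finset.sum_nonneg fun k _ => mul_nonneg (hl k).le ENNReal.toReal_nonneg),
      ENNReal.ofReal_sum_of_nonneg fun k _ => mul_nonneg (hl k).le ENNReal.toReal_nonneg]
    congr 1
    refine Finset.sum_congr rfl fun k _ => ?_
    rw [ENNReal.ofReal_mul (hl k).le, ENNReal.ofReal_toReal (hfin k)]
  have hprodm : Measurable fun ν : Measure S => ∏ k, ν (f ⁻¹' {k}) ^ m k :=
    Finset.measurable_prod _ fun k _ => (hmeas k).pow_const _
  have hdm : Measurable fun μ : Measure S => ENNReal.ofReal (c * (μ Set.univ).toReal ^ (-γ)) :=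
    ((hmu.ennreal_toReal.pow_const _).const_mul _).ennreal_ofReal
  have hcompm : Measurable fun μ : Measure S => ∏ k, normalizedMeasure μ (f ⁻¹' {k}) ^ m k :=
    hprodm.comp measurable_normalizedMeasure
  rw [lintegral_map hprodm measurable_normalizedMeasure,
    lintegral_withDensity_eq_lintegral_mul _ hdm hcompm]
  -- Normalization and tilting leave `T ^ (-(γ + n))`, which is `Γ(γ + n)⁻¹` times the integral of
  -- `u ^ (γ + n - 1) exp (-u T)`. Here `n ≥ 1` ensures `γ + n > 0`.
  have hstep : ∀ᵐ μ ∂M, ((fun μ : Measure S => ENNReal.ofReal (c * (μ Set.univ).toReal ^ (-γ))) *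
      fun μ => ∏ k, normalizedMeasure μ (f ⁻¹' {k}) ^ m k) μ =
      ENNReal.ofReal (c / Real.Gamma (γ + n)) * ∫⁻ u in Set.Ioi (0 : ℝ),
        ENNReal.ofReal (u ^ (γ + n - 1)) *
          ENNReal.ofReal ((∏ k, X k μ ^ m k) * Real.exp (-∑ k, u * X k μ)) := by
    filter_upwards [hae] with μ hμ
    have hfin : ∀ k, μ (f ⁻¹' {k}) ≠ ∞ := fun k =>
      ne_top_of_le_ne_top hμ.2 (measure_mono (Set.subset_univ _))
    set T := (μ Set.univ).toReal with hT
    have hTpos : 0 < T := ENNReal.toReal_pos hμ.1 hμ.2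
    have hTsum : ∑ k, X k μ = T := by
      rw [hT, ← hsum μ, ENNReal.toReal_sum fun k _ => hfin k]
    have hP0 : 0 ≤ ∏ k, X k μ ^ m k :=
      Finset.prod_nonneg fun k _ => pow_nonneg ENNReal.toReal_nonneg _
    have e1 : ∀ u ∈ Set.Ioi (0 : ℝ), ENNReal.ofReal (u ^ (γ + n - 1)) *
          ENNReal.ofReal ((∏ k, X k μ ^ m k) * Real.exp (-∑ k, u * X k μ)) =
        ENNReal.ofReal (∏ k, X k μ ^ m k) *
          ENNReal.ofReal (u ^ (γ + n - 1) * Real.exp (-(T * u))) := by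
      intro u hu
      have hu' : (0 : ℝ) < u := hu
      rw [← ENNReal.ofReal_mul (by positivity), ← ENNReal.ofReal_mul hP0, ← Finset.mul_sum, hTsum]
      congr 1
      rw [mul_comm u T]
      ring
    rw [setLIntegral_congr_fun measurableSet_Ioi e1, lintegral_const_mul _ (by fun_prop),
      lintegral_rpow_mul_exp_neg_mul_Ioi (by linarith) hTpos, ← ENNReal.ofReal_mul hP0,
      ← ENNReal.ofReal_mul (by positivity)]
    have e2 : ∏ k, normalizedMeasure μ (f ⁻¹' {k}) ^ m k =
        ENNReal.ofReal ((T ^ n)⁻¹ * ∏ k, X k μ ^ m k) := by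
      have : ∀ k, normalizedMeasure μ (f ⁻¹' {k}) ^ m k =
          ENNReal.ofReal ((T⁻¹ * X k μ) ^ m k) := by
        intro k
        rw [ENNReal.ofReal_pow (mul_nonneg (inv_nonneg.2 hTpos.le) ENNReal.toReal_nonneg),
          normalizedMeasure, Measure.smul_apply, smul_eq_mul,
          ENNReal.ofReal_mul (by positivity), ENNReal.ofReal_toReal (hfin k),
          ENNReal.ofReal_inv_of_pos hTpos, hT, ENNReal.ofReal_toReal hμ.2]
      simp_rw [this]
      rw [← ENNReal.ofReal_prod_of_nonneg fun k _ =>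
        pow_nonneg (mul_nonneg (inv_nonneg.2 hTpos.le) ENNReal.toReal_nonneg) _]
      simp_rw [mul_pow]
      rw [Finset.prod_mul_distrib, Finset.prod_pow_eq_pow_sum, hm, inv_pow]
    change ENNReal.ofReal (c * T ^ (-γ)) * _ = _
    simp only
    rw [e2, ← ENNReal.ofReal_mul (by positivity)]
    congr 1
    have e3 : (1 / T) ^ (γ + n) = T ^ (-γ) * (T ^ n)⁻¹ := by
      rw [one_div, Real.inv_rpow hTpos.le, ← Real.rpow_neg hTpos.le, ← Real.rpow_natCast,
        ← Real.rpow_neg hTpos.le, ← Real.rpow_add hTpos]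
      ring_nf
    rw [e3]
    field_simp
  -- After Tonelli, the moments at the common argument `u` apply; the exponents add up to `u ^ α`
  -- because the `G₀`-masses of the cells sum to one.
  rw [lintegral_congr_ae hstep, lintegral_const_mul', lintegral_lintegral_swap]
  · congr 1
    refine setLIntegral_congr_fun measurableSet_Ioi fun u hu => ?_
    have hu' : (0 : ℝ) < u := hu
    rw [lintegral_const_mul']
    · rw [lintegral_prod_pow_mul_exp h0 h1 M X hXm (fun _ _ => ENNReal.toReal_nonneg)
        (fun k => G₀.real (f ⁻¹' {k})) (fun _ => measureReal_nonneg) hL m Finset.univ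
        (fun _ => u) (fun _ => hu'), ← ENNReal.ofReal_mul (by positivity), ← Real.exp_sum,
        Finset.sum_neg_distrib, ← Finset.sum_mul, hG1, one_mul]
    · exact ENNReal.ofReal_ne_top
  · refine Measurable.aemeasurable ?_
    unfold Function.uncurry
    refine Measurable.mul ?_ (Measurable.ennreal_ofReal (Measurable.mul ?_ ?_))
    · fun_prop
    · exact Finset.measurable_prod _ fun k _ => ((hXm k).comp measurable_fst).pow_const _
    · refine Real.measurable_exp.comp (Measurable.neg (Finset.measurable_sum _ fun k _ => ?_))
      exact measurable_snd.mul ((hXm k).comp measurable_fst)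
  · exact ENNReal.ofReal_ne_top

end Moments

/-! ### The law of a sample as a mixture over set partitions -/

section SamplingLaw

open Filter Topology
open scoped NNReal

variable {S : Type*} [MeasurableSpace S] {α γ : ℝ} {m : ℕ}

/-- The exchangeable partition probability function of the Pitman-Yor process, as a mixture over
`u` of functions that are products over the blocks. -/
noncomputable def partitionWeight (α γ : ℝ) {m : ℕ}
    (π : Finpartition (Finset.univ : Finset (Fin m))) : ℝ≥0∞ :=
  ENNReal.ofReal (samplingConstant α γ m) *
    ∫⁻ u in Set.Ioi (0 : ℝ), ENNReal.ofReal (u ^ (γ + m - 1) *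
      (Real.exp (-u ^ α) * ∏ B ∈ π.parts, blockWeight α u B.card))

/-- The law of a sample whose coordinates agree on the blocks of `π` and are otherwise independent
with law `G₀`. -/
noncomputable def partitionMeasure (G₀ : Measure S) {m : ℕ}
    (π : Finpartition (Finset.univ : Finset (Fin m))) : Measure (Fin m → S) :=
  (Measure.pi (fun _ : Finset (Fin m) => G₀)).map (fun Y i => Y (π.part i))

/-- The marginal law of a sample of size `m` from the Pitman-Yor process. -/
noncomputable def samplingLaw (α γ : ℝ) (G₀ : Measure S) (m : ℕ) : Measure (Fin m → S) :=
  ∑ π : Finpartition (Finset.univ : Finset (Fin m)), partitionWeight α γ π • partitionMeasure G₀ π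

lemma measurable_blockWeight (k : ℕ) : Measurable fun u => blockWeight α u k := by
  unfold blockWeight
  fun_prop

/-- The weights are products over blocks only for fixed `u`, so the sum over partitions has to be
moved inside the `u`-integral before it can be factorized. -/
lemma sum_partitionWeight_mul (h0 : 0 < α) (h1 : α < 1)
    (φ : Finpartition (Finset.univ : Finset (Fin m)) → ℝ) (hφ : ∀ π, 0 ≤ φ π) :
    ∑ π, partitionWeight α γ π * ENNReal.ofReal (φ π) =
      ENNReal.ofReal (samplingConstant α γ m) *
        ∫⁻ u in Set.Ioi (0 : ℝ), ENNReal.ofReal (u ^ (γ + m - 1) * (Real.exp (-u ^ α) *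
          ∑ π : Finpartition (Finset.univ : Finset (Fin m)),
            (∏ B ∈ π.parts, blockWeight α u B.card) * φ π)) := by
  have hmeas : ∀ π : Finpartition (Finset.univ : Finset (Fin m)),
      Measurable fun u : ℝ => ENNReal.ofReal (u ^ (γ + m - 1) *
        (Real.exp (-u ^ α) * ∏ B ∈ π.parts, blockWeight α u B.card)) := by
    intro π
    have := Finset.measurable_prod π.parts (fun B _ => measurable_blockWeight (α := α) B.card)
    fun_prop
  simp_rw [partitionWeight, mul_assoc]
  rw [← Finset.mul_sum]
  congr 1
  have e : ∀ π : Finpartition (Finset.univ : Finset (Fin m)),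
      (∫⁻ u in Set.Ioi (0 : ℝ), ENNReal.ofReal (u ^ (γ + m - 1) *
        (Real.exp (-u ^ α) * ∏ B ∈ π.parts, blockWeight α u B.card))) * ENNReal.ofReal (φ π) =
      ∫⁻ u in Set.Ioi (0 : ℝ), ENNReal.ofReal (u ^ (γ + m - 1) *
        (Real.exp (-u ^ α) * ∏ B ∈ π.parts, blockWeight α u B.card)) * ENNReal.ofReal (φ π) :=
    fun π => (lintegral_mul_const _ (hmeas π)).symm
  rw [Finset.sum_congr rfl fun π _ => e π,
    ← lintegral_finsetSum _ fun π _ => (hmeas π).mul_const _]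
  refine setLIntegral_congr_fun measurableSet_Ioi fun u hu => ?_
  have hu' : (0 : ℝ) < u := hu
  have hw : ∀ π : Finpartition (Finset.univ : Finset (Fin m)),
      0 ≤ ∏ B ∈ π.parts, blockWeight α u B.card :=
    fun π => Finset.prod_nonneg fun B _ => blockWeight_nonneg h0 h1 hu' _
  have hp : ∀ π : Finpartition (Finset.univ : Finset (Fin m)), 0 ≤ u ^ (γ + m - 1) *
        (Real.exp (-u ^ α) * ∏ B ∈ π.parts, blockWeight α u B.card) :=
    fun π => mul_nonneg (by positivity) (mul_nonneg (Real.exp_pos _).le (hw π))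
  rw [Finset.mul_sum, Finset.mul_sum, ENNReal.ofReal_sum_of_nonneg]
  · refine Finset.sum_congr rfl fun π _ => ?_
    rw [← ENNReal.ofReal_mul (hp π)]
    congr 1
    ring
  · intro π _
    have := mul_nonneg (hp π) (hφ π)
    simpa [mul_assoc] using this

lemma measurable_comp_part (π : Finpartition (Finset.univ : Finset (Fin m))) :
    Measurable fun (Y : Finset (Fin m) → S) (i : Fin m) => Y (π.part i) := by
  fun_prop

/-- The event constrains each block label separately: the label of `B` must have all the colours
that `r` prescribes on `B`. If these disagree, the factor is zero. -/
lemma partitionMeasure_colour (G₀ : Measure S) [IsProbabilityMeasure G₀] {κ : Type*}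
    [MeasurableSpace κ] [MeasurableSingletonClass κ] {f : S → κ} (hf : Measurable f)
    (π : Finpartition (Finset.univ : Finset (Fin m))) (r : Fin m → κ) :
    partitionMeasure G₀ π {x | ∀ i, f (x i) = r i} =
      ENNReal.ofReal (∏ B ∈ π.parts, G₀.real {y | ∀ i ∈ B, f y = r i}) := by
  classical
  have hset : MeasurableSet {x : Fin m → S | ∀ i, f (x i) = r i} := by
    have : {x : Fin m → S | ∀ i, f (x i) = r i} =
        ⋂ i, (fun x : Fin m → S => f (x i)) ⁻¹' {r i} := by ext; simp
    rw [this]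
    exact MeasurableSet.iInter fun i =>
      (hf.comp (measurable_pi_apply i)) (measurableSet_singleton _)
  have hpre : (fun (Y : Finset (Fin m) → S) (i : Fin m) => Y (π.part i)) ⁻¹'
      {x | ∀ i, f (x i) = r i} = Set.pi Set.univ
        (fun B => if B ∈ π.parts then {y | ∀ i ∈ B, f y = r i} else Set.univ) := by
    ext Y
    simp only [Set.mem_preimage, Set.mem_ofPred_eq, Set.mem_pi, Set.mem_univ, true_imp_iff]
    constructor
    · intro h B
      split_ifs with hB
      · intro i hi
        rw [← π.part_eq_of_mem hB hi]
        exact h i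
      · trivial
    · intro h i
      have := h (π.part i)
      rw [if_pos (π.part_mem.2 (Finset.mem_univ i))] at this
      exact this i (π.mem_part_self.2 (Finset.mem_univ i))
  rw [partitionMeasure, Measure.map_apply (measurable_comp_part π) hset, hpre, Measure.pi_pi,
    ENNReal.ofReal_prod_of_nonneg fun _ _ => measureReal_nonneg]
  rw [← Finset.prod_subset (Finset.subset_univ π.parts)]
  · exact Finset.prod_congr rfl fun B hB => by rw [if_pos hB, ofReal_measureReal]
  · intro B _ hB
    rw [if_neg hB, measure_univ]

/-- The sum over set partitions of products of block weights, restricted to the partitions that are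
finer than a colouring. -/
lemma partitionSum_blockWeight_colour {ι κ : Type*} [DecidableEq ι] [Fintype κ] [DecidableEq κ]
    (g : κ → ℝ) (r : ι → κ) (w : Finset ι → ℝ)
    (hw : ∀ a B, (∀ i ∈ B, r i = r a) → w (insert a B) = g (r a))
    (hw0 : ∀ a b B, a ∈ B → b ∈ B → r a ≠ r b → w B = 0) {u : ℝ} (hu : 0 < u)
    (s : Finset ι) :
    partitionSum (fun B => blockWeight α u B.card * w B) s =
      ∏ k, ((u ^ (s.filter (fun i => r i = k)).card)⁻¹ *
        (genFactorialPoly α (s.filter (fun i => r i = k)).card).eval (g k * u ^ α)) := by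
  refine partitionSum_eq_prod r _ (fun k l => g k * blockWeight α u l)
    (fun k l => (u ^ l)⁻¹ * (genFactorialPoly α l).eval (g k * u ^ α)) ?_ ?_ ?_ ?_ s
  · intro a B hB ha
    rw [hw a B hB, Finset.card_insert_of_notMem ha, mul_comm]
  · intro a b B ha hb hab
    rw [hw0 a b B ha hb hab, mul_zero]
  · intro k
    simp [genFactorialPoly_zero]
  · intro k l
    exact genFactorialPoly_eval_succ_eq_sum (g k) l hu

lemma samplingLaw_apply (G₀ : Measure S) (A : Set (Fin m → S)) :
    samplingLaw α γ G₀ m A = ∑ π, partitionWeight α γ π * partitionMeasure G₀ π A := by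
  simp [samplingLaw]

variable {G₀ : Measure S} [IsProbabilityMeasure G₀]

/-- Both sides are the same mixture over `u`: the right side by the joint moments of the cells `f
⁻¹' {k}`, the left side because the sum over partitions factorizes over the colours. -/
lemma samplingLaw_colour (h0 : 0 < α) (h1 : α < 1) (hγ : -α < γ)
    {Λ : Measure (Measure S)} (hΛ : IsPitmanYor α γ G₀ Λ) (hm : 1 ≤ m)
    {κ : Type*} [Fintype κ] [DecidableEq κ] [MeasurableSpace κ] [MeasurableSingletonClass κ]
    {f : S → κ} (hf : Measurable f) (r : Fin m → κ) :
    samplingLaw α γ G₀ m {x | ∀ i, f (x i) = r i} = ∫⁻ ν, ∏ i, ν (f ⁻¹' {r i}) ∂Λ := by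
  have hcount : ∑ k, (Finset.univ.filter (fun i => r i = k)).card = m := by
    rw [← Finset.card_eq_sum_card_fiberwise (fun i _ => Finset.mem_univ (r i))]
    simp
  have hprod : ∀ ν : Measure S, ∏ i, ν (f ⁻¹' {r i}) =
      ∏ k, ν (f ⁻¹' {k}) ^ (Finset.univ.filter (fun i => r i = k)).card := by
    intro ν
    rw [← Finset.prod_fiberwise' Finset.univ r (fun k => ν (f ⁻¹' {k}))]
    simp
  simp_rw [hprod]
  rw [hΛ.lintegral_prod_pow h0 h1 hγ hf _ hm hcount, samplingLaw_apply]
  simp_rw [partitionMeasure_colour G₀ hf]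
  rw [sum_partitionWeight_mul h0 h1 _ fun π => Finset.prod_nonneg fun _ _ => measureReal_nonneg]
  congr 1
  refine setLIntegral_congr_fun measurableSet_Ioi fun u hu => ?_
  rw [mul_comm (∏ k, _)]
  congr 3
  simp_rw [← Finset.prod_mul_distrib]
  refine partitionSum_blockWeight_colour (fun k => G₀.real (f ⁻¹' {k})) r
    (fun B => G₀.real {y | ∀ i ∈ B, f y = r i}) ?_ ?_ hu Finset.univ
  · intro a B hB
    congr 1
    ext y
    simp only [Finset.forall_mem_insert, Set.mem_ofPred_eq, Set.mem_preimage, Set.mem_singleton_iff]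
    exact ⟨fun h => h.1, fun h => ⟨h, fun i hi => h.trans (hB i hi).symm⟩⟩
  · intro a b B ha hb hab
    have : {y | ∀ i ∈ B, f y = r i} = ∅ := by
      ext y
      simp only [Set.mem_ofPred_eq, Set.mem_empty_iff_false, iff_false]
      exact fun h => hab ((h a ha).symm.trans (h b hb))
    simp only [this, measureReal_empty]

/-- The law of a sample from a Pitman-Yor process. -/
lemma eq_samplingLaw (h0 : 0 < α) (h1 : α < 1) (hγ : -α < γ)
    {Λ : Measure (Measure S)} (hΛ : IsPitmanYor α γ G₀ Λ) (hm : 1 ≤ m)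
    (ξ : Measure (Fin m → S)) [IsFiniteMeasure ξ]
    (hξ : ∀ A : Fin m → Set S, (∀ i, MeasurableSet (A i)) →
      ξ (Set.pi Set.univ A) = ∫⁻ ν, ∏ i, ν (A i) ∂Λ) :
    ξ = samplingLaw α γ G₀ m := by
  classical
  have key : ∀ A : Fin m → Set S, (∀ i, MeasurableSet (A i)) →
      ξ (Set.pi Set.univ A) = samplingLaw α γ G₀ m (Set.pi Set.univ A) := by
    intro A hA
    -- Colouring a point by its membership in all the `A i` gives finitely many cells, and the
    -- rectangle becomes a union of coloured events.
    set f : S → (Fin m → Prop) := fun y i => y ∈ A i with hf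
    have hfm : Measurable f := measurable_pi_iff.2 fun i => (hA i).mem
    have hF : Measurable fun (x : Fin m → S) (i : Fin m) => f (x i) :=
      measurable_pi_iff.2 fun i => hfm.comp (measurable_pi_apply i)
    have hmap : ξ.map (fun (x : Fin m → S) (i : Fin m) => f (x i)) =
        (samplingLaw α γ G₀ m).map (fun (x : Fin m → S) (i : Fin m) => f (x i)) := by
      refine Measure.ext_of_singleton fun r => ?_
      rw [Measure.map_apply hF (measurableSet_singleton r),
        Measure.map_apply hF (measurableSet_singleton r)]
      have e1 : (fun (x : Fin m → S) (i : Fin m) => f (x i)) ⁻¹' {r} =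
          Set.pi Set.univ fun i => f ⁻¹' {r i} := by
        ext x
        simp [funext_iff]
      have e2 : (fun (x : Fin m → S) (i : Fin m) => f (x i)) ⁻¹' {r} =
          {x | ∀ i, f (x i) = r i} := by
        ext x
        simp [funext_iff]
      rw [e1, hξ _ fun i => hfm (measurableSet_singleton _),
        ← samplingLaw_colour h0 h1 hγ hΛ hm hfm r, ← e2, e1]
    have hpi : Set.pi Set.univ A =
        (fun (x : Fin m → S) (i : Fin m) => f (x i)) ⁻¹' {r | ∀ i, r i i} := by
      ext x
      simp [hf]
    have hset : MeasurableSet {r : Fin m → Fin m → Prop | ∀ i, r i i} :=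
      Set.toFinite _ |>.measurableSet
    rw [hpi, ← Measure.map_apply hF hset, hmap, Measure.map_apply hF hset]
  refine ext_of_generate_finite _ generateFrom_pi.symm isPiSystem_pi ?_ ?_
  · rintro _ ⟨A, hA, rfl⟩
    exact key A fun i => hA i (Set.mem_univ i)
  · have := key (fun _ => Set.univ) fun _ => MeasurableSet.univ
    simpa using this

end SamplingLaw

/-! ### Pairwise independent hashing of diffuse symbols -/

section Hash

variable {Ω S : Type*} [MeasurableSpace Ω] [MeasurableSpace S] {Pr : Measure Ω}
  {J : ℕ} {h : Ω → S → Fin J}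

lemma IsPairwiseIndependentHash.measurableSet_eq (hh : IsPairwiseIndependentHash Pr h) (x : S)
    (v : Fin J) : MeasurableSet {ω | h ω x = v} :=
  hh.measurable_eval x (measurableSet_singleton v)

lemma IsPairwiseIndependentHash.measureReal_inter (hh : IsPairwiseIndependentHash Pr h) {x y : S}
    (hxy : x ≠ y) (v w : Fin J) :
    Pr.real ({ω | h ω x = v} ∩ {ω | h ω y = w}) = ((J : ℝ) ^ 2)⁻¹ := by
  have := hh.pairwise x y hxy v w
  rw [measureReal_def, ← Set.ofPred_and, this]
  simp

variable [IsProbabilityMeasure Pr]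

/-- The uniform marginal follows by summing the pair law over the bucket of a second symbol, which
exists because `S` is nontrivial. -/
lemma IsPairwiseIndependentHash.measureReal_eq [Nontrivial S]
    (hh : IsPairwiseIndependentHash Pr h) (x : S) (v : Fin J) :
    Pr.real {ω | h ω x = v} = (J : ℝ)⁻¹ := by
  obtain ⟨y, hy⟩ := exists_ne x
  have hJ : (J : ℝ) ≠ 0 := by
    have := Fin.pos v
    positivity
  have h1 : Pr.real {ω | h ω x = v} =
      ∑ w, Pr.real ({ω | h ω x = v} ∩ {ω | h ω y = w}) := by
    rw [← measureReal_biUnion_finset]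
    · congr 1
      ext ω
      simp
    · intro w _ w' _ hww
      refine Set.disjoint_left.2 fun ω hω hω' => hww ?_
      exact hω.2.symm.trans hω'.2
    · exact fun w _ => (hh.measurableSet_eq x v).inter (hh.measurableSet_eq y w)
  rw [h1, Finset.sum_congr rfl fun w _ => hh.measureReal_inter hy.symm v w]
  simp
  field_simp

/-- An event is uncorrelated with all but countably many of pairwise independent hash values. -/
lemma IsPairwiseIndependentHash.countable_measureReal_inter_ne [Nontrivial S]
    (hh : IsPairwiseIndependentHash Pr h) {E : Set Ω} (hE : MeasurableSet E) (v : Fin J) :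
    {x | Pr.real (E ∩ {ω | h ω x = v}) ≠ Pr.real E * (J : ℝ)⁻¹}.Countable := by
  have hJ0 : 0 < J := Fin.pos v
  -- With a single bucket the indicators have variance zero and cannot be normalized, but the claim
  -- is then trivial.
  rcases Nat.lt_or_ge 1 J with hJ | hJ
  swap
  · obtain rfl : J = 1 := le_antisymm hJ hJ0
    have : ∀ x, {ω | h ω x = v} = Set.univ := fun x => by
      ext ω
      simp [Subsingleton.elim (h ω x) v]
    simp [this]
  set p : ℝ := (J : ℝ)⁻¹ with hp
  have hJR : (1 : ℝ) < J := by exact_mod_cast hJ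
  have hp0 : 0 < p := by positivity
  have hp1 : p < 1 := inv_lt_one_of_one_lt₀ hJR
  have hvar : 0 < p - p ^ 2 := by nlinarith
  set b : Lp ℝ 2 Pr := indicatorConstLp 2 MeasurableSet.univ (measure_ne_top Pr _) 1 with hb
  set a : S → Lp ℝ 2 Pr := fun x =>
    indicatorConstLp 2 (hh.measurableSet_eq x v) (measure_ne_top Pr _) 1 with ha
  -- The indicators, centred at `p = 1 / J` and divided by their standard deviation, form an
  -- orthonormal family by pairwise independence.
  set e : S → Lp ℝ 2 Pr := fun x => (Real.sqrt (p - p ^ 2))⁻¹ • (a x - p • b) with he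
  have hbb : inner ℝ b b = 1 := by
    rw [hb, L2.real_inner_indicatorConstLp_one_indicatorConstLp_one]
    simp
  have hab : ∀ x, inner ℝ (a x) b = p := fun x => by
    rw [ha, hb, L2.real_inner_indicatorConstLp_one_indicatorConstLp_one, Set.inter_univ,
      hh.measureReal_eq]
  have hba : ∀ x, inner ℝ b (a x) = p := fun x => by rw [real_inner_comm, hab]
  have hcov : ∀ x y, inner ℝ (e x) (e y) = (p - p ^ 2)⁻¹ * (inner ℝ (a x) (a y) - p ^ 2) := by
    intro x y
    simp only [he, inner_smul_left, inner_smul_right, inner_sub_left, inner_sub_right, hbb, hab,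
      hba, RCLike.conj_to_real]
    have : (Real.sqrt (p - p ^ 2))⁻¹ * (Real.sqrt (p - p ^ 2))⁻¹ = (p - p ^ 2)⁻¹ := by
      rw [← mul_inv, Real.mul_self_sqrt hvar.le]
    rw [← this]
    ring
  have horth : Orthonormal ℝ e := by
    constructor
    · intro x
      have hxx : inner ℝ (a x) (a x) = p := by
        rw [ha, L2.real_inner_indicatorConstLp_one_indicatorConstLp_one, Set.inter_self,
          hh.measureReal_eq]
      have : ‖e x‖ ^ 2 = 1 := by
        rw [← real_inner_self_eq_norm_sq, hcov, hxx, inv_mul_cancel₀ hvar.ne']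
      exact (pow_eq_one_iff_of_nonneg (norm_nonneg _) two_ne_zero).1 this
    · intro x y hxy
      rw [hcov]
      have : inner ℝ (a x) (a y) = p ^ 2 := by
        rw [ha, L2.real_inner_indicatorConstLp_one_indicatorConstLp_one,
          hh.measureReal_inter hxy, hp, inv_pow]
      rw [this, sub_self, mul_zero]
  set ε : Lp ℝ 2 Pr := indicatorConstLp 2 hE (measure_ne_top Pr _) 1 with hε
  -- Bessel's inequality: the squared coefficients of the indicator of `E` are summable, so only
  -- countably many are nonzero.
  have hsum := horth.inner_products_summable (x := ε)
  refine hsum.countable_support.mono fun x hx => ?_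
  rw [Function.mem_support]
  refine pow_ne_zero 2 (norm_ne_zero_iff.2 ?_)
  have h1 : inner ℝ (a x) ε = Pr.real (E ∩ {ω | h ω x = v}) := by
    rw [ha, hε, L2.real_inner_indicatorConstLp_one_indicatorConstLp_one, Set.inter_comm]
  have h2 : inner ℝ b ε = Pr.real E := by
    rw [hb, hε, L2.real_inner_indicatorConstLp_one_indicatorConstLp_one, Set.univ_inter]
  simp only [he, inner_smul_left, inner_sub_left, h1, h2, RCLike.conj_to_real]
  refine mul_ne_zero (inv_ne_zero (Real.sqrt_pos.2 hvar).ne') (sub_ne_zero.2 fun hx' => hx ?_)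
  rw [hx', mul_comm]

variable (G₀ : Measure S) [IsProbabilityMeasure G₀]

lemma nontrivial_of_nullSingletonClass [NullSingletonClass G₀] : Nontrivial S := by
  by_contra hcon
  rw [not_nontrivial_iff_subsingleton] at hcon
  have h1 : G₀ Set.univ = 0 := Set.subsingleton_univ.measure_zero G₀
  simp at h1

/-- Pairwise independent hash values of an i.i.d. diffuse sample are independent and uniform. -/
lemma IsPairwiseIndependentHash.ae_pi_fin [NullSingletonClass G₀]
    (hh : IsPairwiseIndependentHash Pr h) (k : ℕ) (v : Fin k → Fin J) :
    ∀ᵐ y ∂(Measure.pi fun _ : Fin k => G₀),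
      Pr.real {ω | ∀ i, h ω (y i) = v i} = ((J : ℝ)⁻¹) ^ k := by
  have : Nontrivial S := nontrivial_of_nullSingletonClass G₀
  induction k with
  | zero => simp
  | succ k ih =>
    have hmeas : MeasurableSet {y : Fin (k + 1) → S |
        Pr.real {ω | ∀ i, h ω (y i) = v i} = ((J : ℝ)⁻¹) ^ (k + 1)} :=
      (hh.measurable_law (k + 1) v).ennreal_toReal (measurableSet_singleton _)
    have hmp := (measurePreserving_piFinSuccAbove (fun _ : Fin (k + 1) => G₀) 0).symm
    have hmeas2 : MeasurableSet {z : S × (Fin k → S) |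
        Pr.real {ω | ∀ i, h ω ((MeasurableEquiv.piFinSuccAbove (fun _ => S) 0).symm
          (z.1, z.2) i) = v i} = ((J : ℝ)⁻¹) ^ (k + 1)} := hmp.measurable hmeas
    -- The order of integration is exchanged so that the tail `y` is fixed first: the countable
    -- exceptional set for the first symbol depends on the event determined by `y`.
    rw [← hmp.map_eq, ae_map_iff hmp.measurable.aemeasurable hmeas,
      Measure.ae_prod_iff_ae_ae hmeas2, Measure.ae_ae_comm hmeas2]
    filter_upwards [ih (fun i => v i.succ)] with y hy
    have hE : MeasurableSet {ω | ∀ i, h ω (y i) = v i.succ} := by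
      rw [Set.ofPred_forall]
      exact MeasurableSet.iInter fun i => hh.measurableSet_eq _ _
    have hc := hh.countable_measureReal_inter_ne hE (v 0)
    have hae : ∀ᵐ x ∂G₀, x ∉ {x | Pr.real ({ω | ∀ i, h ω (y i) = v i.succ} ∩ {ω | h ω x = v 0}) ≠
        Pr.real {ω | ∀ i, h ω (y i) = v i.succ} * (J : ℝ)⁻¹} :=
      measure_eq_zero_iff_ae_notMem.1 (hc.measure_zero G₀)
    filter_upwards [hae] with x hx
    have hx' := not_not.1 hx
    rw [hy, ← pow_succ] at hx'
    rw [← hx']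
    congr 1
    ext ω
    simp [Fin.forall_fin_succ, and_comm]

variable {ι : Type*} [Fintype ι]

lemma map_pi_comp_injective {k : ℕ} {e : Fin k → ι} (he : Function.Injective e) :
    (Measure.pi fun _ : ι => G₀).map (fun Y j => Y (e j)) = Measure.pi fun _ : Fin k => G₀ := by
  classical
  symm
  refine Measure.pi_eq fun A hA => ?_
  have hpre : (fun (Y : ι → S) (j : Fin k) => Y (e j)) ⁻¹' Set.pi Set.univ A =
      Set.pi Set.univ fun b => ⋂ j, ⋂ _ : e j = b, A j := by
    ext Y
    simp only [Set.mem_preimage, Set.mem_pi, Set.mem_univ, true_imp_iff, Set.mem_iInter]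
    exact ⟨fun H b j hj => hj ▸ H j, fun H j => H _ j rfl⟩
  rw [Measure.map_apply (by fun_prop) (MeasurableSet.univ_pi hA), hpre, Measure.pi_pi,
    ← Finset.prod_subset (Finset.subset_univ (Finset.univ.image e)),
    Finset.prod_image fun _ _ _ _ hij => he hij]
  · refine Finset.prod_congr rfl fun j _ => ?_
    congr 1
    ext y
    simp only [Set.mem_iInter]
    exact ⟨fun H => H j rfl, fun H j' hj' => he hj' ▸ H⟩
  · intro b _ hb
    have : ⋂ j, ⋂ _ : e j = b, A j = Set.univ := by
      ext y
      simp only [Set.mem_iInter, Set.mem_univ, iff_true]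
      rintro j rfl
      exact absurd (Finset.mem_image_of_mem e (Finset.mem_univ j)) hb
    rw [this, measure_univ]

/-- Block labels are indexed by all finite subsets of the sample indices; enumerating `t` and
projecting onto its coordinates brings the claim back to `Fin`. -/
lemma IsPairwiseIndependentHash.ae_pi_finset [NullSingletonClass G₀]
    (hh : IsPairwiseIndependentHash Pr h) (t : Finset ι) (v : ι → Fin J) :
    ∀ᵐ Y ∂(Measure.pi fun _ : ι => G₀),
      Pr.real {ω | ∀ b ∈ t, h ω (Y b) = v b} = ((J : ℝ)⁻¹) ^ t.card := by
  have he : Function.Injective fun j : Fin t.card => (t.equivFin.symm j : ι) :=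
    Subtype.val_injective.comp t.equivFin.symm.injective
  have hae := hh.ae_pi_fin G₀ t.card fun j => v (t.equivFin.symm j)
  rw [← map_pi_comp_injective G₀ he] at hae
  filter_upwards [ae_of_ae_map (measurable_pi_lambda _ fun _ => measurable_pi_apply _).aemeasurable
    hae] with Y hY
  rw [← hY]
  congr 1
  ext ω
  refine ⟨fun H j => H _ (t.equivFin.symm j).2, fun H b hb => ?_⟩
  have := H (t.equivFin ⟨b, hb⟩)
  simpa using this

/-- Distinct blocks almost surely carry distinct symbols, so the frequencies in the sample are the
block sizes. -/
lemma ae_pi_injective [MeasurableEq S] [NullSingletonClass G₀] :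
    ∀ᵐ Y ∂(Measure.pi fun _ : ι => G₀), Function.Injective Y := by
  have key : ∀ a b : ι, a ≠ b → ∀ᵐ Y ∂(Measure.pi fun _ : ι => G₀), Y a ≠ Y b := by
    intro a b hab
    have he : Function.Injective ![a, b] := by
      intro i j hij
      fin_cases i <;> fin_cases j <;> simp_all
    have hm : MeasurableSet {y : Fin 2 → S | y 0 ≠ y 1} :=
      (measurableSet_eq_fun (measurable_pi_apply 0) (measurable_pi_apply 1)).compl
    have hmp := (measurePreserving_piFinSuccAbove (fun _ : Fin 2 => G₀) 0).symm
    have hm2 : MeasurableSet {z : S × (Fin 1 → S) |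
        (MeasurableEquiv.piFinSuccAbove (fun _ => S) 0).symm z 0 ≠
          (MeasurableEquiv.piFinSuccAbove (fun _ => S) 0).symm z 1} := hmp.measurable hm
    have h2 : ∀ᵐ y ∂(Measure.pi fun _ : Fin 2 => G₀), y 0 ≠ y 1 := by
      rw [← hmp.map_eq, ae_map_iff hmp.measurable.aemeasurable hm,
        Measure.ae_prod_iff_ae_ae hm2]
      refine ae_of_all _ fun x => ?_
      have h0 : ∀ᵐ z ∂G₀, z ≠ x := by
        rw [ae_iff]
        simp
      have h1 := (measurePreserving_eval (fun _ : Fin 1 => G₀) 0).quasiMeasurePreserving.ae h0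
      filter_upwards [h1] with z hz
      simpa using Ne.symm hz
    rw [← map_pi_comp_injective G₀ he] at h2
    filter_upwards [ae_of_ae_map (measurable_pi_lambda _ fun _ => measurable_pi_apply _).aemeasurable
      h2] with Y hY
    simpa using hY
  have hall : ∀ᵐ Y ∂(Measure.pi fun _ : ι => G₀), ∀ a b : ι, a ≠ b → Y a ≠ Y b := by
    simp only [ae_all_iff]
    exact key
  filter_upwards [hall] with Y hY a b hab
  by_contra hne
  exact hY a b hne hab

end Hash

/-! ### Hash values of a sample with a given partition -/

section PartitionHash

variable {Ω S : Type*} [MeasurableSpace Ω] [MeasurableSpace S] {Pr : Measure Ω}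
  [IsProbabilityMeasure Pr] {J m : ℕ} {h : Ω → S → Fin J}

open Classical in
/-- The factor of a block in the probability that the hash values of a sample are `r`. -/
noncomputable def hashWeight {J : ℕ} {ι : Type*} (r : ι → Fin J) (B : Finset ι) : ℝ :=
  if ∀ i ∈ B, ∀ i' ∈ B, r i = r i' then (J : ℝ)⁻¹ else 0

lemma hashWeight_nonneg {ι : Type*} (r : ι → Fin J) (B : Finset ι) : 0 ≤ hashWeight r B := by
  unfold hashWeight
  split_ifs <;> positivity

lemma hashWeight_insert {ι : Type*} [DecidableEq ι] (r : ι → Fin J) (a : ι) (B : Finset ι)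
    (hB : ∀ i ∈ B, r i = r a) : hashWeight r (insert a B) = (J : ℝ)⁻¹ := by
  refine if_pos fun i hi i' hi' => ?_
  have : ∀ i ∈ insert a B, r i = r a := fun i hi => by
    rcases Finset.mem_insert.1 hi with rfl | hi
    · rfl
    · exact hB i hi
  rw [this i hi, this i' hi']

lemma hashWeight_eq_zero {ι : Type*} (r : ι → Fin J) {a b : ι} {B : Finset ι} (ha : a ∈ B)
    (hb : b ∈ B) (hab : r a ≠ r b) : hashWeight r B = 0 :=
  if_neg fun H => hab (H a ha b hb)

/-- The hash values of a sample with partition `π` are those of its blocks. -/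
lemma IsPairwiseIndependentHash.ae_partition (G₀ : Measure S) [IsProbabilityMeasure G₀]
    [NullSingletonClass G₀] (hh : IsPairwiseIndependentHash Pr h)
    (π : Finpartition (Finset.univ : Finset (Fin m))) (r : Fin m → Fin J) :
    ∀ᵐ Y ∂(Measure.pi fun _ : Finset (Fin m) => G₀),
      Pr {ω | ∀ i, h ω (Y (π.part i)) = r i} =
        ENNReal.ofReal (∏ B ∈ π.parts, hashWeight r B) := by
  by_cases hconst : ∀ B ∈ π.parts, ∀ i ∈ B, ∀ i' ∈ B, r i = r i'
  · have hprod : ∏ B ∈ π.parts, hashWeight r B = ((J : ℝ)⁻¹) ^ π.parts.card := by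
      rw [← Finset.prod_const]
      exact Finset.prod_congr rfl fun B hB => if_pos (hconst B hB)
    rcases isEmpty_or_nonempty (Fin J) with hJ | ⟨⟨j₀⟩⟩
    · have : Nonempty Ω := nonempty_of_isProbabilityMeasure Pr
      have : Nonempty S := nonempty_of_isProbabilityMeasure G₀
      exact (hJ.false (h (Classical.arbitrary Ω) (Classical.arbitrary S))).elim
    classical
    -- The common bucket of the block, read off at an arbitrary element. The default `j₀` is used
    -- only for the empty set, which is never a block.
    set v : Finset (Fin m) → Fin J := fun B => if hB : B.Nonempty then r hB.choose else j₀ with hv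
    have hvr : ∀ i, v (π.part i) = r i := by
      intro i
      have hmem := π.part_mem.2 (Finset.mem_univ i)
      have hne := π.nonempty_of_mem_parts hmem
      rw [hv]
      simp only [hne, dif_pos]
      exact hconst _ hmem _ hne.choose_spec _ (π.mem_part_self.2 (Finset.mem_univ i))
    filter_upwards [hh.ae_pi_finset G₀ π.parts v] with Y hY
    rw [hprod, ← hY, ofReal_measureReal]
    congr 1
    ext ω
    refine ⟨fun H B hB => ?_, fun H i => ?_⟩
    · obtain ⟨i, hi⟩ := π.nonempty_of_mem_parts hB
      rw [← π.part_eq_of_mem hB hi, hvr]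
      exact H i
    · rw [← hvr]
      exact H _ (π.part_mem.2 (Finset.mem_univ i))
  · push Not at hconst
    obtain ⟨B, hB, i, hi, i', hi', hne⟩ := hconst
    refine ae_of_all _ fun Y => ?_
    rw [Finset.prod_eq_zero hB (hashWeight_eq_zero r hi hi' hne), ENNReal.ofReal_zero]
    have : {ω | ∀ i, h ω (Y (π.part i)) = r i} = ∅ := by
      ext ω
      simp only [Set.mem_ofPred_eq, Set.mem_empty_iff_false, iff_false]
      intro H
      have h1 := H i
      have h2 := H i'
      rw [π.part_eq_of_mem hB hi] at h1
      rw [π.part_eq_of_mem hB hi'] at h2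
      exact hne (h1.symm.trans h2)
    rw [this, measure_empty]

end PartitionHash

/-! ### Factorization over the buckets and integration of the latent variable -/

section HashedSample

variable {Ω S : Type*} [MeasurableSpace Ω] [MeasurableSpace S] {Pr : Measure Ω}
  [IsProbabilityMeasure Pr] {J m : ℕ} {h : Ω → S → Fin J} {α γ : ℝ}
  {G₀ : Measure S} [IsProbabilityMeasure G₀] [NullSingletonClass G₀]

/-- By independence, restricting to prescribed hash values reweights the sample law by the density
`q`. On the component of `π`, the density is almost surely the product of the hash weights, and `Φ`
depends on `π` alone because the labels are almost surely distinct. -/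
lemma lintegral_hash_eq_sum [MeasurableEq S] (hh : IsPairwiseIndependentHash Pr h)
    {X : Fin m → Ω → S} (hX : ∀ i, Measurable (X i))
    (hlaw : Pr.map (fun ω i => X i ω) = samplingLaw α γ G₀ m)
    (hmh : ∀ i, Measurable fun ω => h ω (X i ω)) (r : Fin m → Fin J)
    (hind : ∀ A : Set (Fin m → S), MeasurableSet A →
      Pr {ω | (fun i => X i ω) ∈ A ∧ ∀ i, h ω (X i ω) = r i} =
        ∫⁻ ω in {ω | (fun i => X i ω) ∈ A}, Pr {ω' | ∀ i, h ω' (X i ω) = r i} ∂Pr)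
    {Φ : (Fin m → S) → ℝ≥0∞} (hΦ : Measurable Φ)
    {φ : Finpartition (Finset.univ : Finset (Fin m)) → ℝ}
    (hφ : ∀ (π : Finpartition (Finset.univ : Finset (Fin m))) (Y : Finset (Fin m) → S),
      Function.Injective Y → Φ (fun i => Y (π.part i)) = ENNReal.ofReal (φ π)) :
    ∫⁻ ω in {ω | ∀ i, h ω (X i ω) = r i}, Φ (fun i => X i ω) ∂Pr =
      ∑ π, partitionWeight α γ π *
        ENNReal.ofReal ((∏ B ∈ π.parts, hashWeight r B) * φ π) := by
  set q : (Fin m → S) → ℝ≥0∞ := fun x => Pr {ω | ∀ i, h ω (x i) = r i} with hq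
  have hqm : Measurable q := hh.measurable_law m r
  have hXm : Measurable fun ω i => X i ω := measurable_pi_iff.2 hX
  have hset : MeasurableSet {ω | ∀ i, h ω (X i ω) = r i} := by
    rw [Set.ofPred_forall]
    exact MeasurableSet.iInter fun i => hmh i (measurableSet_singleton _)
  have hmeas : (Pr.restrict {ω | ∀ i, h ω (X i ω) = r i}).map (fun ω i => X i ω) =
      (samplingLaw α γ G₀ m).withDensity q := by
    ext A hA
    rw [Measure.map_apply hXm hA, Measure.restrict_apply (hXm hA), withDensity_apply _ hA, ← hlaw,
      setLIntegral_map hA hqm hXm]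
    exact hind A hA
  rw [← lintegral_map hΦ hXm, hmeas, lintegral_withDensity_eq_lintegral_mul _ hqm hΦ,
    samplingLaw, lintegral_finsetSum_measure]
  refine Finset.sum_congr rfl fun π _ => ?_
  rw [lintegral_smul_measure, smul_eq_mul, partitionMeasure,
    lintegral_map (hqm.mul hΦ) (measurable_comp_part π)]
  congr 1
  have hae : ∀ᵐ Y ∂(Measure.pi fun _ : Finset (Fin m) => G₀),
      (q * Φ) (fun i => Y (π.part i)) =
        ENNReal.ofReal ((∏ B ∈ π.parts, hashWeight r B) * φ π) := by
    filter_upwards [hh.ae_partition G₀ π r, ae_pi_injective (ι := Finset (Fin m)) G₀] with Y h1 h2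
    rw [Pi.mul_apply, hφ π Y h2, ENNReal.ofReal_mul
      (Finset.prod_nonneg fun B _ => hashWeight_nonneg r B), ← h1]
  rw [lintegral_congr_ae hae]
  simp

/-- The contribution to `partitionSum` of one bucket with `d` elements. -/
noncomputable def bucketFactor (α : ℝ) (J : ℕ) (u : ℝ) (d : ℕ) : ℝ :=
  (u ^ d)⁻¹ * (genFactorialPoly α d).eval ((J : ℝ)⁻¹ * u ^ α)

variable {ι : Type*} [DecidableEq ι]

lemma partitionSum_hash (r : ι → Fin J) {u : ℝ} (hu : 0 < u) (s : Finset ι) :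
    partitionSum (fun B => blockWeight α u B.card * hashWeight r B) s =
      ∏ k, bucketFactor α J u (s.filter (fun i => r i = k)).card :=
  partitionSum_blockWeight_colour (fun _ => (J : ℝ)⁻¹) r (hashWeight r)
    (fun a B hB => hashWeight_insert r a B hB)
    (fun _ _ _ ha hb hab => hashWeight_eq_zero r ha hb hab) hu s

lemma partitionSum_hash_sdiff (r : ι → Fin J) {u : ℝ} (hu : 0 < u) {s B : Finset ι} {k : Fin J}
    (hB : B ⊆ s.filter (fun i => r i = k)) :
    partitionSum (fun B => blockWeight α u B.card * hashWeight r B) (s \ B) =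
      ∏ k', bucketFactor α J u ((s.filter (fun i => r i = k')).card -
        if k' = k then B.card else 0) := by
  rw [partitionSum_hash r hu]
  refine Finset.prod_congr rfl fun k' _ => ?_
  congr 1
  split_ifs with hk
  · subst hk
    rw [← Finset.card_sdiff_of_subset hB]
    congr 1
    ext i
    simp only [Finset.mem_filter, Finset.mem_sdiff]
    tauto
  · rw [Nat.sub_zero]
    congr 1
    ext i
    simp only [Finset.mem_filter, Finset.mem_sdiff]
    refine ⟨fun H => ⟨H.1.1, H.2⟩, fun H => ⟨⟨H.1, fun hi => hk ?_⟩, H.2⟩⟩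
    exact H.2.symm.trans (Finset.mem_filter.1 (hB hi)).2

/-- A marked block of size `l` with nonzero weight lies in one bucket `k`, where it can be chosen in
a binomial number of ways; the rest factorizes with that bucket lowered by `l`. -/
lemma sum_prod_parts_mul_count (r : ι → Fin J) {u : ℝ} (hu : 0 < u) (s : Finset ι) {l : ℕ}
    (hl : 1 ≤ l) :
    ∑ π : Finpartition s, (∏ B ∈ π.parts, blockWeight α u B.card * hashWeight r B) *
        ((π.parts.filter (fun B => B.card = l)).card : ℝ) =
      ∑ k, ((s.filter (fun i => r i = k)).card.choose l : ℝ) * (blockWeight α u l * (J : ℝ)⁻¹ *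
        ∏ k', bucketFactor α J u ((s.filter (fun i => r i = k')).card -
          if k' = k then l else 0)) := by
  have h1 := sum_prod_parts_mul_sum (fun B => blockWeight α u B.card * hashWeight r B)
    (fun B => if B.card = l then (1 : ℝ) else 0) s
  simp only [Finset.sum_boole] at h1
  rw [h1]
  have h2 : ∀ B ∈ s.powerset.filter (fun B => B.Nonempty),
      (if B.card = l then (1 : ℝ) else 0) * (blockWeight α u B.card * hashWeight r B *
        partitionSum (fun B => blockWeight α u B.card * hashWeight r B) (s \ B)) =
      ∑ k, if B ∈ (s.filter (fun i => r i = k)).powersetCard l then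
        (blockWeight α u l * (J : ℝ)⁻¹ *
          ∏ k', bucketFactor α J u ((s.filter (fun i => r i = k')).card -
            if k' = k then l else 0)) else 0 := by
    intro B hB
    simp only [Finset.mem_filter, Finset.mem_powerset] at hB
    obtain ⟨hBs, a, ha⟩ := hB
    by_cases hBl : B.card = l
    swap
    · rw [if_neg hBl, zero_mul]
      refine (Finset.sum_eq_zero fun k _ => if_neg fun H => hBl ?_).symm
      exact (Finset.mem_powersetCard.1 H).2
    rw [if_pos hBl, one_mul]
    by_cases hconst : ∀ i ∈ B, r i = r a
    · have hsub : B ⊆ s.filter (fun i => r i = r a) :=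
        fun i hi => Finset.mem_filter.2 ⟨hBs hi, hconst i hi⟩
      rw [Finset.sum_eq_single (r a), if_pos (Finset.mem_powersetCard.2 ⟨hsub, hBl⟩),
        partitionSum_hash_sdiff r hu hsub, hBl]
      · congr 2
        have := hashWeight_insert r a B hconst
        rwa [Finset.insert_eq_of_mem ha] at this
      · intro k _ hk
        refine if_neg fun H => hk ?_
        exact (Finset.mem_filter.1 ((Finset.mem_powersetCard.1 H).1 ha)).2.symm
      · exact fun H => absurd (Finset.mem_univ _) H
    · push Not at hconst
      obtain ⟨i, hi, hia⟩ := hconst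
      rw [hashWeight_eq_zero r hi ha hia, mul_zero, zero_mul]
      refine (Finset.sum_eq_zero fun k _ => if_neg fun H => hia ?_).symm
      have hs := (Finset.mem_powersetCard.1 H).1
      exact (Finset.mem_filter.1 (hs hi)).2.trans (Finset.mem_filter.1 (hs ha)).2.symm
  rw [Finset.sum_congr rfl h2, Finset.sum_comm]
  refine Finset.sum_congr rfl fun k _ => ?_
  rw [← Finset.sum_filter, Finset.sum_const, nsmul_eq_mul, ← Finset.card_powersetCard]
  congr 3
  ext B
  simp only [Finset.mem_filter, Finset.mem_powersetCard, Finset.mem_powerset, and_iff_right_iff_imp]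
  rintro ⟨hB, rfl⟩
  exact ⟨hB.trans (Finset.filter_subset _ _), Finset.card_pos.1 hl⟩

lemma card_filter_mem_powersetCard {t : Finset ι} {a : ι} (ha : a ∈ t) (l : ℕ) :
    ((t.powersetCard (l + 1)).filter (fun B => a ∈ B)).card = (t.card - 1).choose l := by
  rw [← Finset.card_erase_of_mem ha, ← Finset.card_powersetCard]
  symm
  refine Finset.card_bij (fun B _ => insert a B) ?_ ?_ ?_
  · intro B hB
    obtain ⟨hB, hl⟩ := Finset.mem_powersetCard.1 hB
    have haB : a ∉ B := fun H => Finset.notMem_erase a t (hB H)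
    refine Finset.mem_filter.2 ⟨Finset.mem_powersetCard.2 ⟨?_, ?_⟩, Finset.mem_insert_self _ _⟩
    · exact Finset.insert_subset ha (hB.trans (Finset.erase_subset _ _))
    · rw [Finset.card_insert_of_notMem haB, hl]
  · intro B hB C hC H
    have haB : a ∉ B := fun H => Finset.notMem_erase a t ((Finset.mem_powersetCard.1 hB).1 H)
    have haC : a ∉ C := fun H => Finset.notMem_erase a t ((Finset.mem_powersetCard.1 hC).1 H)
    rw [← Finset.erase_insert haB, H, Finset.erase_insert haC]
  · intro B hB
    obtain ⟨hB, haB⟩ := Finset.mem_filter.1 hB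
    obtain ⟨hB, hl⟩ := Finset.mem_powersetCard.1 hB
    refine ⟨B.erase a, Finset.mem_powersetCard.2 ⟨Finset.erase_subset_erase _ hB, ?_⟩,
      Finset.insert_erase haB⟩
    rw [Finset.card_erase_of_mem haB, hl, Nat.add_sub_cancel]

/-- The marked block now contains `a`, so its bucket is that of `a` and only `l` further elements
are chosen, from the bucket without `a`. -/
lemma sum_prod_parts_mul_part (r : ι → Fin J) {u : ℝ} (hu : 0 < u) {s : Finset ι} {a : ι}
    (ha : a ∈ s) (l : ℕ) :
    ∑ π : Finpartition s, (∏ B ∈ π.parts, blockWeight α u B.card * hashWeight r B) *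
        (if (π.part a).card = l + 1 then (1 : ℝ) else 0) =
      (((s.filter (fun i => r i = r a)).card - 1).choose l : ℝ) *
        (blockWeight α u (l + 1) * (J : ℝ)⁻¹ *
        ∏ k', bucketFactor α J u ((s.filter (fun i => r i = k')).card -
          if k' = r a then l + 1 else 0)) := by
  have h0 : ∀ π : Finpartition s, (if (π.part a).card = l + 1 then (1 : ℝ) else 0) =
      ∑ B ∈ π.parts, if a ∈ B ∧ B.card = l + 1 then 1 else 0 := by
    intro π
    rw [Finset.sum_eq_single (π.part a)]
    · simp [π.mem_part_self.2 ha]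
    · intro B hB hne
      exact if_neg fun H => hne (π.part_eq_of_mem hB H.1).symm
    · exact fun H => absurd (π.part_mem.2 ha) H
  simp_rw [h0]
  rw [sum_prod_parts_mul_sum (fun B => blockWeight α u B.card * hashWeight r B)]
  have h2 : ∀ B ∈ s.powerset.filter (fun B => B.Nonempty),
      (if a ∈ B ∧ B.card = l + 1 then (1 : ℝ) else 0) * (blockWeight α u B.card * hashWeight r B *
        partitionSum (fun B => blockWeight α u B.card * hashWeight r B) (s \ B)) =
      if B ∈ ((s.filter (fun i => r i = r a)).powersetCard (l + 1)).filter (fun B => a ∈ B) then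
        (blockWeight α u (l + 1) * (J : ℝ)⁻¹ *
          ∏ k', bucketFactor α J u ((s.filter (fun i => r i = k')).card -
            if k' = r a then l + 1 else 0)) else 0 := by
    intro B hB
    simp only [Finset.mem_filter, Finset.mem_powerset] at hB
    by_cases hBl : a ∈ B ∧ B.card = l + 1
    swap
    · rw [if_neg hBl, zero_mul, if_neg fun H => hBl ?_]
      have := Finset.mem_filter.1 H
      exact ⟨this.2, (Finset.mem_powersetCard.1 this.1).2⟩
    rw [if_pos hBl, one_mul]
    by_cases hconst : ∀ i ∈ B, r i = r a
    · have hsub : B ⊆ s.filter (fun i => r i = r a) :=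
        fun i hi => Finset.mem_filter.2 ⟨hB.1 hi, hconst i hi⟩
      rw [if_pos (Finset.mem_filter.2 ⟨Finset.mem_powersetCard.2 ⟨hsub, hBl.2⟩, hBl.1⟩),
        partitionSum_hash_sdiff r hu hsub, hBl.2]
      congr 2
      have := hashWeight_insert r a B hconst
      rwa [Finset.insert_eq_of_mem hBl.1] at this
    · push Not at hconst
      obtain ⟨i, hi, hia⟩ := hconst
      rw [hashWeight_eq_zero r hi hBl.1 hia, mul_zero, zero_mul, if_neg fun H => hia ?_]
      have hs := (Finset.mem_powersetCard.1 (Finset.mem_filter.1 H).1).1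
      exact (Finset.mem_filter.1 (hs hi)).2
  rw [Finset.sum_congr rfl h2, ← Finset.sum_filter, Finset.sum_const, nsmul_eq_mul,
    ← card_filter_mem_powersetCard (t := s.filter (fun i => r i = r a))
      (Finset.mem_filter.2 ⟨ha, rfl⟩)]
  congr 3
  ext B
  simp only [Finset.mem_filter, Finset.mem_powersetCard, Finset.mem_powerset, and_iff_right_iff_imp]
  rintro ⟨⟨hB, -⟩, haB⟩
  exact ⟨hB.trans (Finset.filter_subset _ _), a, haB⟩

/-- Positivity of the gamma argument is assumed only where the coefficients do not vanish: for `e =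
γ ≤ 0` it fails at `i = 0`. -/
lemma bucketSum_term_nonneg (h0 : 0 < α) (h1 : α < 1) {e : ℝ} {d : Fin J → ℕ}
    (hd : ∀ i : Fin J → ℕ, ∏ k, genFactorialCoeff (d k) (i k) α ≠ 0 →
      0 < e + α * ((∑ k, i k : ℕ) : ℝ)) (i : Fin J → ℕ) :
    0 ≤ Real.Gamma (e / α + ((∑ k, i k : ℕ) : ℝ)) / (J : ℝ) ^ (∑ k, i k) *
      ∏ k, genFactorialCoeff (d k) (i k) α := by
  have hc := Finset.prod_nonneg fun k (_ : k ∈ Finset.univ) =>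
    genFactorialCoeff_nonneg h0 h1 (d k) (i k)
  rcases hc.eq_or_lt' with hz | hz
  · simp [hz]
  have hG : 0 < Real.Gamma (e / α + ((∑ k, i k : ℕ) : ℝ)) := by
    refine Real.Gamma_pos_of_pos ?_
    have : e / α + ((∑ k, i k : ℕ) : ℝ) = (e + α * ((∑ k, i k : ℕ) : ℝ)) / α := by
      field_simp
    rw [this]
    exact div_pos (hd i hz.ne') h0
  positivity

/-- Integrating out the latent variable `u` turns products of bucket polynomials into
`bucketSum`. -/
lemma lintegral_prod_genFactorialPoly (h0 : 0 < α) (h1 : α < 1) (e : ℝ) (d : Fin J → ℕ)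
    (hd : ∀ i : Fin J → ℕ, ∏ k, genFactorialCoeff (d k) (i k) α ≠ 0 →
      0 < e + α * ((∑ k, i k : ℕ) : ℝ)) :
    ∫⁻ u in Set.Ioi (0 : ℝ), ENNReal.ofReal (u ^ (e - 1) * (Real.exp (-u ^ α) *
      ∏ k, (genFactorialPoly α (d k)).eval ((J : ℝ)⁻¹ * u ^ α))) =
      ENNReal.ofReal (bucketSum α (e / α) d / α) := by
  set a : (Fin J → ℕ) → ℝ := fun i => (∏ k, genFactorialCoeff (d k) (i k) α) /
    (J : ℝ) ^ (∑ k, i k) with ha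
  have ha0 : ∀ i, 0 ≤ a i := fun i => div_nonneg
    (Finset.prod_nonneg fun k _ => genFactorialCoeff_nonneg h0 h1 _ _) (by positivity)
  have hexp : ∀ u ∈ Set.Ioi (0 : ℝ), ENNReal.ofReal (u ^ (e - 1) * (Real.exp (-u ^ α) *
      ∏ k, (genFactorialPoly α (d k)).eval ((J : ℝ)⁻¹ * u ^ α))) =
      ∑ i ∈ Fintype.piFinset (fun k => Finset.range (d k + 1)), ENNReal.ofReal (a i) *
        ENNReal.ofReal (u ^ (e + α * ((∑ k, i k : ℕ) : ℝ) - 1) * Real.exp (-u ^ α)) := by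
    intro u hu
    have hu' : (0 : ℝ) < u := hu
    have hp : ∏ k, (genFactorialPoly α (d k)).eval ((J : ℝ)⁻¹ * u ^ α) =
        ∑ i ∈ Fintype.piFinset (fun k => Finset.range (d k + 1)),
          a i * u ^ (α * ((∑ k, i k : ℕ) : ℝ)) := by
      simp_rw [genFactorialPoly_eval]
      rw [Finset.prod_univ_sum]
      refine Finset.sum_congr rfl fun i _ => ?_
      rw [Finset.prod_mul_distrib, Finset.prod_pow_eq_pow_sum, mul_pow, inv_pow, ha,
        ← Real.rpow_natCast (u ^ α), ← Real.rpow_mul hu'.le]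
      ring
    rw [hp, Finset.mul_sum, Finset.mul_sum, ENNReal.ofReal_sum_of_nonneg]
    · refine Finset.sum_congr rfl fun i _ => ?_
      rw [← ENNReal.ofReal_mul (ha0 i)]
      congr 1
      rw [show e + α * ((∑ k, i k : ℕ) : ℝ) - 1 = (e - 1) + α * ((∑ k, i k : ℕ) : ℝ) by ring,
        Real.rpow_add hu']
      ring
    · intro i _
      have := ha0 i
      positivity
  rw [setLIntegral_congr_fun measurableSet_Ioi hexp, lintegral_finsetSum _ fun i _ => by fun_prop,
    bucketSum, Finset.sum_div, ENNReal.ofReal_sum_of_nonneg]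
  · refine Finset.sum_congr rfl fun i _ => ?_
    rw [lintegral_const_mul _ (by fun_prop)]
    rcases eq_or_ne (∏ k, genFactorialCoeff (d k) (i k) α) 0 with hz | hz
    · simp [ha, hz]
    have hpos := hd i hz
    -- The integral of `u ^ (q - 1) exp (-u ^ α)` is `Γ(q / α) / α`; this is the source of the gamma
    -- factors in `bucketSum`.
    have hI := integral_rpow_mul_exp_neg_rpow h0
      (by linarith : (-1 : ℝ) < e + α * ((∑ k, i k : ℕ) : ℝ) - 1)
    have harg : (e + α * ((∑ k, i k : ℕ) : ℝ) - 1 + 1) / α = e / α + ((∑ k, i k : ℕ) : ℝ) := by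
      field_simp
      ring
    rw [harg] at hI
    have hG : 0 < Real.Gamma (e / α + ((∑ k, i k : ℕ) : ℝ)) := by
      refine Real.Gamma_pos_of_pos ?_
      rw [← harg]
      exact div_pos (by linarith) h0
    have hL : ∫⁻ u in Set.Ioi (0 : ℝ),
        ENNReal.ofReal (u ^ (e + α * ((∑ k, i k : ℕ) : ℝ) - 1) * Real.exp (-u ^ α)) =
        ENNReal.ofReal (1 / α * Real.Gamma (e / α + ((∑ k, i k : ℕ) : ℝ))) := by
      rw [← hI, ofReal_integral_eq_lintegral_ofReal]
      · exact Integrable.of_integral_ne_zero (by rw [hI]; positivity)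
      · filter_upwards [ae_restrict_mem measurableSet_Ioi] with t ht
        have : (0 : ℝ) < t := ht
        positivity
    rw [hL, ← ENNReal.ofReal_mul (ha0 i), ha]
    congr 1
    ring
  · exact fun i _ => div_nonneg (bucketSum_term_nonneg h0 h1 hd i) h0.le

lemma prod_bucketFactor {u : ℝ} (d : Fin J → ℕ) :
    ∏ k, bucketFactor α J u (d k) =
      (u ^ (∑ k, d k))⁻¹ * ∏ k, (genFactorialPoly α (d k)).eval ((J : ℝ)⁻¹ * u ^ α) := by
  simp_rw [bucketFactor]
  rw [Finset.prod_mul_distrib, Finset.prod_inv_distrib, Finset.prod_pow_eq_pow_sum]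

lemma measurable_bucketFactor (d : ℕ) : Measurable fun u => bucketFactor α J u d := by
  unfold bucketFactor
  have := (genFactorialPoly α d).continuous.measurable
  fun_prop

/-- A nonempty bucket admits no zero index, because its coefficient would vanish. Hence `|i| ≥ 1`,
and `γ + α > 0` is enough even if `γ` is negative. -/
lemma add_mul_sum_pos_of_prod_ne_zero (h0 : 0 < α) (hγ : -α < γ) {d : Fin J → ℕ}
    (hd : 1 ≤ ∑ k, d k) (i : Fin J → ℕ) (hi : ∏ k, genFactorialCoeff (d k) (i k) α ≠ 0) :
    0 < γ + α * ((∑ k, i k : ℕ) : ℝ) := by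
  have hex : ∃ k, d k ≠ 0 := by
    by_contra! hcon
    simp [hcon] at hd
  obtain ⟨k, hk⟩ := hex
  have hik : i k ≠ 0 := by
    intro hik
    refine hi (Finset.prod_eq_zero (Finset.mem_univ k) ?_)
    obtain ⟨l, hl⟩ := Nat.exists_eq_succ_of_ne_zero hk
    rw [hik, hl, Nat.succ_eq_add_one, genFactorialCoeff_succ_zero]
  have h1 : 1 ≤ ∑ k, i k :=
    (Nat.one_le_iff_ne_zero.2 hik).trans (Finset.single_le_sum (f := i) (fun _ _ => Nat.zero_le _)
      (Finset.mem_univ k))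
  have h2 : (1 : ℝ) ≤ ((∑ k, i k : ℕ) : ℝ) := by exact_mod_cast h1
  nlinarith

lemma add_mul_sum_pos (h0 : 0 < α) (hγ : -α < γ) (i : Fin J → ℕ) :
    0 < (γ + α) + α * ((∑ k, i k : ℕ) : ℝ) := by
  have : 0 ≤ α * ((∑ k, i k : ℕ) : ℝ) := by positivity
  linarith

lemma bucketSum_nonneg (h0 : 0 < α) (h1 : α < 1) (hγ : -α < γ) (d : Fin J → ℕ) :
    0 ≤ bucketSum α ((γ + α) / α) d :=
  Finset.sum_nonneg fun i _ =>
    bucketSum_term_nonneg h0 h1 (fun i _ => add_mul_sum_pos h0 hγ i) i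

lemma bucketSum_pos (h0 : 0 < α) (h1 : α < 1) (hγ : -α < γ) {d : Fin J → ℕ}
    (hd : 1 ≤ ∑ k, d k) : 0 < bucketSum α (γ / α) d := by
  have hpos := fun i hi => add_mul_sum_pos_of_prod_ne_zero h0 hγ hd i hi
  refine Finset.sum_pos' (fun i _ => bucketSum_term_nonneg h0 h1 hpos i) ⟨d, by simp, ?_⟩
  have hprod : 0 < ∏ k, genFactorialCoeff (d k) (d k) α :=
    Finset.prod_pos fun k _ => by rw [genFactorialCoeff_self]; positivity
  have hJ : 0 < (J : ℝ) := by
    rcases Nat.eq_zero_or_pos J with rfl | hJ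
    · simp at hd
    · exact_mod_cast hJ
  have hG : 0 < Real.Gamma (γ / α + ((∑ k, d k : ℕ) : ℝ)) := by
    refine Real.Gamma_pos_of_pos ?_
    have : γ / α + ((∑ k, d k : ℕ) : ℝ) = (γ + α * ((∑ k, d k : ℕ) : ℝ)) / α := by
      field_simp
    rw [this]
    exact div_pos (hpos d hprod.ne') h0
  positivity

/-- The powers of `u` combine to `(γ + m - 1) + (α - l) - (m - l) = γ + α - 1`, which explains the
shifted argument `(γ + α) / α`. The size condition is needed only for `C ≠ 0`; in the applications
`C` is a binomial coefficient that vanishes when too few elements are available. -/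
lemma lintegral_blockWeight_mul_prod_bucketFactor (h0 : 0 < α) (h1 : α < 1) (hγ : -α < γ)
    {C : ℝ} (hC : 0 ≤ C) {l : ℕ} (d : Fin J → ℕ) (hd : C ≠ 0 → ∑ k, d k + l = m) :
    ∫⁻ u in Set.Ioi (0 : ℝ), ENNReal.ofReal (u ^ (γ + m - 1) * (Real.exp (-u ^ α) *
      (C * (blockWeight α u l * (J : ℝ)⁻¹ * ∏ k, bucketFactor α J u (d k))))) =
      ENNReal.ofReal (risingFactorial (1 - α) (l - 1) * (J : ℝ)⁻¹ *
        (C * bucketSum α ((γ + α) / α) d)) := by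
  rcases eq_or_ne C 0 with rfl | hC0
  · simp
  have hr := risingFactorial_nonneg (by linarith : 0 ≤ 1 - α) (l - 1)
  have hc : 0 ≤ C * (α * risingFactorial (1 - α) (l - 1)) * (J : ℝ)⁻¹ := by positivity
  have e : ∀ u ∈ Set.Ioi (0 : ℝ), ENNReal.ofReal (u ^ (γ + m - 1) * (Real.exp (-u ^ α) *
      (C * (blockWeight α u l * (J : ℝ)⁻¹ * ∏ k, bucketFactor α J u (d k))))) =
      ENNReal.ofReal (C * (α * risingFactorial (1 - α) (l - 1)) * (J : ℝ)⁻¹) *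
        ENNReal.ofReal (u ^ (γ + α - 1) * (Real.exp (-u ^ α) *
          ∏ k, (genFactorialPoly α (d k)).eval ((J : ℝ)⁻¹ * u ^ α))) := by
    intro u hu
    have hu' : (0 : ℝ) < u := hu
    rw [← ENNReal.ofReal_mul hc, prod_bucketFactor, blockWeight]
    congr 1
    have hp : u ^ (γ + α - 1) = u ^ (γ + m - 1) * u ^ (α - l) * (u ^ (∑ k, d k))⁻¹ := by
      rw [← Real.rpow_natCast u (∑ k, d k), ← Real.rpow_neg hu'.le, ← Real.rpow_add hu',
        ← Real.rpow_add hu', ← hd hC0]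
      congr 1
      push_cast
      ring
    rw [hp]
    ring
  have hm : Measurable fun u : ℝ => ENNReal.ofReal (u ^ (γ + α - 1) * (Real.exp (-u ^ α) *
          ∏ k, (genFactorialPoly α (d k)).eval ((J : ℝ)⁻¹ * u ^ α))) := by
    have : Measurable fun u : ℝ => ∏ k, (genFactorialPoly α (d k)).eval ((J : ℝ)⁻¹ * u ^ α) :=
      Finset.measurable_prod _ fun k _ =>
        (genFactorialPoly α (d k)).continuous.measurable.comp (by fun_prop)
    fun_prop
  rw [setLIntegral_congr_fun measurableSet_Ioi e, lintegral_const_mul _ hm,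
    lintegral_prod_genFactorialPoly h0 h1 (γ + α) d fun i _ => add_mul_sum_pos h0 hγ i,
    ← ENNReal.ofReal_mul hc]
  congr 1
  field_simp

end HashedSample

/-! ### Frequencies and cardinalities in terms of blocks -/

section Statistics

variable {S : Type*} {n : ℕ}

lemma frequency_eq_sum (x : Fin n → S) (y : S) [DecidableEq S] :
    frequency x y = ∑ i, if x i = y then 1 else 0 := by
  rw [frequency, Finset.card_filter]
  refine Finset.sum_congr rfl fun i _ => ?_
  congr

lemma measurable_frequency [MeasurableSpace S] [MeasurableEq S] :
    Measurable fun p : (Fin n → S) × S => frequency p.1 p.2 := by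
  classical
  simp_rw [frequency_eq_sum]
  refine Finset.measurable_sum _ fun i _ => Measurable.ite ?_ measurable_const measurable_const
  exact measurableSet_eq_fun ((measurable_pi_apply i).comp measurable_fst) measurable_snd

/-- Each symbol of frequency `l` is counted by exactly `l` indices. The sum over indices makes
measurability visible. -/
lemma lCardinality_eq_sum_div (x : Fin n → S) {l : ℕ} (hl : 1 ≤ l) :
    lCardinality x l = (∑ i, if frequency x (x i) = l then 1 else 0) / l := by
  classical
  have h1 : ∑ i, (if frequency x (x i) = l then 1 else 0) =
      (Finset.univ.filter fun i => frequency x (x i) = l).card := by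
    rw [Finset.card_filter]
  have h2 : ∀ i ∈ Finset.univ.filter fun i => frequency x (x i) = l,
      x i ∈ (Finset.univ.image x).filter fun y => frequency x y = l := by
    intro i hi
    exact Finset.mem_filter.2 ⟨Finset.mem_image_of_mem x (Finset.mem_univ i),
      (Finset.mem_filter.1 hi).2⟩
  rw [h1, Finset.card_eq_sum_card_fiberwise h2, Finset.sum_const_nat (m := l),
    Nat.mul_div_cancel _ hl,
    lCardinality]
  · intro y hy
    rw [← (Finset.mem_filter.1 hy).2, frequency]
    congr 1
    ext i
    simp only [Finset.mem_filter, Finset.mem_univ, true_and]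
    exact ⟨fun H => H.2, fun H => ⟨by rw [H]; rfl, H⟩⟩

lemma measurable_lCardinality [MeasurableSpace S] [MeasurableEq S] {l : ℕ} (hl : 1 ≤ l) :
    Measurable fun x : Fin n → S => lCardinality x l := by
  simp_rw [fun x : Fin n → S => lCardinality_eq_sum_div x hl]
  have hm : Measurable fun x : Fin n → S => ∑ i, if frequency x (x i) = l then 1 else 0 := by
    refine Finset.measurable_sum _ fun i _ => Measurable.ite ?_ measurable_const measurable_const
    exact (measurable_frequency.comp (measurable_id.prodMk (measurable_pi_apply i)))
      (measurableSet_singleton l)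
  exact (measurable_of_countable fun k : ℕ => k / l).comp hm

lemma lCardinality_le (x : Fin n → S) (l : ℕ) : lCardinality x l ≤ n := by
  classical
  refine (Finset.card_filter_le _ _).trans (Finset.card_image_le.trans ?_)
  simp

lemma cardinality_eq_sum (x : Fin n → S) :
    cardinality x = ∑ l ∈ Finset.Icc 1 n, lCardinality x l := by
  classical
  have h : ∀ y ∈ Finset.univ.image x, frequency x y ∈ Finset.Icc 1 n := by
    intro y hy
    obtain ⟨i, -, rfl⟩ := Finset.mem_image.1 hy
    refine Finset.mem_Icc.2 ⟨Finset.card_pos.2 ⟨i, by simp⟩, ?_⟩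
    exact (Finset.card_filter_le _ _).trans (by simp)
  have := Finset.card_eq_sum_card_fiberwise h
  rw [cardinality]
  convert this using 2
  rw [lCardinality]

variable {m : ℕ}

lemma frequency_comp_part (π : Finpartition (Finset.univ : Finset (Fin m)))
    {Y : Finset (Fin m) → S} (hY : Function.Injective Y) {B : Finset (Fin m)} (hB : B ∈ π.parts) :
    frequency (fun i => Y (π.part i)) (Y B) = B.card := by
  rw [frequency]
  congr 1
  ext i
  simp only [Finset.mem_filter, Finset.mem_univ, true_and]
  rw [hY.eq_iff, π.part_eq_iff_mem hB]

lemma lCardinality_comp_part (π : Finpartition (Finset.univ : Finset (Fin m)))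
    {Y : Finset (Fin m) → S} (hY : Function.Injective Y) (l : ℕ) :
    lCardinality (fun i => Y (π.part i)) l = (π.parts.filter fun B => B.card = l).card := by
  classical
  symm
  refine Finset.card_bij (fun B _ => Y B) ?_ (fun _ _ _ _ H => hY H) ?_
  · intro B hB
    obtain ⟨hB, hl⟩ := Finset.mem_filter.1 hB
    obtain ⟨i, hi⟩ := π.nonempty_of_mem_parts hB
    refine Finset.mem_filter.2 ⟨Finset.mem_image.2 ⟨i, Finset.mem_univ i, ?_⟩, ?_⟩
    · rw [π.part_eq_of_mem hB hi]
    · rw [frequency_comp_part π hY hB, hl]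
  · intro y hy
    obtain ⟨hy, hl⟩ := Finset.mem_filter.1 hy
    obtain ⟨i, -, rfl⟩ := Finset.mem_image.1 hy
    have hB := π.part_mem.2 (Finset.mem_univ i)
    rw [frequency_comp_part π hY hB] at hl
    exact ⟨π.part i, Finset.mem_filter.2 ⟨hB, hl⟩, rfl⟩

/-- The block of the last index contains that index itself, which is not among the first `n`; hence
the `+ 1`. -/
lemma frequency_last_comp_part (π : Finpartition (Finset.univ : Finset (Fin (n + 1))))
    {Y : Finset (Fin (n + 1)) → S} (hY : Function.Injective Y) :
    frequency (fun i : Fin n => Y (π.part i.castSucc)) (Y (π.part (Fin.last n))) + 1 =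
      (π.part (Fin.last n)).card := by
  classical
  rw [← frequency_comp_part π hY (π.part_mem.2 (Finset.mem_univ (Fin.last n))),
    frequency_eq_sum, frequency_eq_sum, Fin.sum_univ_castSucc]
  simp

end Statistics

/-! ### Integrals over the event of prescribed hash values -/

section Posterior

variable {Ω S : Type*} [MeasurableSpace Ω] [MeasurableSpace S] {Pr : Measure Ω}
  [IsProbabilityMeasure Pr] {J m n : ℕ} {h : Ω → S → Fin J} {α γ : ℝ}
  {G₀ : Measure S} [IsProbabilityMeasure G₀] [NullSingletonClass G₀]

/-- The hypotheses on a hashed sample that its distribution depends on. -/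
structure IsHashedSample (Pr : Measure Ω) (h : Ω → S → Fin J) (α γ : ℝ) (G₀ : Measure S)
    (X : Fin m → Ω → S) : Prop where
  measurable_sample : ∀ i, Measurable (X i)
  map_eq : Pr.map (fun ω i => X i ω) = samplingLaw α γ G₀ m
  measurable_hash : ∀ i, Measurable fun ω => h ω (X i ω)
  law : ∀ A : Set (Fin m → S), MeasurableSet A → ∀ r : Fin m → Fin J,
    Pr {ω | (fun i => X i ω) ∈ A ∧ ∀ i, h ω (X i ω) = r i} =
      ∫⁻ ω in {ω | (fun i => X i ω) ∈ A}, Pr {ω' | ∀ i, h ω' (X i ω) = r i} ∂Pr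

/-- The working formula for statistics that depend only on the partition: what remains is a weighted
sum over partitions at fixed `u`. -/
lemma IsHashedSample.lintegral_eq [MeasurableEq S] (h0 : 0 < α) (h1 : α < 1)
    (hh : IsPairwiseIndependentHash Pr h)
    {X : Fin m → Ω → S} (hX : IsHashedSample Pr h α γ G₀ X) (r : Fin m → Fin J)
    {Φ : (Fin m → S) → ℝ≥0∞} (hΦ : Measurable Φ)
    {φ : Finpartition (Finset.univ : Finset (Fin m)) → ℝ} (hφ0 : ∀ π, 0 ≤ φ π)
    (hφ : ∀ (π : Finpartition (Finset.univ : Finset (Fin m))) (Y : Finset (Fin m) → S),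
      Function.Injective Y → Φ (fun i => Y (π.part i)) = ENNReal.ofReal (φ π)) :
    ∫⁻ ω in {ω | ∀ i, h ω (X i ω) = r i}, Φ (fun i => X i ω) ∂Pr =
      ENNReal.ofReal (samplingConstant α γ m) *
        ∫⁻ u in Set.Ioi (0 : ℝ), ENNReal.ofReal (u ^ (γ + m - 1) * (Real.exp (-u ^ α) *
          ∑ π : Finpartition (Finset.univ : Finset (Fin m)),
            (∏ B ∈ π.parts, blockWeight α u B.card * hashWeight r B) * φ π)) := by
  rw [lintegral_hash_eq_sum hh hX.measurable_sample hX.map_eq hX.measurable_hash r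
    (fun A hA => hX.law A hA r) hΦ hφ, sum_partitionWeight_mul h0 h1 _ fun π =>
      mul_nonneg (Finset.prod_nonneg fun B _ => hashWeight_nonneg r B) (hφ0 π)]
  simp_rw [Finset.prod_mul_distrib, mul_assoc]

/-- The probability that a sample has given hash values. -/
lemma IsHashedSample.measure_hash_eq [MeasurableEq S] (h0 : 0 < α) (h1 : α < 1) (hγ : -α < γ)
    (hm : 1 ≤ m) (hh : IsPairwiseIndependentHash Pr h)
    {X : Fin m → Ω → S} (hX : IsHashedSample Pr h α γ G₀ X) (r : Fin m → Fin J)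
    {c : Fin J → ℕ} (hc : ∀ k, (Finset.univ.filter fun i => r i = k).card = c k) :
    ∫⁻ _ in {ω | ∀ i, h ω (X i ω) = r i}, 1 ∂Pr =
      ENNReal.ofReal (samplingConstant α γ m * (bucketSum α (γ / α) c / α)) := by
  have hK : 0 < samplingConstant α γ m := by
    have : (1 : ℝ) ≤ m := by exact_mod_cast hm
    exact samplingConstant_pos h0 hγ (by linarith) (by linarith)
  have hcm : ∑ k, c k = m := by
    simp_rw [← hc]
    rw [← Finset.card_eq_sum_card_fiberwise (fun i _ => Finset.mem_univ (r i))]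
    simp
  rw [hX.lintegral_eq h0 h1 hh r (Φ := fun _ => 1) (φ := fun _ => 1) measurable_const
    (fun _ => zero_le_one) (fun _ _ _ => by simp), ENNReal.ofReal_mul hK.le,
    ← lintegral_prod_genFactorialPoly h0 h1 γ c
      fun i hi => add_mul_sum_pos_of_prod_ne_zero h0 hγ (hcm ▸ hm) i hi]
  congr 1
  refine setLIntegral_congr_fun measurableSet_Ioi fun u hu => ?_
  have hu' : (0 : ℝ) < u := hu
  have hZ := partitionSum_hash (α := α) r hu' Finset.univ
  rw [partitionSum] at hZ
  simp_rw [mul_one]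
  rw [hZ]
  simp_rw [hc]
  rw [prod_bucketFactor, hcm, show γ + m - 1 = γ - 1 + m by ring, Real.rpow_add hu',
    Real.rpow_natCast]
  congr 1
  field_simp

/-- The mean number of symbols of frequency `l`, on the event that a sample has given hash
values. -/
lemma IsHashedSample.lintegral_lCardinality [MeasurableEq S] (h0 : 0 < α) (h1 : α < 1)
    (hγ : -α < γ) (hm : 1 ≤ m) (hh : IsPairwiseIndependentHash Pr h)
    {X : Fin m → Ω → S} (hX : IsHashedSample Pr h α γ G₀ X) (r : Fin m → Fin J)
    {c : Fin J → ℕ} (hc : ∀ k, (Finset.univ.filter fun i => r i = k).card = c k)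
    {l : ℕ} (hl : 1 ≤ l) :
    ∫⁻ ω in {ω | ∀ i, h ω (X i ω) = r i},
        ENNReal.ofReal (lCardinality (fun i => X i ω) l : ℝ) ∂Pr =
      ENNReal.ofReal (samplingConstant α γ m * (risingFactorial (1 - α) (l - 1) * (J : ℝ)⁻¹ *
        ∑ j, ((c j).choose l : ℝ) *
          bucketSum α ((γ + α) / α) (fun k => c k - if k = j then l else 0))) := by
  have hK : 0 < samplingConstant α γ m := by
    have : (1 : ℝ) ≤ m := by exact_mod_cast hm
    exact samplingConstant_pos h0 hγ (by linarith) (by linarith)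
  have hcm : ∑ k, c k = m := by
    simp_rw [← hc]
    rw [← Finset.card_eq_sum_card_fiberwise (fun i _ => Finset.mem_univ (r i))]
    simp
  have hr := risingFactorial_nonneg (by linarith : 0 ≤ 1 - α) (l - 1)
  -- The truncated subtraction removes exactly `l` elements only if `l ≤ c j`; otherwise the
  -- binomial coefficient is zero.
  have hd : ∀ j, ((c j).choose l : ℝ) ≠ 0 →
      ∑ k, (c k - if k = j then l else 0) + l = m := by
    intro j hj
    have hlc : l ≤ c j := by
      by_contra hcon
      exact hj (by rw [Nat.choose_eq_zero_of_lt (not_le.1 hcon), Nat.cast_zero])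
    rw [← hcm, ← Finset.add_sum_erase _ _ (Finset.mem_univ j),
      ← Finset.add_sum_erase _ c (Finset.mem_univ j), if_pos rfl]
    have : ∑ k ∈ Finset.univ.erase j, (c k - if k = j then l else 0) =
        ∑ k ∈ Finset.univ.erase j, c k :=
      Finset.sum_congr rfl fun k hk => by rw [if_neg (Finset.mem_erase.1 hk).1, Nat.sub_zero]
    rw [this]
    omega
  rw [hX.lintegral_eq h0 h1 hh r (Φ := fun x => ENNReal.ofReal (lCardinality x l : ℝ))
    (φ := fun π => ((π.parts.filter fun B => B.card = l).card : ℝ)) ?_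
    (fun _ => Nat.cast_nonneg _) (fun π Y hY => by rw [lCardinality_comp_part π hY]),
    ENNReal.ofReal_mul hK.le, Finset.mul_sum, ENNReal.ofReal_sum_of_nonneg]
  rotate_left
  · intro j _
    have := bucketSum_nonneg h0 h1 hγ (fun k => c k - if k = j then l else 0)
    positivity
  · have := measurable_lCardinality (S := S) (n := m) hl
    fun_prop
  congr 1
  rw [← Finset.sum_congr rfl fun j _ => lintegral_blockWeight_mul_prod_bucketFactor (m := m)
    h0 h1 hγ (Nat.cast_nonneg ((c j).choose l)) (fun k => c k - if k = j then l else 0) (hd j),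
    ← lintegral_finsetSum]
  · refine setLIntegral_congr_fun measurableSet_Ioi fun u hu => ?_
    have hu' : (0 : ℝ) < u := hu
    rw [sum_prod_parts_mul_count r hu' Finset.univ hl]
    simp_rw [hc]
    rw [Finset.mul_sum, Finset.mul_sum, ENNReal.ofReal_sum_of_nonneg]
    intro j _
    have hb := blockWeight_nonneg h0 h1 hu' l
    have hp : 0 ≤ ∏ k, bucketFactor α J u (c k - if k = j then l else 0) :=
      Finset.prod_nonneg fun k _ => mul_nonneg (by positivity)
        (genFactorialPoly_eval_nonneg h0 h1 _ (by positivity))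
    positivity
  · intro j _
    have hb := measurable_blockWeight (α := α) l
    have hp : Measurable fun u => ∏ k, bucketFactor α J u (c k - if k = j then l else 0) :=
      Finset.measurable_prod _ fun k _ => measurable_bucketFactor _
    fun_prop

/-- The probability that the last symbol of a sample has frequency `l` among the others, on the
event that the sample has given hash values. -/
lemma IsHashedSample.lintegral_frequency [MeasurableEq S] (h0 : 0 < α) (h1 : α < 1)
    (hγ : -α < γ) (hn : 1 ≤ n) (hh : IsPairwiseIndependentHash Pr h)
    {X : Fin (n + 1) → Ω → S} (hX : IsHashedSample Pr h α γ G₀ X) (r : Fin n → Fin J) (j : Fin J)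
    {c : Fin J → ℕ} (hc : ∀ k, (Finset.univ.filter fun i => r i = k).card = c k) (l : ℕ) :
    ∫⁻ ω in {ω | ∀ i, h ω (X i ω) = (Fin.snoc r j : Fin (n + 1) → Fin J) i},
        ENNReal.ofReal (if frequency (fun i : Fin n => X i.castSucc ω) (X (Fin.last n) ω) = l
          then 1 else 0) ∂Pr =
      ENNReal.ofReal (samplingConstant α γ (n + 1) * (risingFactorial (1 - α) l * (J : ℝ)⁻¹ *
        (((c j).choose l : ℝ) *
          bucketSum α ((γ + α) / α) (fun k => c k - if k = j then l else 0)))) := by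
  have hn' : (1 : ℝ) ≤ n := by exact_mod_cast hn
  have hK : 0 < samplingConstant α γ (n + 1) :=
    samplingConstant_pos h0 hγ (by push_cast; linarith) (by linarith)
  have hcm : ∑ k, c k = n := by
    simp_rw [← hc]
    rw [← Finset.card_eq_sum_card_fiberwise (fun i _ => Finset.mem_univ (r i))]
    simp
  -- The appended point raises bucket `j` by one. Removing its block of size `l + 1` therefore
  -- lowers the original count `c j` by `l`.
  have hcount : ∀ k, (Finset.univ.filter fun i =>
      (Fin.snoc r j : Fin (n + 1) → Fin J) i = k).card = c k + if k = j then 1 else 0 := by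
    intro k
    rw [Finset.card_filter, Fin.sum_univ_castSucc, ← hc k, Finset.card_filter]
    simp [eq_comm]
  have hd : ((c j).choose l : ℝ) ≠ 0 →
      ∑ k, (c k - if k = j then l else 0) + (l + 1) = n + 1 := by
    intro hj
    have hlc : l ≤ c j := by
      by_contra hcon
      exact hj (by rw [Nat.choose_eq_zero_of_lt (not_le.1 hcon), Nat.cast_zero])
    rw [← hcm, ← Finset.add_sum_erase _ _ (Finset.mem_univ j),
      ← Finset.add_sum_erase _ c (Finset.mem_univ j), if_pos rfl]
    have : ∑ k ∈ Finset.univ.erase j, (c k - if k = j then l else 0) =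
        ∑ k ∈ Finset.univ.erase j, c k :=
      Finset.sum_congr rfl fun k hk => by rw [if_neg (Finset.mem_erase.1 hk).1, Nat.sub_zero]
    rw [this]
    omega
  have hmeas : Measurable fun x : Fin (n + 1) → S =>
      frequency (fun i : Fin n => x i.castSucc) (x (Fin.last n)) :=
    measurable_frequency.comp (g := fun p : (Fin n → S) × S => frequency p.1 p.2)
      (f := fun x : Fin (n + 1) → S => (fun i : Fin n => x i.castSucc, x (Fin.last n)))
      (by fun_prop)
  rw [hX.lintegral_eq h0 h1 hh (Fin.snoc r j) (Φ := fun x => ENNReal.ofReal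
      (if frequency (fun i : Fin n => x i.castSucc) (x (Fin.last n)) = l then 1 else 0))
    (φ := fun π => if (π.part (Fin.last n)).card = l + 1 then (1 : ℝ) else 0) ?_
    (fun π => by split_ifs <;> norm_num)
    (fun π Y hY => by simp only [← frequency_last_comp_part π hY, Nat.add_right_cancel_iff]),
    ENNReal.ofReal_mul hK.le]
  · congr 1
    have h2 := lintegral_blockWeight_mul_prod_bucketFactor (m := n + 1)
      h0 h1 hγ (Nat.cast_nonneg ((c j).choose l)) (fun k => c k - if k = j then l else 0) hd
    rw [Nat.add_sub_cancel] at h2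
    rw [← h2]
    refine setLIntegral_congr_fun measurableSet_Ioi fun u hu => ?_
    have hu' : (0 : ℝ) < u := hu
    rw [sum_prod_parts_mul_part _ hu' (Finset.mem_univ _)]
    simp_rw [hcount, Fin.snoc_last]
    rw [if_pos trivial, Nat.add_sub_cancel]
    have hsub : ∀ k, ((c k + if k = j then 1 else 0) - if k = j then l + 1 else 0) =
        c k - if k = j then l else 0 := by
      intro k
      split_ifs <;> omega
    simp_rw [hsub]
  · exact (Measurable.ite (hmeas (measurableSet_singleton l)) measurable_const
      measurable_const).ennreal_ofReal

end Posterior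

/-! ### The sketch as a union over hash values -/

lemma exists_fiber_card_eq {J n : ℕ} (c : Fin J → ℕ) (hc : ∑ j, c j = n) :
    ∃ r : Fin n → Fin J, ∀ k, (Finset.univ.filter fun i => r i = k).card = c k := by
  have hcard : Fintype.card (Fin n) = Fintype.card (Σ j, Fin (c j)) := by simp [hc]
  refine ⟨fun i => (Fintype.equivOfCardEq hcard i).1, fun k => ?_⟩
  rw [← Finset.card_map (Fintype.equivOfCardEq hcard).toEmbedding]
  have : (Finset.univ.filter fun i => (Fintype.equivOfCardEq hcard i).1 = k).map
      (Fintype.equivOfCardEq hcard).toEmbedding =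
      (Finset.univ : Finset (Fin (c k))).map (Function.Embedding.sigmaMk k) := by
    ext ⟨a, b⟩
    rw [Finset.mem_map_equiv]
    simp only [Finset.mem_filter, Finset.mem_univ, true_and,
      Equiv.apply_symm_apply, Finset.mem_map, Function.Embedding.sigmaMk_apply]
    constructor
    · rintro rfl
      exact ⟨b, rfl⟩
    · rintro ⟨b', hb⟩
      exact (congrArg Sigma.fst hb).symm
  rw [this]
  simp

/-- The sketch event is the disjoint union of the events with prescribed hash values whose bucket
counts are `c`. -/
lemma lintegral_sketch_eq_sum {Ω S : Type*} [MeasurableSpace Ω] {Pr : Measure Ω} {J n : ℕ}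
    {h : Ω → S → Fin J} {X' : Fin n → Ω → S}
    (hm : ∀ i, Measurable fun ω => h ω (X' i ω)) (c : Fin J → ℕ) (f : Ω → ℝ≥0∞) :
    ∫⁻ ω in {ω | sketch (h ω) (fun i => X' i ω) = c}, f ω ∂Pr =
      ∑ r : Fin n → Fin J with ∀ k, (Finset.univ.filter fun i => r i = k).card = c k,
        ∫⁻ ω in {ω | ∀ i, h ω (X' i ω) = r i}, f ω ∂Pr := by
  have hset : {ω | sketch (h ω) (fun i => X' i ω) = c} =
      ⋃ r ∈ Finset.univ.filter fun r : Fin n → Fin J =>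
        ∀ k, (Finset.univ.filter fun i => r i = k).card = c k, {ω | ∀ i, h ω (X' i ω) = r i} := by
    ext ω
    simp only [Set.mem_ofPred_eq, Set.mem_iUnion, Finset.mem_filter, Finset.mem_univ, true_and,
      exists_prop]
    constructor
    · intro H
      exact ⟨fun i => h ω (X' i ω), fun k => congrFun H k, fun _ => rfl⟩
    · rintro ⟨r, hr, H⟩
      funext k
      rw [← hr k, sketch]
      simp_rw [H]
  rw [hset, lintegral_biUnion_finset]
  · intro r _ r' _ hrr
    refine Set.disjoint_left.2 fun ω H H' => hrr (funext fun i => ?_)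
    exact (H i).symm.trans (H' i)
  · intro r _
    rw [Set.ofPred_forall]
    exact MeasurableSet.iInter fun i => hm i (measurableSet_singleton _)

lemma measurableSet_sketch {Ω S : Type*} [MeasurableSpace Ω] {J n : ℕ} {h : Ω → S → Fin J}
    {X' : Fin n → Ω → S}
    (hm : ∀ i, Measurable fun ω => h ω (X' i ω)) (c : Fin J → ℕ) :
    MeasurableSet {ω | sketch (h ω) (fun i => X' i ω) = c} := by
  have : Measurable fun ω (i : Fin n) => h ω (X' i ω) := measurable_pi_iff.2 hm
  exact this ((Set.toFinite {r : Fin n → Fin J |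
    (fun k => (Finset.univ.filter fun i => r i = k).card) = c}).measurableSet)

/-! ### From the sampling hypotheses to the hashed sample -/

section Assembly

variable {Ω S : Type*} [MeasurableSpace Ω] [MeasurableSpace S] {Pr : Measure Ω}
  [IsProbabilityMeasure Pr] {J n : ℕ} {h : Ω → S → Fin J} {α γ : ℝ}
  {G₀ : Measure S} [IsProbabilityMeasure G₀] {P : Ω → Measure S} {X : Fin (n + 1) → Ω → S}

lemma IsConditionallyIID.isHashedSample (h0 : 0 < α) (h1 : α < 1) (hγ : -α < γ)
    (hP : IsPitmanYor α γ G₀ (Pr.map P)) (hX : IsConditionallyIID Pr P X)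
    (hind : IsIndependentHash Pr h P X) : IsHashedSample Pr h α γ G₀ X where
  measurable_sample := hX.measurable_sample
  map_eq := by
    have hXm : Measurable fun ω i => X i ω := measurable_pi_iff.2 hX.measurable_sample
    have := Measure.isProbabilityMeasure_map (μ := Pr) hXm.aemeasurable
    refine eq_samplingLaw h0 h1 hγ hP (by omega) _ fun A hA => ?_
    have hm : Measurable fun ν : Measure S => ∏ i, ν (A i) :=
      Finset.measurable_prod _ fun i _ => Measure.measurable_coe (hA i)
    rw [Measure.map_apply hXm (MeasurableSet.univ_pi hA),
      lintegral_map hm hX.measurable_random_measure]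
    have := hX.law Set.univ MeasurableSet.univ A hA
    simp only [Set.mem_univ, true_and, Set.ofPred_true, Measure.restrict_univ] at this
    rw [← this]
    congr 1
    ext ω
    simp
  measurable_hash := hind.measurable_hash
  law A hA r := by
    have := hind.law Set.univ MeasurableSet.univ A hA r
    simpa only [Set.mem_univ, true_and] using this

/-- The last observation is marginalized out: its symbol is unrestricted, which costs nothing
because `P` almost surely has total mass one, and its hash value is summed over all buckets on both
sides of the independence identity. -/
lemma IsConditionallyIID.isHashedSample_castSucc (h0 : 0 < α) (h1 : α < 1) (hγ : -α < γ)
    (hn : 1 ≤ n) (hP : IsPitmanYor α γ G₀ (Pr.map P)) (hX : IsConditionallyIID Pr P X)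
    (hh : IsPairwiseIndependentHash Pr h) (hind : IsIndependentHash Pr h P X) :
    IsHashedSample Pr h α γ G₀ (fun i : Fin n => X i.castSucc) where
  measurable_sample i := hX.measurable_sample _
  map_eq := by
    have hXm : Measurable fun ω (i : Fin n) => X i.castSucc ω :=
      measurable_pi_iff.2 fun i => hX.measurable_sample _
    have := Measure.isProbabilityMeasure_map (μ := Pr) hXm.aemeasurable
    refine eq_samplingLaw h0 h1 hγ hP hn _ fun A hA => ?_
    have hm : Measurable fun ν : Measure S => ∏ i, ν (A i) :=
      Finset.measurable_prod _ fun i _ => Measure.measurable_coe (hA i)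
    rw [Measure.map_apply hXm (MeasurableSet.univ_pi hA),
      lintegral_map hm hX.measurable_random_measure]
    have hA' : ∀ i, MeasurableSet ((Fin.snoc A Set.univ : Fin (n + 1) → Set S) i) := by
      intro i
      refine Fin.lastCases ?_ (fun i => ?_) i
      · simp
      · simpa using hA i
    have := hX.law Set.univ MeasurableSet.univ (Fin.snoc A Set.univ) hA'
    simp only [Set.mem_univ, true_and, Set.ofPred_true, Measure.restrict_univ] at this
    have hone := ae_of_ae_map hX.measurable_random_measure.aemeasurable
      (hP.ae_univ_eq_one h0 h1)
    have hint : ∫⁻ ω, ∏ i, P ω (A i) ∂Pr =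
        ∫⁻ ω, ∏ i, P ω ((Fin.snoc A Set.univ : Fin (n + 1) → Set S) i) ∂Pr := by
      refine lintegral_congr_ae ?_
      filter_upwards [hone] with ω hω
      rw [Fin.prod_univ_castSucc]
      simp [hω]
    rw [hint, ← this]
    congr 1
    ext ω
    simp [Fin.forall_fin_succ']
  measurable_hash i := hind.measurable_hash _
  law A hA r := by
    have hproj : Measurable fun (x : Fin (n + 1) → S) (i : Fin n) => x i.castSucc := by fun_prop
    have hl := fun j : Fin J => hind.law Set.univ MeasurableSet.univ _ (hproj hA) (Fin.snoc r j)
    simp only [Set.mem_univ, true_and] at hl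
    have hXm : Measurable fun ω i => X i ω := measurable_pi_iff.2 hX.measurable_sample
    have hsplit : ∀ g : Fin (n + 1) → Fin J, ∀ j,
        (∀ i, g i = (Fin.snoc r j : Fin (n + 1) → Fin J) i) ↔
        (∀ i : Fin n, g i.castSucc = r i) ∧ g (Fin.last n) = j := by
      intro g j
      simp [Fin.forall_fin_succ']
    have hset : {ω | (fun i : Fin n => X i.castSucc ω) ∈ A ∧
        ∀ i : Fin n, h ω (X i.castSucc ω) = r i} =
        ⋃ j ∈ (Finset.univ : Finset (Fin J)), {ω | (fun i => X i ω) ∈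
          (fun (x : Fin (n + 1) → S) (i : Fin n) => x i.castSucc) ⁻¹' A ∧
          ∀ i, h ω (X i ω) = (Fin.snoc r j : Fin (n + 1) → Fin J) i} := by
      ext ω
      constructor
      · rintro ⟨hωA, H⟩
        exact Set.mem_iUnion₂.2 ⟨h ω (X (Fin.last n) ω), Finset.mem_univ _, hωA,
          (hsplit (fun i => h ω (X i ω)) _).2 ⟨H, rfl⟩⟩
      · intro H
        obtain ⟨j, _, hωA, H⟩ := Set.mem_iUnion₂.1 H
        exact ⟨hωA, ((hsplit (fun i => h ω (X i ω)) j).1 H).1⟩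
    have hmeas : ∀ j, MeasurableSet {ω | (fun i => X i ω) ∈
          (fun (x : Fin (n + 1) → S) (i : Fin n) => x i.castSucc) ⁻¹' A ∧
          ∀ i, h ω (X i ω) = (Fin.snoc r j : Fin (n + 1) → Fin J) i} := by
      intro j
      refine (hXm (hproj hA)).inter (s₂ := {ω | ∀ i, h ω (X i ω) =
        (Fin.snoc r j : Fin (n + 1) → Fin J) i}) ?_
      rw [Set.ofPred_forall]
      exact MeasurableSet.iInter fun i => hind.measurable_hash i (measurableSet_singleton _)
    rw [hset, measure_biUnion_finset ?_ fun j _ => hmeas j, Finset.sum_congr rfl fun j _ => hl j,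
      ← lintegral_finsetSum]
    · refine lintegral_congr fun ω => ?_
      have hset' : {ω' | ∀ i : Fin n, h ω' (X i.castSucc ω) = r i} =
          ⋃ j ∈ (Finset.univ : Finset (Fin J)), {ω' | ∀ i, h ω' (X i ω) =
            (Fin.snoc r j : Fin (n + 1) → Fin J) i} := by
        ext ω'
        constructor
        · intro H
          exact Set.mem_iUnion₂.2 ⟨h ω' (X (Fin.last n) ω), Finset.mem_univ _,
            (hsplit (fun i => h ω' (X i ω)) _).2 ⟨H, rfl⟩⟩
        · intro H
          obtain ⟨j, _, H⟩ := Set.mem_iUnion₂.1 H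
          exact ((hsplit (fun i => h ω' (X i ω)) j).1 H).1
      rw [hset', measure_biUnion_finset]
      · intro j _ j' _ hjj
        refine Set.disjoint_left.2 fun ω' H H' => hjj ?_
        exact ((hsplit (fun i => h ω' (X i ω)) j).1 H).2.symm.trans
          ((hsplit (fun i => h ω' (X i ω)) j').1 H').2
      · intro j _
        rw [Set.ofPred_forall]
        exact MeasurableSet.iInter fun i => hh.measurableSet_eq _ _
    · exact fun j _ => (hh.measurable_law (n + 1) (Fin.snoc r j)).comp hXm
    · intro j _ j' _ hjj
      refine Set.disjoint_left.2 fun ω H H' => hjj ?_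
      exact ((hsplit (fun i => h ω (X i ω)) j).1 H.2).2.symm.trans
        ((hsplit (fun i => h ω (X i ω)) j').1 H'.2).2

end Assembly

/-! ### Posterior given the sketch -/

theorem corollary1 {Ω S : Type*} [MeasurableSpace Ω] [MeasurableSpace S] [StandardBorelSpace S]
    (Pr : Measure Ω) [IsProbabilityMeasure Pr]
    (G₀ : Measure S) [IsProbabilityMeasure G₀] [NullSingletonClass G₀]
    (α γ : ℝ) (hα₀ : 0 < α) (hα₁ : α < 1) (hγ : -α < γ)
    (n J : ℕ) (hn : 1 ≤ n) (hJ : 1 ≤ J)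
    (P : Ω → Measure S) (X : Fin (n + 1) → Ω → S) (h : Ω → S → Fin J)
    (hP : IsPitmanYor α γ G₀ (Pr.map P))
    (hX : IsConditionallyIID Pr P X)
    (hh : IsPairwiseIndependentHash Pr h)
    (hind : IsIndependentHash Pr h P X)
    (c : Fin J → ℕ) (hc : ∑ j, c j = n) :
    -- the sketch takes the value `c` with positive probability
    0 < Pr {ω | sketch (h ω) (fun i : Fin n => X i.castSucc ω) = c} ∧
    -- the posterior law of the frequency of `X_{n+1}` given the sketch
    (∀ l ∈ Finset.Icc 1 n,
      (ProbabilityTheory.cond Pr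
          {ω | sketch (h ω) (fun i : Fin n => X i.castSucc ω) = c}).real
        {ω | frequency (fun i : Fin n => X i.castSucc ω) (X (Fin.last n) ω) = l} =
      frequencyClosedForm α γ n c l) ∧
    -- its relation to the posterior mean of the `l`-cardinality
    (∀ l ∈ Finset.Icc 1 n,
      (ProbabilityTheory.cond Pr
          {ω | sketch (h ω) (fun i : Fin n => X i.castSucc ω) = c}).real
        {ω | frequency (fun i : Fin n => X i.castSucc ω) (X (Fin.last n) ω) = l} =
      (l - α) / (γ + n) *
        ∫ ω, (lCardinality (fun i : Fin n => X i.castSucc ω) l : ℝ)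
          ∂(ProbabilityTheory.cond Pr
            {ω | sketch (h ω) (fun i : Fin n => X i.castSucc ω) = c})) ∧
    -- the posterior mean of the `l`-cardinality
    (∀ l ∈ Finset.Icc 1 n,
      ∫ ω, (lCardinality (fun i : Fin n => X i.castSucc ω) l : ℝ)
          ∂(ProbabilityTheory.cond Pr
            {ω | sketch (h ω) (fun i : Fin n => X i.castSucc ω) = c}) =
      (γ + n) / (l - α) * frequencyClosedForm α γ n c l) ∧
    -- the posterior mean of the number of distinct symbols
    ∫ ω, (cardinality (fun i : Fin n => X i.castSucc ω) : ℝ)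
        ∂(ProbabilityTheory.cond Pr
          {ω | sketch (h ω) (fun i : Fin n => X i.castSucc ω) = c}) =
      ∑ l ∈ Finset.Icc 1 n, (γ + n) / (l - α) * frequencyClosedForm α γ n c l := by
  set s := {ω | sketch (h ω) (fun i : Fin n => X i.castSucc ω) = c} with hs
  have hsamp := hX.isHashedSample hα₀ hα₁ hγ hP hind
  have hsamp' := hX.isHashedSample_castSucc hα₀ hα₁ hγ hn hP hh hind
  have hsm : MeasurableSet s := measurableSet_sketch hsamp'.measurable_hash c
  have hn' : (1 : ℝ) ≤ n := by exact_mod_cast hn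
  have hγn : 0 < γ + n := by linarith
  have hJ' : 0 < (J : ℝ) := by exact_mod_cast hJ
  set R := Finset.univ.filter fun r : Fin n → Fin J =>
    ∀ k, (Finset.univ.filter fun i => r i = k).card = c k with hR
  -- All `N` assignments of hash values with counts `c` contribute equally to each integral below,
  -- so `N` cancels after conditioning.
  set N : ℝ := (R.card : ℝ) with hN
  have hNpos : 0 < N := by
    obtain ⟨r, hr⟩ := exists_fiber_card_eq c hc
    have : 0 < R.card := Finset.card_pos.2 ⟨r, Finset.mem_filter.2 ⟨Finset.mem_univ _, hr⟩⟩
    exact Nat.cast_pos.2 this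
  set K := samplingConstant α γ n with hK
  have hKpos : 0 < K := samplingConstant_pos hα₀ hγ hγn (by linarith)
  -- The functional equation of the gamma function produces the denominator `γ + n` of the
  -- predictive probability.
  have hK1 : samplingConstant α γ (n + 1) = K / (γ + n) := by
    rw [hK, samplingConstant, samplingConstant]
    push_cast
    rw [← add_assoc, Real.Gamma_add_one hγn.ne']
    field_simp
  set b := bucketSum α (γ / α) c with hb
  have hbpos : 0 < b := bucketSum_pos hα₀ hα₁ hγ (hc ▸ hn)
  set σ : ℕ → ℝ := fun l => ∑ j, ((c j).choose l : ℝ) *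
    bucketSum α ((γ + α) / α) (fun k => c k - if k = j then l else 0) with hσ
  have hσ0 : ∀ l, 0 ≤ σ l := fun l => Finset.sum_nonneg fun j _ =>
    mul_nonneg (Nat.cast_nonneg _) (bucketSum_nonneg hα₀ hα₁ hγ _)
  have hrf : ∀ l, 0 ≤ risingFactorial (1 - α) l :=
    risingFactorial_nonneg (by linarith : 0 ≤ 1 - α)
  have hclosed : ∀ l, frequencyClosedForm α γ n c l =
      (α / J) / (γ + n) * risingFactorial (1 - α) l * (σ l / b) := by
    intro l
    rw [frequencyClosedForm, hσ, Finset.sum_div]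
    simp_rw [mul_div_assoc]
    rfl
  -- the probability of the sketch
  have hPs : Pr s = ENNReal.ofReal (N * (K * (b / α))) := by
    rw [← setLIntegral_one, hs, lintegral_sketch_eq_sum hsamp'.measurable_hash c,
      Finset.sum_congr rfl fun r hr => hsamp'.measure_hash_eq hα₀ hα₁ hγ hn hh r
        (Finset.mem_filter.1 hr).2, Finset.sum_const, nsmul_eq_mul,
      ENNReal.ofReal_mul hNpos.le, hN, ENNReal.ofReal_natCast]
  have hPspos : 0 < N * (K * (b / α)) := by positivity
  have hPsR : Pr.real s = N * (K * (b / α)) := by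
    rw [measureReal_def, hPs, ENNReal.toReal_ofReal hPspos.le]
  -- the posterior means of the cardinalities
  have hcond : ∀ f : Ω → ℝ, ∫ ω, f ω ∂(ProbabilityTheory.cond Pr s) =
      (Pr.real s)⁻¹ * ∫ ω in s, f ω ∂Pr := by
    intro f
    rw [ProbabilityTheory.cond, integral_smul_measure, ENNReal.toReal_inv, smul_eq_mul,
      measureReal_def]
  have hXm : Measurable fun ω (i : Fin n) => X i.castSucc ω :=
    measurable_pi_iff.2 hsamp'.measurable_sample
  have hMm : ∀ l, 1 ≤ l → Measurable fun ω =>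
      (lCardinality (fun i : Fin n => X i.castSucc ω) l : ℝ) := fun l hl =>
    (measurable_of_countable (fun k : ℕ => (k : ℝ))).comp ((measurable_lCardinality hl).comp hXm)
  have hmean : ∀ l ∈ Finset.Icc 1 n,
      ∫ ω, (lCardinality (fun i : Fin n => X i.castSucc ω) l : ℝ) ∂(ProbabilityTheory.cond Pr s) =
      risingFactorial (1 - α) (l - 1) * (J : ℝ)⁻¹ * σ l * α / b := by
    intro l hl
    have hl1 := (Finset.mem_Icc.1 hl).1
    have hval : 0 ≤ K * (risingFactorial (1 - α) (l - 1) * (J : ℝ)⁻¹ * σ l) :=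
      mul_nonneg hKpos.le (mul_nonneg (mul_nonneg (hrf _) (by positivity)) (hσ0 l))
    rw [hcond, integral_eq_lintegral_of_nonneg_ae (ae_of_all _ fun _ => Nat.cast_nonneg _)
      (hMm l hl1).aestronglyMeasurable, hPsR, hs,
      lintegral_sketch_eq_sum hsamp'.measurable_hash c, Finset.sum_congr rfl fun r hr =>
        hsamp'.lintegral_lCardinality hα₀ hα₁ hγ hn hh r (Finset.mem_filter.1 hr).2 hl1,
      Finset.sum_const, nsmul_eq_mul, ENNReal.toReal_mul, ENNReal.toReal_natCast,
      ENNReal.toReal_ofReal hval]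
    change (N * (K * (b / α)))⁻¹ * (N * (K * (risingFactorial (1 - α) (l - 1) * (J : ℝ)⁻¹ * σ l))) =
      _
    field_simp
  -- the posterior law of the frequency
  have hfm : Measurable fun ω => frequency (fun i : Fin n => X i.castSucc ω) (X (Fin.last n) ω) :=
    measurable_frequency.comp (hXm.prodMk (hX.measurable_sample _))
  have hfreq : ∀ l ∈ Finset.Icc 1 n, (ProbabilityTheory.cond Pr s).real
      {ω | frequency (fun i : Fin n => X i.castSucc ω) (X (Fin.last n) ω) = l} =
      frequencyClosedForm α γ n c l := by
    intro l hl
    set E := {ω | frequency (fun i : Fin n => X i.castSucc ω) (X (Fin.last n) ω) = l} with hE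
    have hEm : MeasurableSet E := hfm (measurableSet_singleton l)
    set f : Ω → ℝ≥0∞ := fun ω => ENNReal.ofReal
      (if frequency (fun i : Fin n => X i.castSucc ω) (X (Fin.last n) ω) = l then 1 else 0) with hf
    have hfE : f = E.indicator 1 := by
      funext ω
      by_cases hω : ω ∈ E
      · rw [Set.indicator_of_mem hω, hf]
        simp only
        rw [if_pos (show frequency _ _ = l from hω)]
        simp
      · rw [Set.indicator_of_notMem hω, hf]
        simp only
        rw [if_neg (show ¬ frequency _ _ = l from hω)]
        simp
    -- The sketch ignores the hash value of `X_{n+1}`; splitting by it produces the sum over buckets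
    -- in the closed form.
    have hsnoc : ∀ r : Fin n → Fin J,
        ∫⁻ ω in {ω | ∀ i : Fin n, h ω (X i.castSucc ω) = r i}, f ω ∂Pr =
        ∑ j, ∫⁻ ω in {ω | ∀ i, h ω (X i ω) = (Fin.snoc r j : Fin (n + 1) → Fin J) i}, f ω ∂Pr := by
      intro r
      have hsplit : ∀ ω, ∀ j, (∀ i, h ω (X i ω) = (Fin.snoc r j : Fin (n + 1) → Fin J) i) ↔
          (∀ i : Fin n, h ω (X i.castSucc ω) = r i) ∧ h ω (X (Fin.last n) ω) = j := by
        intro ω j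
        simp [Fin.forall_fin_succ']
      have hset : {ω | ∀ i : Fin n, h ω (X i.castSucc ω) = r i} =
          ⋃ j ∈ (Finset.univ : Finset (Fin J)),
            {ω | ∀ i, h ω (X i ω) = (Fin.snoc r j : Fin (n + 1) → Fin J) i} := by
        ext ω
        constructor
        · intro H
          exact Set.mem_iUnion₂.2 ⟨_, Finset.mem_univ _, (hsplit ω _).2 ⟨H, rfl⟩⟩
        · intro H
          obtain ⟨j, _, H⟩ := Set.mem_iUnion₂.1 H
          exact ((hsplit ω j).1 H).1
      rw [hset, lintegral_biUnion_finset]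
      · intro j _ j' _ hjj
        refine Set.disjoint_left.2 fun ω H H' => hjj ?_
        exact ((hsplit ω j).1 H).2.symm.trans ((hsplit ω j').1 H').2
      · intro j _
        rw [Set.ofPred_forall]
        exact MeasurableSet.iInter fun i => hind.measurable_hash i (measurableSet_singleton _)
    have hK1pos : 0 ≤ samplingConstant α γ (n + 1) := by
      rw [hK1]
      positivity
    have hPE : Pr (s ∩ E) = ENNReal.ofReal (N * (samplingConstant α γ (n + 1) *
        (risingFactorial (1 - α) l * (J : ℝ)⁻¹ * σ l))) := by
      have e1 : Pr (s ∩ E) = ∫⁻ ω in s, f ω ∂Pr := by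
        rw [hfE, lintegral_indicator_one hEm, Measure.restrict_apply hEm, Set.inter_comm]
      have e2 : ∀ r ∈ R, ∫⁻ ω in {ω | ∀ i : Fin n, h ω (X i.castSucc ω) = r i}, f ω ∂Pr =
          ENNReal.ofReal (samplingConstant α γ (n + 1) *
            (risingFactorial (1 - α) l * (J : ℝ)⁻¹ * σ l)) := by
        intro r hr
        rw [hsnoc, Finset.sum_congr rfl fun j _ => hsamp.lintegral_frequency hα₀ hα₁ hγ hn hh r j
          (Finset.mem_filter.1 hr).2 l, ← ENNReal.ofReal_sum_of_nonneg, ← Finset.mul_sum,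
          ← Finset.mul_sum]
        intro j _
        refine mul_nonneg hK1pos (mul_nonneg (mul_nonneg (hrf _) (by positivity)) ?_)
        exact mul_nonneg (Nat.cast_nonneg _) (bucketSum_nonneg hα₀ hα₁ hγ _)
      rw [e1, hs, lintegral_sketch_eq_sum hsamp'.measurable_hash c, Finset.sum_congr rfl e2,
        Finset.sum_const, nsmul_eq_mul, ENNReal.ofReal_mul hNpos.le, hN, ENNReal.ofReal_natCast]
    have hval : 0 ≤ N * (samplingConstant α γ (n + 1) *
        (risingFactorial (1 - α) l * (J : ℝ)⁻¹ * σ l)) :=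
      mul_nonneg hNpos.le (mul_nonneg hK1pos
        (mul_nonneg (mul_nonneg (hrf _) (by positivity)) (hσ0 l)))
    rw [measureReal_def, ProbabilityTheory.cond_apply hsm, ENNReal.toReal_mul, ENNReal.toReal_inv,
      hPs, hPE, ENNReal.toReal_ofReal hPspos.le, ENNReal.toReal_ofReal hval, hK1, hclosed]
    field_simp
  -- The last factor of `(1 - α)_{(l)}` is `l - α`; writing `l = k + 1` exposes it. It is positive
  -- since `l ≥ 1 > α`, so the relation can be inverted.
  have hrel : ∀ l ∈ Finset.Icc 1 n, 0 < (l : ℝ) - α ∧ frequencyClosedForm α γ n c l =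
      (l - α) / (γ + n) * (risingFactorial (1 - α) (l - 1) * (J : ℝ)⁻¹ * σ l * α / b) := by
    intro l hl
    obtain ⟨k, rfl⟩ : ∃ k, l = k + 1 := ⟨l - 1, (Nat.sub_add_cancel (Finset.mem_Icc.1 hl).1).symm⟩
    refine ⟨by push_cast; linarith [Nat.cast_nonneg (α := ℝ) k], ?_⟩
    rw [hclosed, Nat.add_sub_cancel, risingFactorial_succ]
    push_cast
    field_simp
    ring
  have hmean' : ∀ l ∈ Finset.Icc 1 n,
      ∫ ω, (lCardinality (fun i : Fin n => X i.castSucc ω) l : ℝ) ∂(ProbabilityTheory.cond Pr s) =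
      (γ + n) / (l - α) * frequencyClosedForm α γ n c l := by
    intro l hl
    obtain ⟨hpos, heq⟩ := hrel l hl
    rw [hmean l hl, heq]
    field_simp
  refine ⟨?_, hfreq, ?_, hmean', ?_⟩
  · rw [hPs]
    exact ENNReal.ofReal_pos.2 hPspos
  · intro l hl
    rw [hfreq l hl, hmean l hl, (hrel l hl).2]
  · have hprob : IsProbabilityMeasure (ProbabilityTheory.cond Pr s) :=
      ProbabilityTheory.cond_isProbabilityMeasure (by
        rw [hPs]
        exact (ENNReal.ofReal_pos.2 hPspos).ne')
    simp_rw [cardinality_eq_sum]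
    push_cast
    rw [integral_finsetSum]
    · exact Finset.sum_congr rfl hmean'
    · intro l hl
      refine Integrable.of_bound (hMm l (Finset.mem_Icc.1 hl).1).aestronglyMeasurable n
        (ae_of_all _ fun ω => ?_)
      rw [Real.norm_natCast]
      exact_mod_cast lCardinality_le _ l
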